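/- Let $X$ be a compact Hausdorff space, and for $x\in X$ let $C_x(X)$ be the ideal of the functions $f\in C(X)$ with $f(x)=0$. Let $W$ be a separable operator system, that is, a separable norm-closed self-adjoint linear subspace, containing the unit $1$, of a unital $C^*$-algebra $A$, with the matrix norms and the positive cones that $M_n(W)$ inherits from $M_n(A)$. Suppose that $W$ is a unital $C(X)$-module such that $C(X)$ acts contractively on each $M_n(W)$ (i.e. $\|fw\|\le\|f\|\,\|w\|$ for $f\in C(X)$, $w\in M_n(W)$, the action being entrywise) and $(fw)^*=\bar f\,w^*$ for $f\in C(X)$, $w\in W$. For $x\in X$ let $W_x=W/\overline{C_x(X)W}$ be the fibre at $x$, with quotient map $w\mapsto w_x$ (applied entrywise to matrices), unit $1_x$, the quotient norms on $M_n(W_x)=M_n(W)/\overline{C_x(X)M_n(W)}$, and the quotient cones: $y\in M_n(W_x)$ is positive if for every $\varepsilon>0$ there is $w\in M_n(W)$ with $w_x=y$ and $w+\varepsilon 1\ge 0$. Assume that for all $n\ge 1$ and all $w\in M_n(W)$ the map $x\mapsto\|w_x\|$ is continuous. (i) Suppose that $f\mapsto f\cdot 1$ is injective on $C(X)$, i.e.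 $W$ contains a copy of $C(X)$ (equivalently, no fibre of $W$ is zero). Then for every $n$ and every $x\in X$, every unital completely positive map $\phi:W_x\to M_n(\mathbb{C})$ admits a $C(X)$-linear unital completely positive extension $\varphi:W\to M_n(C(X))$, in the sense that $\varphi(w)(x)=\phi(w_x)$ for all $w\in W$. (ii) There exist a Hilbert $C(X)$-module $E$ and a $C(X)$-linear map $\Phi$ from $W$ to the algebra $\mathcal{L}_{C(X)}(E)$ of continuous adjointable $C(X)$-linear operators on $E$ such that, for every $x\in X$, $\Phi$ induces a map $\Phi_x:W_x\to\mathcal{L}(E_x)$, $\Phi_x(w_x)\xi_x=(\Phi(w)\xi)_x$ for $w\in W$, $\xi\in E$, and $\Phi_x$ is completely isometric. Here $E_x$ is the Hilbert space obtained from $E$ and the semi-inner product $\langle\xi,\eta\rangle(x)$ by separation and completion, and $\xi_x$ is the image of $\xi$ in $E_x$. -/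

import Mathlib

open scoped ComplexOrder

universe u v

noncomputable section

/-! ### Operator systems -/

/-- An operator system: a norm-closed, self-adjoint linear subspace of a unital C⋆-algebra that
contains the unit. Its matrix norms and matrix cones are those inherited from the C⋆-algebras
`M_n(A)`. -/
structure OperatorSystem (A : Type*) [CStarAlgebra A] extends Submodule ℂ A where
  one_mem' : (1 : A) ∈ carrier
  star_mem' : ∀ a ∈ carrier, star a ∈ carrier
  isClosed' : IsClosed carrier

/-- A map `φ` between spaces, where the source `V` carries a unit `e` and a family of matrix cones
`cone k ⊆ M_k(V)` and the target `B` is a unital C⋆-algebra, is unital completely positive if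
`φ e = 1` and all its entrywise amplifications `M_k(V) → M_k(B)` preserve positivity. (It is only
used for linear maps.) -/
structure IsUCP {V B : Type*} [CStarAlgebra B] [PartialOrder B] [StarOrderedRing B]
    (e : V) (cone : (k : ℕ) → Set (Matrix (Fin k) (Fin k) V)) (φ : V → B) : Prop where
  map_unit : φ e = 1
  map_cone : ∀ (k : ℕ), ∀ M ∈ cone k,
    (0 : CStarMatrix (Fin k) (Fin k) B) ≤ CStarMatrix.ofMatrix (M.map φ)

namespace OperatorSystem

section Basic

variable {A : Type*} [CStarAlgebra A]

instance : CoeSort (OperatorSystem A) (Type _) := ⟨fun W => W.toSubmodule⟩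

/-- The unit of an operator system. -/
def unit (W : OperatorSystem A) : W := ⟨1, W.one_mem'⟩

/-- The involution of an operator system. -/
def adj (W : OperatorSystem A) (w : W) : W := ⟨star (w : A), W.star_mem' w w.2⟩

/-- The inclusion `M_n(W) ⊆ M_n(A)`. -/
def toCStarMatrix (W : OperatorSystem A) {n : ℕ} (w : Matrix (Fin n) (Fin n) W) :
    CStarMatrix (Fin n) (Fin n) A :=
  CStarMatrix.ofMatrix (w.map fun a => (a : A))

variable [PartialOrder A] [StarOrderedRing A]

/-- The norm of `M_n(W)`. -/
def matNorm (W : OperatorSystem A) {n : ℕ} (w : Matrix (Fin n) (Fin n) W) : ℝ :=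
  ‖W.toCStarMatrix w‖

/-- The positive cone of `M_n(W)`. -/
def matCone (W : OperatorSystem A) (n : ℕ) : Set (Matrix (Fin n) (Fin n) W) :=
  {w | 0 ≤ W.toCStarMatrix w}

end Basic

section Module

variable {X : Type*} [TopologicalSpace X]
variable {A : Type*} [CStarAlgebra A]

/-- The closed subspace `C_x(X) W`, where `C_x(X)` is the ideal of the functions that vanish
at `x`. -/
def fibreKer (W : OperatorSystem A) [Module C(X, ℂ) W] (x : X) : Submodule ℂ W :=
  (Submodule.span ℂ {v : W | ∃ (f : C(X, ℂ)) (w : W), f x = 0 ∧ v = f • w}).topologicalClosure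

/-- The fibre `W_x = W / C_x(X) W`. -/
abbrev Fibre (W : OperatorSystem A) [Module C(X, ℂ) W] (x : X) : Type _ := W ⧸ W.fibreKer x

/-- The quotient map `w ↦ w_x`. -/
def toFibre (W : OperatorSystem A) [Module C(X, ℂ) W] (x : X) : W →ₗ[ℂ] W.Fibre x :=
  (W.fibreKer x).mkQ

/-- The unit of the fibre `W_x`. -/
def fibreUnit (W : OperatorSystem A) [Module C(X, ℂ) W] (x : X) : W.Fibre x :=
  W.toFibre x W.unit

variable [PartialOrder A] [StarOrderedRing A]

/-- The quotient norm of `M_n(W_x) = M_n(W) / C_x(X) M_n(W)`. -/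
def fibreNorm (W : OperatorSystem A) [Module C(X, ℂ) W] (x : X) {n : ℕ}
    (y : Matrix (Fin n) (Fin n) (W.Fibre x)) : ℝ :=
  sInf {r : ℝ | ∃ w : Matrix (Fin n) (Fin n) W, w.map (W.toFibre x) = y ∧ r = W.matNorm w}

/-- The positive cone of `M_n(W_x)` in the quotient operator system structure: `y` is positive if
for every `ε > 0` the matrix `y + ε 1` lifts to a positive element of `M_n(W)`. -/
def fibreCone (W : OperatorSystem A) [Module C(X, ℂ) W] (x : X) (n : ℕ) :
    Set (Matrix (Fin n) (Fin n) (W.Fibre x)) :=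
  {y | ∀ ε : ℝ, 0 < ε → ∃ w : Matrix (Fin n) (Fin n) W, w.map (W.toFibre x) = y ∧
    0 ≤ W.toCStarMatrix w + (ε : ℂ) • (1 : CStarMatrix (Fin n) (Fin n) A)}

/-- Compatibility of a (unital) `C(X)`-module structure with the operator system structure:
`C(X)` acts contractively on each of the Banach spaces `M_n(W)`, and the action respects the
involutions. -/
structure IsCXModule [CompactSpace X] (W : OperatorSystem A) [Module C(X, ℂ) W] : Prop where
  matNorm_smul_le : ∀ (n : ℕ) (f : C(X, ℂ)) (w : Matrix (Fin n) (Fin n) W),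
    W.matNorm (f • w) ≤ ‖f‖ * W.matNorm w
  adj_smul : ∀ (f : C(X, ℂ)) (w : W), W.adj (f • w) = star f • W.adj w

end Module

end OperatorSystem

/-! ### Hilbert `C(X)`-modules -/

namespace HilbertCX

variable {X : Type*} [TopologicalSpace X] [CompactSpace X]

/-- Membership in `L_{C(X)}(E)`: continuous `C(X)`-linear operators that have an adjoint. -/
def IsAdjointable {E : Type*} [NormedAddCommGroup E] [NormedSpace ℂ E] [Module C(X, ℂ) E]
    [CStarModule C(X, ℂ) E] (T : E →ₗ[C(X, ℂ)] E) : Prop :=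
  Continuous T ∧ ∃ S : E → E, ∀ ξ η : E, inner C(X, ℂ) (T ξ) η = inner C(X, ℂ) ξ (S η)

/-- A copy of `E`, to be given the semi-inner product `⟨ξ, η⟩(x)`. -/
@[nolint unusedArguments]
def PreFibre (E : Type*) (_x : X) : Type _ := E

section Fibre

variable (E : Type*) [NormedAddCommGroup E] [NormedSpace ℂ E] [Module C(X, ℂ) E]
  [CStarModule C(X, ℂ) E] (x : X)

instance : AddCommGroup (PreFibre E x) := inferInstanceAs (AddCommGroup E)
instance : Module ℂ (PreFibre E x) := inferInstanceAs (Module ℂ E)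

/-- The semi-inner product `⟨ξ, η⟩(x)` on `E`. -/
abbrev preFibreCore : PreInnerProductSpace.Core ℂ (PreFibre E x) where
  inner ξ η := (inner C(X, ℂ) (show E from ξ) (show E from η)) x
  conj_inner_symm ξ η := by
    have h := CStarModule.star_inner (A := C(X, ℂ)) (show E from η) (show E from ξ)
    have h' := congrArg (fun g : C(X, ℂ) => g x) h
    simpa using h'
  re_inner_nonneg ξ := by
    have h := CStarModule.inner_self_nonneg (A := C(X, ℂ)) (x := (show E from ξ))
    exact (RCLike.nonneg_iff.mp (h x)).1
  add_left ξ η ζ := by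
    have h := CStarModule.inner_add_left (A := C(X, ℂ)) (x := (show E from ξ))
      (y := (show E from η)) (z := (show E from ζ))
    exact congrArg (fun g : C(X, ℂ) => g x) h
  smul_left ξ η c := by
    have h := CStarModule.inner_smul_left_complex (A := C(X, ℂ)) (z := c) (x := (show E from ξ))
      (y := (show E from η))
    exact congrArg (fun g : C(X, ℂ) => g x) h

instance : SeminormedAddCommGroup (PreFibre E x) :=
  InnerProductSpace.Core.toSeminormedAddCommGroup (c := preFibreCore E x)

instance : InnerProductSpace ℂ (PreFibre E x) :=
  InnerProductSpace.ofCore (preFibreCore E x)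

/-- The fibre `E_x` of a Hilbert `C(X)`-module: the Hilbert space obtained from `E` and the
semi-inner product `⟨ξ, η⟩(x)` by separation and completion. -/
abbrev Fibre : Type _ := UniformSpace.Completion (PreFibre E x)

variable {E}

/-- The canonical map `ξ ↦ ξ_x` from `E` to `E_x`; its range is dense. -/
def toFibre (ξ : E) : Fibre E x := ((show PreFibre E x from ξ : PreFibre E x) : Fibre E x)

end Fibre

end HilbertCX

end

/-! A positive functional on `M_m(W)` is the same thing as a completely positive map from `W` to
`M_m(ℂ)`. A continuous family of states of the fibres of `M_m(W)` is therefore a `C(X)`-linear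
completely positive map into `M_m(C(X))`, and the theorem is reduced to extending a state of one
fibre to such a family.

The action is only assumed contractive, so positivity has to be extracted from norms. Comparing the
norms of `w + l • 1` and of its rotation by a unitary function, for large `l`, yields `clamp s • w ≤
θ (clamp (s + 4))` for self-adjoint contractions `w`, where `θ f` is the image of `f • 1`. Cutting
`N • f` into layers and dividing by `N` removes the shift by 4 and gives `f • w ≤ θ f` for `0 ≤ f ≤
1`. Hence nonnegative functions preserve the positive cones (`ι_smul_nonneg`).

The fibre norm is `N y w`, the infimum of `‖h • w‖` over bump functions `h` at `y`. By positivity of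
the action it behaves like the norm of an operator system: `N (v + μ e) = N v + μ N e` for `v ≥ 0`.
So `P y w = N (re w + l e) - l N e`, with `l` at least the norm of `w`, is sublinear, and the real
functionals below it are the real parts of the fibre states. As `P` is continuous in `y`, the
Hahn–Banach theorem and compactness of the unit sphere show that the sets of fibre states vary lower
semicontinuously. By separability a state is coded by a weighted sequence of values on a dense
sequence, and Michael's selection theorem, with a prescribed value at one point, extends a state
(`IsFibreState.exists_extension`).

For (i), the state that belongs to `φ` is extended. The resulting completely positive map is unital
at `x` only; it is shrunk by a function `K` and completed by a scalar state times a positive matrix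
function that vanishes at `x`.

For (ii), a state attaining `P` at the block matrix with corners `w` and `w⋆` is extended and
normalised to a completely contractive map into matrices over `C(X)` that nearly attains the norm of
`w` in the fibre (`exists_isCCMap`). The direct sum of all completely contractive maps of this kind
acts on `C(X, H)`, where `H` is the Hilbert sum of the spaces involved. The fibres of this module
are copies of `H`, and there the sum is completely isometric. -/

set_option linter.unusedSectionVars false

section

open ContinuousMap Filter Topology

/-! ### Order and norm inequalities in a unital C⋆-algebra. -/

section CStarInequalities

variable {B : Type*} [CStarAlgebra B] [PartialOrder B] [StarOrderedRing B]

theorem IsSelfAdjoint.le_smul_one_of_norm_le {a : B} (ha : IsSelfAdjoint a) {r : ℝ}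
    (h : ‖a‖ ≤ r) : a ≤ r • (1 : B) := by
  refine ha.le_algebraMap_norm_self.trans ?_
  rw [Algebra.algebraMap_eq_smul_one]
  exact smul_le_smul_of_nonneg_right h zero_le_one

theorem CStarAlgebra.norm_sq_le_of_star_mul_self_le {a : B} {r : ℝ} (hr : 0 ≤ r)
    (h : star a * a ≤ r • (1 : B)) : ‖a‖ ^ 2 ≤ r := by
  rw [← Algebra.algebraMap_eq_smul_one] at h
  rw [pow_two, ← CStarRing.norm_star_mul_self]
  exact (CStarAlgebra.norm_le_iff_le_algebraMap _ hr (star_mul_self_nonneg a)).2 h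

theorem CStarAlgebra.star_mul_self_le_smul_one {a : B} {r : ℝ} (h : ‖a‖ ≤ r) :
    star a * a ≤ (r ^ 2) • (1 : B) := by
  refine (IsSelfAdjoint.star_mul_self a).le_smul_one_of_norm_le ?_
  rw [CStarRing.norm_star_mul_self, pow_two]
  exact mul_self_le_mul_self (norm_nonneg _) h

theorem CStarAlgebra.norm_le_of_nonneg_of_le_smul_one {a : B} {r : ℝ} (hr : 0 ≤ r) (ha : 0 ≤ a)
    (h : a ≤ r • (1 : B)) : ‖a‖ ≤ r := by
  rw [← Algebra.algebraMap_eq_smul_one] at h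
  exact (CStarAlgebra.norm_le_iff_le_algebraMap _ hr ha).2 h

theorem CStarAlgebra.le_of_forall_le_add_smul_one {a b : B}
    (h : ∀ ε : ℝ, 0 < ε → a ≤ b + ε • (1 : B)) : a ≤ b := by
  have hc : Filter.Tendsto (fun ε : ℝ => b + ε • (1 : B)) (nhdsWithin 0 (Set.Ioi 0)) (nhds b) := by
    have : Continuous fun ε : ℝ => b + ε • (1 : B) := by fun_prop
    simpa using (this.tendsto 0).mono_left nhdsWithin_le_nhds
  exact ge_of_tendsto hc (Filter.eventually_of_mem self_mem_nhdsWithin fun ε hε => h ε hε)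

theorem CStarAlgebra.nonneg_of_forall_nonneg_add_smul_one {b : B}
    (h : ∀ ε : ℝ, 0 < ε → 0 ≤ b + ε • (1 : B)) : 0 ≤ b :=
  CStarAlgebra.le_of_forall_le_add_smul_one h

end CStarInequalities

/-- The inclusion of the real-valued functions in `C(X, ℂ)`. -/
noncomputable def ContinuousMap.ofRealC {X : Type*} [TopologicalSpace X] :
    C(X, ℝ) →+* C(X, ℂ) :=
  Complex.ofRealHom.compLeftContinuous X Complex.continuous_ofReal

namespace ContinuousMap

variable {X : Type*} [TopologicalSpace X]

@[simp] theorem ofRealC_apply (f : C(X, ℝ)) (x : X) : ofRealC f x = (f x : ℂ) := rfl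

@[simp] theorem star_ofRealC (f : C(X, ℝ)) : star (ofRealC f) = ofRealC f := by
  ext x; simp

theorem ofRealC_smul (r : ℝ) (f : C(X, ℝ)) : ofRealC (r • f) = (r : ℂ) • ofRealC f := by
  ext x; simp

theorem norm_ofRealC_le [CompactSpace X] {f : C(X, ℝ)} {r : ℝ} (hr : 0 ≤ r)
    (h : ∀ x, |f x| ≤ r) : ‖ofRealC f‖ ≤ r := by
  rw [ContinuousMap.norm_le _ hr]
  intro x
  simpa using h x

end ContinuousMap


/-! ### The action of `C(X)` and the positive unital map `θ`. -/

/-- A `C(X)`-module `V` with a map `ι` to a C⋆-algebra whose range is a self-adjoint subspace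
containing the unit, such that `C(X)` acts contractively and compatibly with the involution. -/
structure CXSystem (X V B : Type*) [TopologicalSpace X] [CompactSpace X] [AddCommGroup V]
    [Module ℂ V] [Module C(X, ℂ) V] [CStarAlgebra B] where
  ι : V →ₗ[ℂ] B
  e : V
  adj : V → V
  ι_e : ι e = 1
  ι_smul_adj : ∀ (f : C(X, ℂ)) (w : V), ι (f • adj w) = star (ι (star f • w))
  norm_smul_le : ∀ (f : C(X, ℂ)) (w : V), ‖ι (f • w)‖ ≤ ‖f‖ * ‖ι w‖

namespace CXSystem

variable {X V B : Type*} [TopologicalSpace X] [CompactSpace X] [AddCommGroup V]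
    [Module ℂ V] [Module C(X, ℂ) V] [IsScalarTower ℂ C(X, ℂ) V] [CStarAlgebra B]
    (D : CXSystem X V B)

/-- The map `f ↦ ι (f • e)`. -/
noncomputable def θ (f : C(X, ℂ)) : B := D.ι (f • D.e)

theorem ι_complex_smul (c : ℂ) (w : V) : D.ι (c • w) = c • D.ι w := map_smul D.ι c w

theorem ι_adj (w : V) : D.ι (D.adj w) = star (D.ι w) := by
  simpa using D.ι_smul_adj 1 w

/-- `ι` need not be injective; contractivity makes the action descend to its range. -/
theorem ι_smul_eq_of_ι_eq {w w' : V} (h : D.ι w = D.ι w') (f : C(X, ℂ)) :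
    D.ι (f • w) = D.ι (f • w') := by
  have := D.norm_smul_le f (w - w')
  rw [map_sub, h, sub_self, norm_zero, mul_zero, smul_sub, map_sub] at this
  exact sub_eq_zero.1 (norm_le_zero_iff.1 this)

theorem isSelfAdjoint_smul {w : V} (hw : IsSelfAdjoint (D.ι w)) (f : C(X, ℝ)) :
    IsSelfAdjoint (D.ι (ofRealC f • w)) := by
  have h := D.ι_smul_adj (ofRealC f) w
  rw [star_ofRealC] at h
  rw [IsSelfAdjoint, ← h]
  exact D.ι_smul_eq_of_ι_eq (by rw [D.ι_adj, hw.star_eq]) _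

@[simp] theorem θ_one : D.θ 1 = 1 := by simp [θ, D.ι_e]

theorem θ_add (f g : C(X, ℂ)) : D.θ (f + g) = D.θ f + D.θ g := by simp [θ, add_smul]

theorem θ_sub (f g : C(X, ℂ)) : D.θ (f - g) = D.θ f - D.θ g := by simp [θ, sub_smul]

theorem θ_smul (c : ℂ) (f : C(X, ℂ)) : D.θ (c • f) = c • D.θ f := by simp [θ, smul_assoc]

theorem θ_sum {α : Type*} (s : Finset α) (f : α → C(X, ℂ)) :
    D.θ (∑ i ∈ s, f i) = ∑ i ∈ s, D.θ (f i) := by simp [θ, Finset.sum_smul]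

theorem θ_star (f : C(X, ℂ)) : D.θ (star f) = star (D.θ f) := by
  have h := D.ι_smul_adj (star f) D.e
  rw [star_star] at h
  rw [θ, θ, ← h]
  exact D.ι_smul_eq_of_ι_eq (by rw [D.ι_adj, D.ι_e, star_one]) _

theorem norm_θ_le (f : C(X, ℂ)) : ‖D.θ f‖ ≤ ‖f‖ := by
  refine (D.norm_smul_le f D.e).trans ?_
  rw [D.ι_e]
  refine mul_le_of_le_one_right (norm_nonneg _) ?_
  rcases subsingleton_or_nontrivial B with h | h
  · rw [Subsingleton.elim (1 : B) 0, norm_zero]; exact zero_le_one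
  · exact CStarRing.norm_one.le

theorem isSelfAdjoint_θ (f : C(X, ℝ)) : IsSelfAdjoint (D.θ (ofRealC f)) := by
  rw [IsSelfAdjoint, ← θ_star, star_ofRealC]

variable [PartialOrder B] [StarOrderedRing B]

/-- The function `1 - f` also takes values in `[0, 1]`, so `1 - θ f` is a self-adjoint contraction
and is at most `1`. -/
theorem θ_nonneg_of_le_one {f : C(X, ℝ)} (h0 : ∀ x, 0 ≤ f x) (h1 : ∀ x, f x ≤ 1) :
    0 ≤ D.θ (ofRealC f) := by
  have h : ‖D.θ (ofRealC (1 - f))‖ ≤ 1 := (D.norm_θ_le _).trans <|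
    norm_ofRealC_le zero_le_one fun x => by
      have := h0 x; have := h1 x
      change |1 - f x| ≤ 1; rw [abs_le]; constructor <;> linarith
  have h2 := (D.isSelfAdjoint_θ (1 - f)).le_smul_one_of_norm_le h
  rw [map_sub, map_one, θ_sub, θ_one, one_smul] at h2
  simpa using h2

theorem θ_nonneg {f : C(X, ℝ)} (h0 : ∀ x, 0 ≤ f x) : 0 ≤ D.θ (ofRealC f) := by
  have hb : ∀ x, f x ≤ ‖f‖ := fun x => (le_abs_self _).trans (f.norm_coe_le_norm x)
  rcases eq_or_lt_of_le (norm_nonneg f) with h | h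
  · have : f = 0 := norm_eq_zero.1 h.symm
    simp [this, θ]
  · have := D.θ_nonneg_of_le_one (f := ‖f‖⁻¹ • f)
      (fun x => mul_nonneg (inv_nonneg.2 h.le) (h0 x))
      (fun x => by
        change ‖f‖⁻¹ * f x ≤ 1
        rw [inv_mul_le_iff₀ h, mul_one]; exact hb x)
    have h2 : ofRealC f = (‖f‖ : ℂ) • ofRealC (‖f‖⁻¹ • f) := by
      rw [← ofRealC_smul, smul_smul, mul_inv_cancel₀ h.ne', one_smul]
    rw [h2, θ_smul]
    have h3 : (‖f‖ : ℂ) • D.θ (ofRealC (‖f‖⁻¹ • f)) = ‖f‖ • D.θ (ofRealC (‖f‖⁻¹ • f)) :=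
      Complex.coe_smul _ _
    rw [h3]
    exact smul_nonneg h.le this

theorem θ_mono {f g : C(X, ℝ)} (h : ∀ x, f x ≤ g x) : D.θ (ofRealC f) ≤ D.θ (ofRealC g) := by
  have := D.θ_nonneg (f := g - f) fun x => by simpa using h x
  rwa [map_sub, θ_sub, sub_nonneg] at this

/-! ### Order bounds obtained by rotating with unitary functions. -/

/-- If `u` fixes `a` and rotates `1 - c` by `-i`, then `a • w` is dominated by multiples of `c`,
up to a small multiple of the unit. -/
theorem ι_smul_le_of_rotation {a c : C(X, ℝ)} {u : C(X, ℂ)} (hu : ‖u‖ ≤ 1)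
    (hua : u * ofRealC a = ofRealC a)
    (huc : u * ofRealC (1 - c) = (-Complex.I) • ofRealC (1 - c))
    (hc0 : ∀ x, 0 ≤ c x) (hc1 : ∀ x, c x ≤ 1) {w : V} (hw : IsSelfAdjoint (D.ι w))
    {l : ℝ} (hl : 0 < l) :
    D.ι (ofRealC a • w) ≤ l • D.θ (ofRealC c) + (‖D.ι (ofRealC a • w)‖ ^ 2 / l) • (1 : B) := by
  set y := D.ι (ofRealC a • w) with hy
  have hysa : star y = y := (D.isSelfAdjoint_smul hw a).star_eq
  set t := D.θ (ofRealC c) with ht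
  have htsa : star t = t := (D.isSelfAdjoint_θ c).star_eq
  have ht0 : 0 ≤ t := D.θ_nonneg hc0
  have hq : D.θ (ofRealC (1 - c)) = 1 - t := by rw [map_sub, map_one, θ_sub, θ_one]
  have hq0 : 0 ≤ 1 - t := by rw [← hq]; exact D.θ_nonneg fun x => by simpa using hc1 x
  set z := y + (Complex.I * l) • (1 - t) with hz
  -- The contraction `u` turns the imaginary multiple of `1 - t` in `z` into a real one, for which a
  -- norm bound is an order bound.
  have hrot : y + l • (1 - t) = D.ι (u • (ofRealC a • w + (Complex.I * l) •
      (ofRealC (1 - c) • D.e))) := by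
    rw [smul_add, smul_smul, hua, smul_comm u, smul_smul, huc, map_add, D.ι_complex_smul,
      smul_assoc, D.ι_complex_smul, smul_smul]
    have : D.ι (ofRealC (1 - c) • D.e) = 1 - t := hq
    rw [this]
    congr 1
    have h4 : Complex.I * l * -Complex.I = (l : ℂ) := by
      linear_combination (-(l : ℂ)) * Complex.I_mul_I
    rw [h4]; exact (Complex.coe_smul _ _).symm
  have hnorm : ‖y + l • (1 - t)‖ ≤ ‖z‖ := by
    rw [hrot]
    refine (D.norm_smul_le _ _).trans ?_
    rw [map_add, D.ι_complex_smul]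
    have : D.ι (ofRealC (1 - c) • D.e) = 1 - t := hq
    rw [this]
    exact mul_le_of_le_one_left (norm_nonneg _) hu
  have hyy : star y * y ≤ (‖y‖ ^ 2) • (1 : B) := CStarAlgebra.star_mul_self_le_smul_one le_rfl
  have hcomm : 0 ≤ t * (1 - t) :=
    (Commute.one_right t |>.sub_right (Commute.refl t)).mul_nonneg ht0 hq0
  have hsq : 0 ≤ star ((l : ℂ) • t - Complex.I • y) * ((l : ℂ) • t - Complex.I • y) :=
    star_mul_self_nonneg _
  -- The cross terms of `star z * z` form `l` times a commutator of `y` and `t`. They cancel against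
  -- those of the square of `l t - i y`, and what remains is bounded by `t² + (1 - t)² ≤ 1`.
  have hzz : star z * z ≤ (l ^ 2 + 2 * ‖y‖ ^ 2) • (1 : B) := by
    have key : (l ^ 2 + 2 * ‖y‖ ^ 2) • (1 : B) - star z * z
        = star ((l : ℂ) • t - Complex.I • y) * ((l : ℂ) • t - Complex.I • y)
          + (2 : ℝ) • ((‖y‖ ^ 2) • (1 : B) - star y * y) + (2 * l ^ 2) • (t * (1 - t)) := by
      have hr : ∀ (r : ℝ) (b : B), r • b = (r : ℂ) • b := fun r b => (Complex.coe_smul r b).symm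
      simp only [hz, star_add, star_sub, star_smul, hysa, htsa, star_one, hr, mul_add, add_mul,
        mul_sub, sub_mul, smul_mul_assoc, mul_smul_comm, mul_one, one_mul, smul_sub, smul_add,
        smul_smul, RCLike.star_def, map_mul, Complex.conj_I, Complex.conj_ofReal]
      push_cast
      match_scalars <;> ring_nf <;> simp only [Complex.I_sq] <;> ring
    rw [← sub_nonneg, key]
    refine add_nonneg (add_nonneg hsq (smul_nonneg zero_le_two (sub_nonneg.2 hyy)))
      (smul_nonneg (by positivity) hcomm)
  have hzn : ‖z‖ ^ 2 ≤ l ^ 2 + 2 * ‖y‖ ^ 2 :=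
    CStarAlgebra.norm_sq_le_of_star_mul_self_le (by positivity) hzz
  have hbound : ‖y + l • (1 - t)‖ ≤ l + ‖y‖ ^ 2 / l := by
    refine hnorm.trans ((sq_le_sq₀ (norm_nonneg _) (by positivity)).1 ?_)
    refine hzn.trans ?_
    have : (l + ‖y‖ ^ 2 / l) ^ 2 = l ^ 2 + 2 * ‖y‖ ^ 2 + (‖y‖ ^ 2 / l) ^ 2 := by
      field_simp; ring
    rw [this]
    nlinarith [sq_nonneg (‖y‖ ^ 2 / l)]
  have hsa : IsSelfAdjoint (y + l • (1 - t)) := by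
    rw [IsSelfAdjoint, star_add, star_smul, star_sub, hysa, htsa, star_one, star_trivial]
  have := hsa.le_smul_one_of_norm_le hbound
  rw [add_smul, smul_sub] at this
  have h5 : y ≤ l • (1 : B) + (‖y‖ ^ 2 / l) • (1 : B) - (l • (1 : B) - l • t) :=
    le_sub_iff_add_le.2 this
  refine h5.trans (le_of_eq ?_)
  abel

end CXSystem

/-- A finite partition of unity subordinate to a neighbourhood assignment on a compact space. -/
theorem exists_finite_partition_of_unity {X : Type*} [TopologicalSpace X] [CompactSpace X]
    [T2Space X] (U : X → Set X) (hU : ∀ x, IsOpen (U x)) (hx : ∀ x, x ∈ U x) :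
    ∃ (n : ℕ) (p : Fin n → X) (χ : Fin n → C(X, ℝ)), (∀ l x, 0 ≤ χ l x) ∧
      (∀ x, ∑ l, χ l x = 1) ∧ ∀ l x, χ l x ≠ 0 → x ∈ U (p l) := by
  obtain ⟨t, ht⟩ := isCompact_univ.elim_finite_subcover U hU
    fun x _ => Set.mem_iUnion.2 ⟨x, hx x⟩
  have hcov : Set.univ ⊆ ⋃ l : Fin t.card, U (t.equivFin.symm l) := by
    intro x hx
    obtain ⟨y, hy, hxy⟩ := Set.mem_iUnion₂.1 (ht hx)
    exact Set.mem_iUnion.2 ⟨t.equivFin ⟨y, hy⟩, by simpa using hxy⟩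
  obtain ⟨χ, h1, h2, h3, -⟩ := exists_continuous_sum_one_of_isOpen_isCompact
    (fun l : Fin t.card => hU (t.equivFin.symm l)) isCompact_univ hcov
  refine ⟨t.card, fun l => t.equivFin.symm l, χ, fun l x => (h3 l x).1, fun x => ?_,
    fun l x h => h1 l (subset_tsupport _ h)⟩
  simpa using h2 (Set.mem_univ x)

namespace CXSystem

variable {X V B : Type*} [TopologicalSpace X] [CompactSpace X] [AddCommGroup V]
    [Module ℂ V] [Module C(X, ℂ) V] [IsScalarTower ℂ C(X, ℂ) V] [CStarAlgebra B]
    (D : CXSystem X V B) [PartialOrder B] [StarOrderedRing B]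

/-- The Schwarz inequality for `θ`, with a weight `m`. -/
theorem schwarz_weighted [T2Space X] {m : C(X, ℝ)} (hm : ∀ x, 0 ≤ m x) (g : C(X, ℂ)) (b : B) :
    0 ≤ star b * D.θ (ofRealC m) * b - star b * D.θ (ofRealC m * g)
      - D.θ (ofRealC m * star g) * b + D.θ (ofRealC m * (star g * g)) := by
  set K : ℝ := ‖b‖ * ‖ofRealC m‖ + ‖ofRealC m‖ * ‖b‖ + ‖ofRealC m‖ * (2 * ‖g‖ + 1) with hK
  have hK0 : 0 ≤ K := by positivity
  set Q := star b * D.θ (ofRealC m) * b - star b * D.θ (ofRealC m * g)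
      - D.θ (ofRealC m * star g) * b + D.θ (ofRealC m * (star g * g)) with hQ
  have hQsa : IsSelfAdjoint Q := by
    simp only [IsSelfAdjoint, hQ, star_add, star_sub, star_mul, star_star, ← θ_star, star_ofRealC,
      mul_comm, mul_left_comm, mul_assoc]
    abel
  have main : ∀ ε : ℝ, 0 < ε → ε ≤ 1 → 0 ≤ Q + (ε * K) • (1 : B) := by
    intro ε hε hε1
    obtain ⟨n, p, χ, h0, h1, h2⟩ := exists_finite_partition_of_unity
      (fun x => {y | ‖g y - g x‖ < ε})
      (fun x => isOpen_lt (by fun_prop) continuous_const) (fun x => by simpa using hε)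
    set G : C(X, ℂ) := ∑ l, g (p l) • ofRealC (χ l) with hG
    set G2 : C(X, ℂ) := ∑ l, (star (g (p l)) * g (p l)) • ofRealC (χ l) with hG2
    have hχ1 : ∑ l, ofRealC (χ l) = 1 := by
      ext x
      simp only [ContinuousMap.coe_sum, Finset.sum_apply, ofRealC_apply, ContinuousMap.one_apply]
      exact_mod_cast h1 x
    -- Formally the claim is positivity of the integral of `star (b - g) * (b - g)` with weight `m`.
    -- With `g` frozen at the nodes of a partition of unity it is a sum of conjugates of positive
    -- elements; freezing `g` costs at most `ε * K`.
    set P := ∑ l, star (b - g (p l) • 1) * D.θ (ofRealC (m * χ l)) * (b - g (p l) • 1) with hP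
    have hP0 : 0 ≤ P := Finset.sum_nonneg fun l _ => star_left_conjugate_nonneg
      (D.θ_nonneg fun x => mul_nonneg (hm x) (h0 l x)) _
    have hPeq : P = star b * D.θ (ofRealC m) * b - star b * D.θ (ofRealC m * G)
      - D.θ (ofRealC m * star G) * b + D.θ (ofRealC m * G2) := by
      have e1 : D.θ (ofRealC m) = ∑ l, D.θ (ofRealC (m * χ l)) := by
        rw [← θ_sum]; simp_rw [map_mul]; rw [← Finset.mul_sum, hχ1, mul_one]
      have e2 : D.θ (ofRealC m * G) = ∑ l, g (p l) • D.θ (ofRealC (m * χ l)) := by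
        simp_rw [← θ_smul]; rw [← θ_sum, hG, Finset.mul_sum]; simp_rw [map_mul, mul_smul_comm]
      have e3 : D.θ (ofRealC m * star G) = ∑ l, star (g (p l)) • D.θ (ofRealC (m * χ l)) := by
        simp_rw [← θ_smul]; rw [← θ_sum, hG, star_sum, Finset.mul_sum]
        simp_rw [map_mul, star_smul, star_ofRealC, mul_smul_comm]
      have e4 : D.θ (ofRealC m * G2)
          = ∑ l, (star (g (p l)) * g (p l)) • D.θ (ofRealC (m * χ l)) := by
        simp_rw [← θ_smul]; rw [← θ_sum, hG2, Finset.mul_sum]; simp_rw [map_mul, mul_smul_comm]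
      rw [e1, e2, e3, e4, Finset.mul_sum, Finset.sum_mul, Finset.mul_sum, Finset.sum_mul,
        ← Finset.sum_sub_distrib, ← Finset.sum_sub_distrib, ← Finset.sum_add_distrib]
      refine Finset.sum_congr rfl fun l _ => ?_
      simp only [star_sub, star_smul, star_one, sub_mul, mul_sub, smul_mul_assoc, mul_smul_comm,
        one_mul, mul_one]
      module
    have hgG : ‖g - G‖ ≤ ε := by
      rw [ContinuousMap.norm_le _ hε.le]
      intro x
      have : (g - G) x = ∑ l, (χ l x : ℂ) * (g x - g (p l)) := by
        simp only [mul_sub, Finset.sum_sub_distrib, ← Finset.sum_mul]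
        rw [← Complex.ofReal_sum, h1]
        simp [hG, mul_comm]
      rw [this]
      calc _ ≤ ∑ l, χ l x * ε := by
            refine norm_sum_le_of_le _ fun l _ => ?_
            rw [norm_mul, Complex.norm_real, Real.norm_of_nonneg (h0 l x)]
            by_cases h : χ l x = 0
            · simp [h]
            · exact mul_le_mul_of_nonneg_left (h2 l x h).le (h0 l x)
        _ = ε := by rw [← Finset.sum_mul, h1, one_mul]
    have hgG2 : ‖star g * g - G2‖ ≤ ε * (2 * ‖g‖ + 1) := by
      rw [ContinuousMap.norm_le _ (by positivity)]
      intro x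
      have : (star g * g - G2) x
          = ∑ l, (χ l x : ℂ) * (star (g x) * g x - star (g (p l)) * g (p l)) := by
        simp only [mul_sub, Finset.sum_sub_distrib, ← Finset.sum_mul]
        rw [← Complex.ofReal_sum, h1]
        simp [hG2, mul_comm]
      rw [this]
      calc _ ≤ ∑ l, χ l x * (ε * (2 * ‖g‖ + 1)) := by
            refine norm_sum_le_of_le _ fun l _ => ?_
            rw [norm_mul, Complex.norm_real, Real.norm_of_nonneg (h0 l x)]
            by_cases h : χ l x = 0
            · simp [h]
            · refine mul_le_mul_of_nonneg_left ?_ (h0 l x)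
              have hd : ‖g x - g (p l)‖ < ε := h2 l x h
              have e : star (g x) * g x - star (g (p l)) * g (p l)
                = star (g x) * (g x - g (p l)) + star (g x - g (p l)) * g (p l) := by
                rw [star_sub]; ring
              rw [e]
              refine (norm_add_le _ _).trans ?_
              rw [norm_mul, norm_mul, norm_star, norm_star]
              have n1 := g.norm_coe_le_norm x
              have n2 := g.norm_coe_le_norm (p l)
              nlinarith [norm_nonneg g, norm_nonneg (g x - g (p l)), norm_nonneg (g x),
                norm_nonneg (g (p l))]
        _ = _ := by rw [← Finset.sum_mul, h1, one_mul]
    have hPsa : IsSelfAdjoint P := .of_nonneg hP0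
    have hdiff : P - Q = star b * D.θ (ofRealC m * (g - G))
        + D.θ (ofRealC m * star (g - G)) * b - D.θ (ofRealC m * (star g * g - G2)) := by
      rw [hPeq, hQ, star_sub]
      simp only [mul_sub, θ_sub, sub_mul]
      abel
    have hnorm : ‖P - Q‖ ≤ ε * K := by
      rw [hdiff]
      have hm0 := norm_nonneg (ofRealC m)
      have b1 : ‖star b * D.θ (ofRealC m * (g - G))‖ ≤ ‖b‖ * (‖ofRealC m‖ * ε) := by
        refine (norm_mul_le _ _).trans ?_
        rw [norm_star]
        refine mul_le_mul_of_nonneg_left ?_ (norm_nonneg _)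
        refine (D.norm_θ_le _).trans ((norm_mul_le _ _).trans ?_)
        exact mul_le_mul_of_nonneg_left hgG hm0
      have b2 : ‖D.θ (ofRealC m * star (g - G)) * b‖ ≤ (‖ofRealC m‖ * ε) * ‖b‖ := by
        refine (norm_mul_le _ _).trans ?_
        refine mul_le_mul_of_nonneg_right ?_ (norm_nonneg _)
        refine (D.norm_θ_le _).trans ((norm_mul_le _ _).trans ?_)
        rw [norm_star]
        exact mul_le_mul_of_nonneg_left hgG hm0
      have b3 : ‖D.θ (ofRealC m * (star g * g - G2))‖ ≤ ‖ofRealC m‖ * (ε * (2 * ‖g‖ + 1)) := by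
        refine (D.norm_θ_le _).trans ((norm_mul_le _ _).trans ?_)
        exact mul_le_mul_of_nonneg_left hgG2 hm0
      refine (norm_sub_le _ _).trans
        ((add_le_add ((norm_add_le _ _).trans (add_le_add b1 b2)) b3).trans ?_)
      rw [hK]; linarith
    have hle := (hPsa.sub hQsa).le_smul_one_of_norm_le hnorm
    exact hP0.trans (sub_le_iff_le_add'.1 hle)
  refine CStarAlgebra.nonneg_of_forall_nonneg_add_smul_one fun ε hε => ?_
  have hK1 : 0 < K + 1 := by linarith
  have h := main (min 1 (ε / (K + 1))) (by positivity) (min_le_left _ _)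
  refine h.trans (add_le_add_right (smul_le_smul_of_nonneg_right ?_ zero_le_one) _)
  calc min 1 (ε / (K + 1)) * K ≤ (ε / (K + 1)) * (K + 1) :=
        mul_le_mul (min_le_right _ _) (by linarith) hK0 (by positivity)
    _ = ε := by field_simp

end CXSystem

theorem ContinuousMap.norm_le_one_of_star_mul_self {X : Type*} [TopologicalSpace X] [CompactSpace X]
    {u : C(X, ℂ)} (hu : star u * u = 1) : ‖u‖ ≤ 1 := by
  rw [ContinuousMap.norm_le _ zero_le_one]
  intro x
  have h := congrArg (fun g : C(X, ℂ) => ‖g x‖) hu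
  simp only [ContinuousMap.mul_apply, ContinuousMap.star_apply, norm_mul, norm_star,
    ContinuousMap.one_apply, norm_one] at h
  nlinarith [norm_nonneg (u x)]

namespace CXSystem

variable {X V B : Type*} [TopologicalSpace X] [CompactSpace X] [AddCommGroup V]
    [Module ℂ V] [Module C(X, ℂ) V] [IsScalarTower ℂ C(X, ℂ) V] [CStarAlgebra B]
    (D : CXSystem X V B) [PartialOrder B] [StarOrderedRing B]

/-- An upper bound for `ι w` can be checked after rotating `w` by a unitary `u`, and where
`θ u` is isometric. -/
theorem ι_le_smul_one_of_unitary {u : C(X, ℂ)} (hu : star u * u = 1) {w : V}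
    (hw : IsSelfAdjoint (D.ι w)) {τ K : ℝ} (hK : 0 ≤ K)
    (h : star (D.θ u) * D.ι (u • w) + star (D.ι (u • w)) * D.θ u
      ≤ (2 * τ) • (1 : B) + K • (1 - star (D.θ u) * D.θ u)) :
    D.ι w ≤ τ • (1 : B) := by
  set v := D.θ u with hv
  set z := D.ι (u • w) with hz
  refine CStarAlgebra.le_of_forall_le_add_smul_one fun ε hε => ?_
  -- For large `l` the norm of `l • 1 + w` detects the upper bound of `w`. The summand `K` lets the
  -- defect `1 - star v * v`, which occurs with factor `l²`, absorb the one with factor `l K`; `2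
  -- |τ|` keeps the square bound nonnegative; the last summand makes the remainder `‖z‖² / l` at
  -- most `ε`.
  set l : ℝ := K + 2 * |τ| + 1 + ‖z‖ ^ 2 / ε with hl
  have hl0 : 0 < l := by positivity
  have hlK : K ≤ l := by rw [hl]; nlinarith [abs_nonneg τ, div_nonneg (sq_nonneg ‖z‖) hε.le]
  have hlτ : 2 * |τ| ≤ l := by rw [hl]; nlinarith [abs_nonneg τ, div_nonneg (sq_nonneg ‖z‖) hε.le]
  have hlz : ‖z‖ ^ 2 / l ≤ ε := by
    rw [div_le_iff₀ hl0, hl]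
    have : ε * (‖z‖ ^ 2 / ε) = ‖z‖ ^ 2 := by field_simp
    nlinarith [abs_nonneg τ, mul_nonneg hε.le hK, mul_nonneg hε.le (abs_nonneg τ)]
  have hτ := neg_abs_le τ
  have hnn : 0 ≤ l ^ 2 + 2 * l * τ + ‖z‖ ^ 2 := by nlinarith [sq_nonneg ‖z‖]
  have hv1 : ‖v‖ ≤ 1 := (D.norm_θ_le u).trans (norm_le_one_of_star_mul_self hu)
  have hrot : D.ι ((l : ℂ) • D.e + w) = D.ι (star u • (u • ((l : ℂ) • D.e + w))) := by
    rw [smul_smul, hu, one_smul]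
  have hrot2 : D.ι (u • ((l : ℂ) • D.e + w)) = l • v + z := by
    rw [smul_add, map_add, smul_comm, D.ι_complex_smul]
    exact congrArg (· + z) (Complex.coe_smul _ _)
  have hlw : D.ι ((l : ℂ) • D.e + w) = l • (1 : B) + D.ι w := by
    rw [map_add, D.ι_complex_smul, D.ι_e]
    exact congrArg (· + D.ι w) (Complex.coe_smul _ _)
  -- The contraction `star u` undoes the rotation, so the norm before it is at most the norm after
  -- it.
  have hnorm : ‖l • (1 : B) + D.ι w‖ ≤ ‖l • v + z‖ := by
    rw [← hlw, hrot, ← hrot2]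
    refine (D.norm_smul_le _ _).trans (mul_le_of_le_one_left (norm_nonneg _) ?_)
    rw [norm_star]; exact norm_le_one_of_star_mul_self hu
  have hvv : star v * v ≤ (1 : B) := by
    simpa using CStarAlgebra.star_mul_self_le_smul_one hv1
  have hzz : star z * z ≤ (‖z‖ ^ 2) • (1 : B) := CStarAlgebra.star_mul_self_le_smul_one le_rfl
  have hsq : star (l • v + z) * (l • v + z) ≤ (l ^ 2 + 2 * l * τ + ‖z‖ ^ 2) • (1 : B) := by
    have key : (l ^ 2 + 2 * l * τ + ‖z‖ ^ 2) • (1 : B) - star (l • v + z) * (l • v + z)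
        = (l * (l - K)) • (1 - star v * v) + l • (((2 * τ) • (1 : B) + K • (1 - star v * v))
          - (star v * z + star z * v)) + ((‖z‖ ^ 2) • (1 : B) - star z * z) := by
      simp only [star_add, star_smul, star_trivial, mul_add, add_mul, smul_mul_assoc,
        mul_smul_comm, smul_sub, smul_add]
      module
    rw [← sub_nonneg, key]
    exact add_nonneg (add_nonneg
      (smul_nonneg (mul_nonneg hl0.le (sub_nonneg.2 hlK)) (sub_nonneg.2 hvv))
      (smul_nonneg hl0.le (sub_nonneg.2 h))) (sub_nonneg.2 hzz)
  have hn2 := CStarAlgebra.norm_sq_le_of_star_mul_self_le hnn hsq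
  have hτ2 : 0 ≤ l + τ + ε := by nlinarith [abs_nonneg τ]
  have hbound : ‖l • (1 : B) + D.ι w‖ ≤ l + τ + ε := by
    refine hnorm.trans ((sq_le_sq₀ (norm_nonneg _) hτ2).1 (hn2.trans ?_))
    have : ‖z‖ ^ 2 ≤ l * ε := by rw [div_le_iff₀ hl0] at hlz; linarith
    nlinarith [sq_nonneg (τ + ε), mul_nonneg hl0.le hε.le]
  have hsa : IsSelfAdjoint (l • (1 : B) + D.ι w) := by
    rw [IsSelfAdjoint, star_add, star_smul, star_one, star_trivial, hw.star_eq]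
  have hfin := hsa.le_smul_one_of_norm_le hbound
  have e : (l + τ + ε) • (1 : B) = l • (1 : B) + (τ • (1 : B) + ε • (1 : B)) := by module
  rw [e] at hfin
  exact le_of_add_le_add_left hfin

/-- The Schwarz inequality at `g = u (l + k)` and `b = l θ u`: the terms of order `l²` leave only
the defect `1 - star (θ u) * θ u`. It remains to divide by `l` and to use `θ (k²) ≤ 1`. -/
theorem star_θ_mul_θ_add_le [T2Space X] {u : C(X, ℂ)} (hu : star u * u = 1) {k : C(X, ℝ)}
    (hk0 : ∀ x, 0 ≤ k x) (hk1 : ∀ x, k x ≤ 1) {l : ℝ} (hl : 0 < l) :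
    star (D.θ u) * D.θ (u * ofRealC k) + star (D.θ (u * ofRealC k)) * D.θ u
      ≤ (2 : ℝ) • D.θ (ofRealC k) + l • (1 - star (D.θ u) * D.θ u) + (1 / l) • (1 : B) := by
  have hs := D.schwarz_weighted (m := 1) (fun _ => zero_le_one)
    (u * ((l : ℂ) • 1 + ofRealC k)) ((l : ℂ) • D.θ u)
  have e1 : star (u * ((l : ℂ) • 1 + ofRealC k)) * (u * ((l : ℂ) • 1 + ofRealC k))
      = ((l : ℂ) ^ 2) • 1 + (2 * l : ℂ) • ofRealC k + ofRealC (k * k) := by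
    have : star (u * ((l : ℂ) • 1 + ofRealC k)) = star u * ((l : ℂ) • 1 + ofRealC k) := by
      rw [star_mul, mul_comm]; simp
    rw [this, mul_mul_mul_comm, hu, one_mul, map_mul]
    simp only [mul_add, add_mul, smul_mul_assoc, mul_smul_comm, one_mul, mul_one]
    module
  rw [map_one, one_mul, one_mul, one_mul, e1, θ_one, θ_star] at hs
  simp only [mul_add, θ_add, mul_smul_comm, mul_one, θ_smul, θ_one, star_smul, star_add,
    RCLike.star_def, Complex.conj_ofReal, smul_mul_assoc, smul_smul, add_mul, smul_add] at hs
  have hkk : D.θ (ofRealC (k * k)) ≤ 1 := by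
    have := D.θ_mono (f := k * k) (g := 1) fun x => by
      change k x * k x ≤ 1
      nlinarith [hk0 x, hk1 x]
    simpa using this
  rw [← sub_nonneg]
  have key : (2 : ℝ) • D.θ (ofRealC k) + l • (1 - star (D.θ u) * D.θ u) + (1 / l) • (1 : B)
      - (star (D.θ u) * D.θ (u * ofRealC k) + star (D.θ (u * ofRealC k)) * D.θ u)
      = (1 / l) • (((l * l : ℂ) • (star (D.θ u) * D.θ u) - ((l * l : ℂ) • (star (D.θ u) * D.θ u)
        + (l : ℂ) • (star (D.θ u) * D.θ (u * ofRealC k)))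
        - ((l * l : ℂ) • (star (D.θ u) * D.θ u) + (l : ℂ) • (star (D.θ (u * ofRealC k)) * D.θ u))
        + (((l : ℂ) ^ 2) • 1 + (2 * l : ℂ) • D.θ (ofRealC k) + D.θ (ofRealC (k * k))))
        + (1 - D.θ (ofRealC (k * k)))) := by
    have hr : ∀ (r : ℝ) (b : B), r • b = (r : ℂ) • b := fun r b => (Complex.coe_smul r b).symm
    have hl' : (l : ℂ) ≠ 0 := by exact_mod_cast hl.ne'
    simp only [hr]
    push_cast
    match_scalars <;> field_simp <;> ring
  rw [key]
  exact smul_nonneg (by positivity) (add_nonneg (by convert! hs using 2) (sub_nonneg.2 hkk))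

/-- Since `u = 1` where `c` does not vanish, `1 - θ u` should annihilate `θ c`; it does so up to the
defect of `θ u` from being isometric. This is the Schwarz inequality with weight `1 - c` at `u` and
`θ u`, rearranged. -/
theorem star_one_sub_θ_mul_le [T2Space X] {u : C(X, ℂ)} (hu : star u * u = 1) {c : C(X, ℝ)}
    (hc1 : ∀ x, c x ≤ 1) (hcu : ofRealC c * u = ofRealC c) :
    star (1 - D.θ u) * D.θ (ofRealC c) * (1 - D.θ u) ≤ 1 - star (D.θ u) * D.θ u := by
  have hs := D.schwarz_weighted (m := 1 - c) (fun x => by simpa using hc1 x) u (D.θ u)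
  have hcu' : ofRealC c * star u = ofRealC c := by
    have := congrArg star hcu
    rwa [star_mul, star_ofRealC, mul_comm] at this
  simp only [map_sub, map_one, sub_mul, one_mul, hcu, hcu', hu, mul_one, θ_sub, θ_one, θ_star,
    mul_sub] at hs
  rw [← sub_nonneg]
  refine hs.trans (le_of_eq ?_)
  simp only [star_sub, star_one, sub_mul, mul_sub, mul_one, one_mul]
  abel

theorem star_one_add_θ_mul_le [T2Space X] {u : C(X, ℂ)} {b : C(X, ℝ)}
    (hb : (4 : ℂ) • ofRealC b = star (1 + u) * (1 + u)) :
    star (1 + D.θ u) * (1 + D.θ u) ≤ (4 : ℝ) • D.θ (ofRealC b) := by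
  have hs := D.schwarz_weighted (m := 1) (fun _ => zero_le_one) (1 + u) (1 + D.θ u)
  rw [map_one, one_mul, one_mul, one_mul, ← hb, θ_smul, θ_one, θ_star, θ_add, θ_one, mul_one] at hs
  rw [← sub_nonneg]
  refine hs.trans (le_of_eq ?_)
  have : (4 : ℝ) • D.θ (ofRealC b) = (4 : ℂ) • D.θ (ofRealC b) := by
    rw [← Complex.coe_smul]; norm_num
  rw [this]; abel

/-- Write `v = θ u`. Rotating `a • w + (1 - b) • e` by `u` fixes its first summand, and `star v * Y
+ Y * v` is half the difference of the conjugates of `Y` by `1 + v` and `1 - v`. The first conjugate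
is at most `4 θ b`. In the second, `-Y` is at most `l θ c + 1 / l`, and `1 - v` nearly annihilates
`θ c`. Together with the contribution `2 (1 - θ b)` of the second summand the total is `2`, up to
`O(1 / l)` and multiples of the defect `1 - star v * v`, which `ι_le_smul_one_of_unitary` tolerates.
-/
theorem ι_smul_le_θ_of_rotations [T2Space X] {a b c : C(X, ℝ)} {u₀ u : C(X, ℂ)} (hu₀ : ‖u₀‖ ≤ 1)
    (hu₀a : u₀ * ofRealC a = ofRealC a)
    (hu₀c : u₀ * ofRealC (1 - c) = (-Complex.I) • ofRealC (1 - c))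
    (hc0 : ∀ x, 0 ≤ c x) (hc1 : ∀ x, c x ≤ 1) (ha : ∀ x, |a x| ≤ 1)
    (hu : star u * u = 1) (hua : u * ofRealC a = ofRealC a) (hcu : ofRealC c * u = ofRealC c)
    (hb : (4 : ℂ) • ofRealC b = star (1 + u) * (1 + u)) (hb0 : ∀ x, 0 ≤ b x) (hb1 : ∀ x, b x ≤ 1)
    {w : V} (hw : IsSelfAdjoint (D.ι w)) (hw1 : ‖D.ι w‖ ≤ 1) :
    D.ι (ofRealC a • w) ≤ D.θ (ofRealC b) := by
  set v := D.θ u with hv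
  set Y := D.ι (ofRealC a • w) with hY
  have hYsa : IsSelfAdjoint Y := D.isSelfAdjoint_smul hw a
  have hY1 : ‖Y‖ ≤ 1 := (D.norm_smul_le _ _).trans
    (mul_le_one₀ (norm_ofRealC_le zero_le_one ha) (norm_nonneg _) hw1)
  have hYle : Y ≤ 1 := by simpa using hYsa.le_smul_one_of_norm_le hY1
  set k : C(X, ℝ) := 1 - b with hk
  have hk0 : ∀ x, 0 ≤ k x := fun x => by simpa [hk] using hb1 x
  have hk1 : ∀ x, k x ≤ 1 := fun x => by simpa [hk] using hb0 x
  have hθk : D.θ (ofRealC k) = 1 - D.θ (ofRealC b) := by rw [hk, map_sub, map_one, θ_sub, θ_one]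
  have hv1 : ‖v‖ ≤ 1 := (D.norm_θ_le u).trans (norm_le_one_of_star_mul_self hu)
  have hsum : D.ι (ofRealC a • w + ofRealC k • D.e) = Y + D.θ (ofRealC k) := map_add _ _ _
  have hsa : IsSelfAdjoint (D.ι (ofRealC a • w + ofRealC k • D.e)) := by
    rw [hsum]; exact hYsa.add (D.isSelfAdjoint_θ k)
  have hz : D.ι (u • (ofRealC a • w + ofRealC k • D.e)) = Y + D.θ (u * ofRealC k) := by
    rw [smul_add, smul_smul, smul_smul, hua, map_add]; rfl
  have main : ∀ l : ℝ, 0 < l → Y + D.θ (ofRealC k) ≤ (1 + 3 / (2 * l)) • (1 : B) := by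
    intro l hl
    rw [← hsum]
    -- Of the factor `3 l / 2` of the defect, `l` comes from `i1` and `l / 2` from `i4` through
    -- `i2`. Of the error `3 / l`, `1 / l` comes from `i1` and `2 / l` from `i4` through `i5`.
    refine D.ι_le_smul_one_of_unitary hu hsa (K := 3 * l / 2) (by positivity) ?_
    rw [hz]
    have i1 := D.star_θ_mul_θ_add_le hu hk0 hk1 hl
    have i2 := D.star_one_sub_θ_mul_le hu hc1 hcu
    have i3 := D.star_one_add_θ_mul_le hb
    have i4 : -Y ≤ l • D.θ (ofRealC c) + (1 / l) • (1 : B) := by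
      have hwn : IsSelfAdjoint (D.ι (-w)) := by rw [map_neg]; exact hw.neg
      have := D.ι_smul_le_of_rotation hu₀ hu₀a hu₀c hc0 hc1 hwn hl
      rw [smul_neg, map_neg, norm_neg] at this
      refine this.trans (add_le_add_right (smul_le_smul_of_nonneg_right ?_ zero_le_one) _)
      exact div_le_div_of_nonneg_right (pow_le_one₀ (norm_nonneg _) hY1) hl.le
    have i5 : star (1 - v) * (1 - v) ≤ (4 : ℝ) • (1 : B) := by
      have : ‖1 - v‖ ≤ 2 := by
        have h1 : D.θ (1 - u) = 1 - v := by rw [θ_sub, θ_one]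
        rw [← h1]
        refine (D.norm_θ_le _).trans ((norm_sub_le _ _).trans ?_)
        have h2 : ‖(1 : C(X, ℂ))‖ ≤ 1 := norm_le_one_of_star_mul_self (by simp)
        have h3 := norm_le_one_of_star_mul_self hu
        linarith
      have := CStarAlgebra.star_mul_self_le_smul_one this
      norm_num at this ⊢
      exact this
    rw [← hv] at i1 i2 i3
    have j1 := star_left_conjugate_le_conjugate hYle (1 + v)
    have j2 := star_left_conjugate_le_conjugate i4 (1 - v)
    rw [← sub_nonneg] at i1 i2 i3 i5 j1 j2 ⊢
    have key : (2 * (1 + 3 / (2 * l))) • (1 : B) + (3 * l / 2) • (1 - star v * v)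
        - (star v * (Y + D.θ (u * ofRealC k)) + star (Y + D.θ (u * ofRealC k)) * v)
      = ((2 : ℝ) • D.θ (ofRealC k) + l • (1 - star v * v) + (1 / l) • (1 : B)
          - (star v * D.θ (u * ofRealC k) + star (D.θ (u * ofRealC k)) * v))
        + (1 / 2 : ℝ) • (star (1 + v) * 1 * (1 + v) - star (1 + v) * Y * (1 + v))
        + (1 / 2 : ℝ) • (star (1 - v) * (l • D.θ (ofRealC c) + (1 / l) • (1 : B)) * (1 - v)
            - star (1 - v) * (-Y) * (1 - v))
        + (1 / 2 : ℝ) • ((4 : ℝ) • D.θ (ofRealC b) - star (1 + v) * (1 + v))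
        + (l / 2) • (1 - star v * v - star (1 - v) * D.θ (ofRealC c) * (1 - v))
        + (1 / (2 * l)) • ((4 : ℝ) • (1 : B) - star (1 - v) * (1 - v)) := by
      rw [hθk]
      simp only [star_add, star_sub, star_one, hYsa.star_eq, mul_add, add_mul, mul_sub, sub_mul,
        smul_mul_assoc, mul_smul_comm, mul_one, one_mul, smul_sub, smul_add, mul_neg, neg_mul,
        smul_neg]
      match_scalars <;> field_simp <;> ring
    rw [key]
    refine add_nonneg (add_nonneg (add_nonneg (add_nonneg (add_nonneg i1 ?_) ?_) ?_) ?_) ?_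
    all_goals refine smul_nonneg (by positivity) ?_
    exacts [j1, j2, i3, i2, i5]
  have hle : Y + D.θ (ofRealC k) ≤ 1 := by
    refine CStarAlgebra.le_of_forall_le_add_smul_one fun ε hε => ?_
    have := main (3 / (2 * ε)) (by positivity)
    have e : 3 / (2 * (3 / (2 * ε))) = ε := by field_simp
    rwa [e, add_smul, one_smul] at this
  rw [hθk] at hle
  have := sub_nonneg.2 hle
  rw [← sub_nonneg]
  refine this.trans (le_of_eq ?_)
  abel

end CXSystem

/-! ### Truncations, layers, and preservation of positivity. -/

/-- The `j`-th summand is the portion of `t` between the heights `j` and `j + 1`. -/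
theorem sum_range_clamp (t : ℝ) (N : ℕ) :
    ∑ j ∈ Finset.range N, max 0 (min 1 (t - j)) = max 0 (min (N : ℝ) t) := by
  induction N with
  | zero => simp
  | succ N ih =>
    rw [Finset.sum_range_succ, ih]
    push_cast
    have hN : (0 : ℝ) ≤ N := N.cast_nonneg
    rcases le_total t N with h | h
    · rw [min_eq_right h, min_eq_right (h.trans (by linarith)), min_eq_right (by linarith : t - N ≤ 1),
        max_eq_left (by linarith : t - N ≤ 0), add_zero]
    · rw [min_eq_left h, max_eq_right hN]
      rcases le_total t (N + 1) with h' | h'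
      · rw [min_eq_right h', min_eq_right (by linarith : t - N ≤ 1),
          max_eq_right (by linarith : 0 ≤ t - N), max_eq_right (by linarith)]; ring
      · rw [min_eq_left h', min_eq_left (by linarith : 1 ≤ t - N), max_eq_right zero_le_one,
          max_eq_right (by linarith)]

/-- The truncation of a real function to `[0, 1]`. -/
noncomputable def ContinuousMap.clamp {X : Type*} [TopologicalSpace X] (s : C(X, ℝ)) : C(X, ℝ) :=
  ⟨fun x => max 0 (min 1 (s x)), by fun_prop⟩

namespace ContinuousMap

variable {X : Type*} [TopologicalSpace X]

theorem clamp_apply (s : C(X, ℝ)) (x : X) : clamp s x = max 0 (min 1 (s x)) := rfl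

theorem clamp_nonneg (s : C(X, ℝ)) (x : X) : 0 ≤ clamp s x := le_max_left _ _

theorem clamp_le_one (s : C(X, ℝ)) (x : X) : clamp s x ≤ 1 :=
  max_le zero_le_one (min_le_left _ _)

theorem clamp_eq_zero {s : C(X, ℝ)} {x : X} (h : s x ≤ 0) : clamp s x = 0 := by
  rw [clamp_apply, min_eq_right (h.trans zero_le_one), max_eq_left h]

theorem clamp_eq_one {s : C(X, ℝ)} {x : X} (h : 1 ≤ s x) : clamp s x = 1 := by
  rw [clamp_apply, min_eq_left h, max_eq_right zero_le_one]

/-- The unitary function `exp (i s)`. -/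
noncomputable def expI (s : C(X, ℝ)) : C(X, ℂ) :=
  ⟨fun x => Complex.exp ((s x : ℂ) * Complex.I), by fun_prop⟩

theorem expI_apply (s : C(X, ℝ)) (x : X) : expI s x = Complex.exp ((s x : ℂ) * Complex.I) := rfl

theorem star_expI_mul_self (s : C(X, ℝ)) : star (expI s) * expI s = 1 := by
  ext x
  rw [ContinuousMap.mul_apply, ContinuousMap.star_apply, expI_apply, RCLike.star_def,
    ContinuousMap.one_apply, ← Complex.normSq_eq_conj_mul_self, Complex.normSq_eq_norm_sq,
    Complex.norm_exp_ofReal_mul_I]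
  norm_num

end ContinuousMap

namespace CXSystem

variable {X V B : Type*} [TopologicalSpace X] [CompactSpace X] [AddCommGroup V]
    [Module ℂ V] [Module C(X, ℂ) V] [IsScalarTower ℂ C(X, ℂ) V] [CStarAlgebra B]
    (D : CXSystem X V B) [PartialOrder B] [StarOrderedRing B] [T2Space X]

theorem ι_clamp_smul_le (s : C(X, ℝ)) {w : V} (hw : IsSelfAdjoint (D.ι w)) (hw1 : ‖D.ι w‖ ≤ 1) :
    D.ι (ofRealC (clamp s) • w) ≤ D.θ (ofRealC (clamp (s + 4))) := by
  -- `u₀` is `1` where `s ≥ 0` and `-i` where `s ≤ -1`; `u` is `1` where `s ≥ -2` and `-1` where `s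
  -- ≤ -3`; the cutoff `clamp (s + 2)` passes from `0` to `1` in between. As `b` vanishes where `u =
  -- -1`, it lies below `clamp (s + 4)`, which is `1` where `s ≥ -3`.
  set u₀ := expI (-(Real.pi / 2) • clamp (-s)) with hu₀
  set u := expI (Real.pi • clamp (-2 - s)) with hu
  set b : C(X, ℝ) := ⟨fun x => ‖1 + u x‖ ^ 2 / 4, by fun_prop⟩ with hb
  have hu1 : ∀ x, -2 ≤ s x → u x = 1 := fun x hx => by
    rw [hu, expI_apply]
    change Complex.exp (((Real.pi * clamp (-2 - s) x : ℝ) : ℂ) * Complex.I) = 1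
    rw [clamp_eq_zero (show (-2 : ℝ) - s x ≤ 0 by linarith)]
    simp
  have hun : ∀ x, ‖u x‖ = 1 := fun x => Complex.norm_exp_ofReal_mul_I _
  have hb1 : ∀ x, b x ≤ 1 := fun x => by
    change ‖1 + u x‖ ^ 2 / 4 ≤ 1
    have h2 : ‖1 + u x‖ ≤ 2 := (norm_add_le _ _).trans (by rw [hun, norm_one]; norm_num)
    nlinarith [norm_nonneg (1 + u x)]
  have hle : D.ι (ofRealC (clamp s) • w) ≤ D.θ (ofRealC b) := by
    refine D.ι_smul_le_θ_of_rotations (c := clamp (s + 2)) (u₀ := u₀) (u := u)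
      (norm_le_one_of_star_mul_self (star_expI_mul_self _)) ?_ ?_ (clamp_nonneg _) (clamp_le_one _)
      (fun x => by rw [abs_of_nonneg (clamp_nonneg _ _)]; exact clamp_le_one _ _)
      (star_expI_mul_self _) ?_ ?_ ?_ (fun x => by change 0 ≤ ‖1 + u x‖ ^ 2 / 4; positivity)
      hb1 hw hw1
    · ext x
      rw [ContinuousMap.mul_apply, ofRealC_apply]
      rcases le_total (s x) 0 with h | h
      · rw [clamp_eq_zero h]; simp
      · have : u₀ x = 1 := by
          rw [hu₀, expI_apply]
          change Complex.exp (((-(Real.pi / 2) * clamp (-s) x : ℝ) : ℂ) * Complex.I) = 1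
          rw [clamp_eq_zero (show -s x ≤ 0 by linarith)]; simp
        rw [this, one_mul]
    · ext x
      rw [ContinuousMap.mul_apply, ContinuousMap.smul_apply, ofRealC_apply, smul_eq_mul]
      rcases le_total (-1) (s x) with h | h
      · have : (1 - clamp (s + 2)) x = 0 := by
          change 1 - clamp (s + 2) x = 0
          rw [clamp_eq_one (show (1 : ℝ) ≤ s x + 2 by linarith), sub_self]
        rw [this]; simp
      · have : u₀ x = -Complex.I := by
          rw [hu₀, expI_apply]
          change Complex.exp (((-(Real.pi / 2) * clamp (-s) x : ℝ) : ℂ) * Complex.I) = _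
          rw [clamp_eq_one (show 1 ≤ -s x by linarith), mul_one, Complex.exp_mul_I,
            ← Complex.ofReal_cos, ← Complex.ofReal_sin]
          simp
        rw [this]
    · ext x
      rw [ContinuousMap.mul_apply, ofRealC_apply]
      rcases le_total (s x) 0 with h | h
      · rw [clamp_eq_zero h]; simp
      · rw [hu1 x (by linarith), one_mul]
    · ext x
      rw [ContinuousMap.mul_apply, ofRealC_apply]
      rcases le_total (s x) (-2) with h | h
      · rw [clamp_eq_zero (show s x + 2 ≤ 0 by linarith)]; simp
      · rw [hu1 x h, mul_one]
    · ext x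
      have h4 : (star (1 + u) * (1 + u)) x = ((‖1 + u x‖ ^ 2 : ℝ) : ℂ) := by
        change star (1 + u x) * (1 + u x) = _
        rw [RCLike.star_def, ← Complex.normSq_eq_conj_mul_self, Complex.normSq_eq_norm_sq]
      rw [h4, ContinuousMap.smul_apply, ofRealC_apply, smul_eq_mul]
      change (4 : ℂ) * ((‖1 + u x‖ ^ 2 / 4 : ℝ) : ℂ) = _
      push_cast; ring
  refine hle.trans (D.θ_mono fun x => ?_)
  rcases le_total (s x) (-3) with h | h
  · have : u x = -1 := by
      rw [hu, expI_apply]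
      change Complex.exp (((Real.pi * clamp (-2 - s) x : ℝ) : ℂ) * Complex.I) = _
      rw [clamp_eq_one (show (1 : ℝ) ≤ -2 - s x by linarith), mul_one, Complex.exp_pi_mul_I]
    change ‖1 + u x‖ ^ 2 / 4 ≤ _
    rw [this]
    simpa using clamp_nonneg _ _
  · rw [clamp_eq_one (show (1 : ℝ) ≤ s x + 4 by linarith)]
    exact hb1 x

/-- `ι_clamp_smul_le` is applied to each of the `N` layers of `N • f`. The shifted layers sum to at
most `N • f + 4`, so the shift costs `4` altogether and `4 / N` after division. -/
theorem ι_smul_le_θ_of_le_one {f : C(X, ℝ)} (hf0 : ∀ x, 0 ≤ f x) (hf1 : ∀ x, f x ≤ 1) {w : V}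
    (hw : IsSelfAdjoint (D.ι w)) (hw1 : ‖D.ι w‖ ≤ 1) :
    D.ι (ofRealC f • w) ≤ D.θ (ofRealC f) := by
  have main : ∀ N : ℕ, 0 < N →
      D.ι (ofRealC f • w) ≤ D.θ (ofRealC f) + (4 / (N : ℝ)) • (1 : B) := by
    intro N hN
    have hN' : (0 : ℝ) < N := by exact_mod_cast hN
    have e1 : (N : ℝ) • f = ∑ j ∈ Finset.range N, clamp ((N : ℝ) • f - (j : C(X, ℝ))) := by
      ext x
      have : ∀ j : ℕ, clamp ((N : ℝ) • f - (j : C(X, ℝ))) x = max 0 (min 1 (N * f x - j)) := by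
        intro j; simp [clamp_apply]
      rw [ContinuousMap.coe_sum, Finset.sum_apply]
      simp_rw [this]
      rw [sum_range_clamp, min_eq_right (by nlinarith [hf1 x]),
        max_eq_right (mul_nonneg hN'.le (hf0 x))]
      simp
    have e2 : ∀ x, (∑ j ∈ Finset.range N, clamp ((N : ℝ) • f - (j : C(X, ℝ)) + 4)) x
        ≤ ((N : ℝ) • f + 4) x := by
      intro x
      have : ∀ j : ℕ, clamp ((N : ℝ) • f - (j : C(X, ℝ)) + 4) x
          = max 0 (min 1 ((N * f x + 4) - j)) := by
        intro j
        have h4 : (4 : C(X, ℝ)) x = 4 := rfl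
        rw [clamp_apply]; congr 2; simp [h4]; ring
      rw [ContinuousMap.coe_sum, Finset.sum_apply]
      simp_rw [this]
      rw [sum_range_clamp]
      have h4 : ((N : ℝ) • f + 4) x = N * f x + 4 := rfl
      rw [h4]
      exact max_le (by nlinarith [mul_nonneg hN'.le (hf0 x)]) (min_le_right _ _)
    have h1 : D.ι (ofRealC ((N : ℝ) • f) • w) ≤ D.θ (ofRealC ((N : ℝ) • f + 4)) := by
      refine le_trans ?_ (D.θ_mono e2)
      rw [congrArg ofRealC e1, map_sum, Finset.sum_smul, map_sum]
      rw [map_sum, θ_sum]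
      exact Finset.sum_le_sum fun j _ => D.ι_clamp_smul_le _ hw hw1
    have h4 : D.θ (ofRealC (4 : C(X, ℝ))) = (4 : ℝ) • (1 : B) := by
      have : (4 : C(X, ℝ)) = (4 : ℝ) • 1 := by ext x; simp; rfl
      rw [this, ofRealC_smul, θ_smul, map_one, θ_one, Complex.coe_smul]
    rw [map_add, θ_add, h4, ofRealC_smul, smul_assoc, D.ι_complex_smul, θ_smul, Complex.coe_smul,
      Complex.coe_smul] at h1
    have h2 := smul_le_smul_of_nonneg_left h1 (inv_nonneg.2 hN'.le)
    rw [smul_smul, inv_mul_cancel₀ hN'.ne', one_smul, smul_add, smul_smul,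
      inv_mul_cancel₀ hN'.ne', one_smul, smul_smul] at h2
    rwa [div_eq_inv_mul]
  refine CStarAlgebra.le_of_forall_le_add_smul_one fun ε hε => ?_
  obtain ⟨N, hN⟩ := exists_nat_gt (4 / ε)
  have hN' : (0 : ℝ) < N := lt_trans (by positivity) hN
  refine (main N (by exact_mod_cast hN')).trans
    (add_le_add_right (smul_le_smul_of_nonneg_right ?_ zero_le_one) _)
  rw [div_le_iff₀ hN']
  rw [div_lt_iff₀ hε] at hN
  linarith

/-- Multiplication by a nonnegative function preserves positivity. -/
theorem ι_smul_nonneg {f : C(X, ℝ)} (hf0 : ∀ x, 0 ≤ f x) {w : V} (hw : 0 ≤ D.ι w) :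
    0 ≤ D.ι (ofRealC f • w) := by
  have hwsa : IsSelfAdjoint (D.ι w) := .of_nonneg hw
  have hM : 0 < ‖f‖ + 1 := by positivity
  have hR : 0 < ‖D.ι w‖ + 1 := by positivity
  set r : ℝ := (‖D.ι w‖ + 1)⁻¹ with hr
  have hr0 : 0 < r := by positivity
  set g : C(X, ℝ) := (‖f‖ + 1)⁻¹ • f with hg
  -- The image of `w'` lies between `0` and `1`, and `g • w' ≤ θ g` says that `g • w` is positive.
  set w' : V := D.e - (r : ℂ) • w with hw'
  have hιw' : D.ι w' = 1 - r • D.ι w := by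
    rw [hw', map_sub, D.ι_complex_smul, D.ι_e, Complex.coe_smul]
  have hsa : IsSelfAdjoint (D.ι w') := by
    rw [hιw', IsSelfAdjoint, star_sub, star_smul, star_one, star_trivial, hwsa.star_eq]
  have hrw : r • D.ι w ≤ 1 := by
    have := hwsa.le_smul_one_of_norm_le (r := ‖D.ι w‖ + 1) (by linarith)
    have := smul_le_smul_of_nonneg_left this hr0.le
    rwa [smul_smul, hr, inv_mul_cancel₀ hR.ne', one_smul] at this
  have hn : ‖D.ι w'‖ ≤ 1 := by
    rw [hιw']
    refine CStarAlgebra.norm_le_of_nonneg_of_le_smul_one zero_le_one (sub_nonneg.2 hrw) ?_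
    rw [one_smul, sub_le_self_iff]
    exact smul_nonneg hr0.le hw
  have h := D.ι_smul_le_θ_of_le_one (f := g)
    (fun x => mul_nonneg (inv_nonneg.2 hM.le) (hf0 x))
    (fun x => by
      change (‖f‖ + 1)⁻¹ * f x ≤ 1
      rw [inv_mul_le_iff₀ hM, mul_one]
      have := (le_abs_self _).trans (f.norm_coe_le_norm x)
      linarith) hsa hn
  have e1 : D.ι (ofRealC g • w') = D.θ (ofRealC g) - (r * (‖f‖ + 1)⁻¹) • D.ι (ofRealC f • w) := by
    rw [hw', smul_sub, map_sub, smul_comm (ofRealC g) (r : ℂ) w, D.ι_complex_smul,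
      Complex.coe_smul, hg, ofRealC_smul, smul_assoc _ _ w, D.ι_complex_smul,
      Complex.coe_smul _ (D.ι (ofRealC f • w)), smul_smul]
    rfl
  have h3 : 0 ≤ (r * (‖f‖ + 1)⁻¹) • D.ι (ofRealC f • w) := by
    rwa [e1, sub_le_self_iff] at h
  have h5 := smul_nonneg (inv_nonneg.2 (by positivity : 0 ≤ r * (‖f‖ + 1)⁻¹)) h3
  rwa [smul_smul, inv_mul_cancel₀ (by positivity), one_smul] at h5

end CXSystem

/-! ### Localisation at a point: bump functions and the fibre norm. -/

theorem le_of_forall_le_add_mul {a b K : ℝ} (h : ∀ ε : ℝ, 0 < ε → ε < 1 → a ≤ b + ε * K) :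
    a ≤ b := by
  by_contra hab
  push Not at hab
  have h1 := h (min (1 / 2) ((a - b) / (2 * (|K| + 1)))) (by
    have := abs_nonneg K
    have : 0 < a - b := by linarith
    positivity) (by have := min_le_left (1 / 2 : ℝ) ((a - b) / (2 * (|K| + 1))); linarith)
  have h2 : min (1 / 2) ((a - b) / (2 * (|K| + 1))) * K ≤ (a - b) / (2 * (|K| + 1)) * (|K| + 1) := by
    have hK := abs_nonneg K
    have hK' := le_abs_self K
    have h0 : 0 < a - b := by linarith
    have h3 : 0 ≤ min (1 / 2) ((a - b) / (2 * (|K| + 1))) := by positivity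
    calc _ ≤ min (1 / 2) ((a - b) / (2 * (|K| + 1))) * (|K| + 1) :=
          mul_le_mul_of_nonneg_left (by linarith) h3
      _ ≤ _ := mul_le_mul_of_nonneg_right (min_le_right _ _) (by linarith)
  have h4 : (a - b) / (2 * (|K| + 1)) * (|K| + 1) = (a - b) / 2 := by
    have hK := abs_nonneg K
    field_simp
  linarith

/-- The functions with values in `[0, 1]` that are `1` at `y`. -/
def ContinuousMap.bumps {X : Type*} [TopologicalSpace X] (y : X) : Set C(X, ℝ) :=
  {h | (∀ x, 0 ≤ h x) ∧ (∀ x, h x ≤ 1) ∧ h y = 1}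

namespace ContinuousMap

variable {X : Type*} [TopologicalSpace X] {y : X}

theorem one_mem_bumps : (1 : C(X, ℝ)) ∈ bumps y := ⟨fun _ => zero_le_one, fun _ => le_rfl, rfl⟩

theorem mul_mem_bumps {g h : C(X, ℝ)} (hg : g ∈ bumps y) (hh : h ∈ bumps y) : g * h ∈ bumps y :=
  ⟨fun x => mul_nonneg (hg.1 x) (hh.1 x), fun x => mul_le_one₀ (hg.2.1 x) (hh.1 x) (hh.2.1 x),
    by rw [mul_apply, hg.2.2, hh.2.2, mul_one]⟩

theorem norm_ofRealC_le_one_of_mem_bumps [CompactSpace X] {h : C(X, ℝ)} (hh : h ∈ bumps y) :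
    ‖ofRealC h‖ ≤ 1 :=
  norm_ofRealC_le zero_le_one fun x => by rw [abs_of_nonneg (hh.1 x)]; exact hh.2.1 x

instance : Nonempty (bumps y) := ⟨⟨1, one_mem_bumps⟩⟩

/-- A bump function that almost annihilates a function vanishing at `y`. -/
theorem exists_bump_norm_mul_le [CompactSpace X] {f : C(X, ℂ)} (hf : f y = 0) {ε : ℝ}
    (hε : 0 < ε) : ∃ h ∈ bumps y, ‖ofRealC h * f‖ ≤ ε := by
  refine ⟨clamp ⟨fun x => 1 - ‖f x‖ / ε, by fun_prop⟩,
    ⟨clamp_nonneg _, clamp_le_one _, clamp_eq_one (by simp [hf])⟩, ?_⟩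
  rw [ContinuousMap.norm_le _ hε.le]
  intro x
  rw [mul_apply, ofRealC_apply, norm_mul, Complex.norm_real, Real.norm_of_nonneg (clamp_nonneg _ _)]
  rcases le_total (‖f x‖) ε with h | h
  · exact (mul_le_of_le_one_left (norm_nonneg _) (clamp_le_one _ _)).trans h
  · rw [clamp_eq_zero, zero_mul]
    · exact hε.le
    · change 1 - ‖f x‖ / ε ≤ 0
      rw [sub_nonpos, one_le_div hε]; exact h

end ContinuousMap

namespace CXSystem

variable {X V B : Type*} [TopologicalSpace X] [CompactSpace X] [AddCommGroup V]
    [Module ℂ V] [Module C(X, ℂ) V] [IsScalarTower ℂ C(X, ℂ) V] [CStarAlgebra B]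
    (D : CXSystem X V B)

/-- The norm of the image of `w` in the fibre at `y`. -/
noncomputable def N (y : X) (w : V) : ℝ := ⨅ h : bumps y, ‖D.ι (ofRealC h.1 • w)‖

variable {y : X}

theorem N_le {h : C(X, ℝ)} (hh : h ∈ bumps y) (w : V) : D.N y w ≤ ‖D.ι (ofRealC h • w)‖ :=
  ciInf_le ⟨0, by rintro _ ⟨h, rfl⟩; exact norm_nonneg _⟩ (⟨h, hh⟩ : bumps y)

theorem exists_bump_norm_lt (y : X) (w : V) {ε : ℝ} (hε : 0 < ε) :
    ∃ h ∈ bumps y, ‖D.ι (ofRealC h • w)‖ < D.N y w + ε := by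
  obtain ⟨h, hh⟩ := exists_lt_of_ciInf_lt (lt_add_of_pos_right (D.N y w) hε)
  exact ⟨h.1, h.2, hh⟩

theorem N_nonneg (y : X) (w : V) : 0 ≤ D.N y w := Real.iInf_nonneg fun _ => norm_nonneg _

theorem le_N {r : ℝ} {w : V} (h : ∀ h ∈ bumps y, r ≤ ‖D.ι (ofRealC h • w)‖) : r ≤ D.N y w :=
  le_ciInf fun h' => h h'.1 h'.2

theorem N_le_norm (y : X) (w : V) : D.N y w ≤ ‖D.ι w‖ := by
  simpa using D.N_le (one_mem_bumps (y := y)) w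

theorem N_congr {w w' : V} (h : D.ι w = D.ι w') : D.N y w = D.N y w' := by
  simp only [N, D.ι_smul_eq_of_ι_eq h]

theorem norm_ι_mul_smul_le {h : C(X, ℝ)} (hh : h ∈ bumps y) (f : C(X, ℂ)) (w : V) :
    ‖D.ι ((ofRealC h * f) • w)‖ ≤ ‖D.ι (f • w)‖ := by
  rw [mul_smul]
  exact (D.norm_smul_le _ _).trans
    (mul_le_of_le_one_left (norm_nonneg _) (norm_ofRealC_le_one_of_mem_bumps hh))

/-- The product of two bumps is a bump that is at least as good as each of them. -/
theorem N_add_le (y : X) (w w' : V) : D.N y (w + w') ≤ D.N y w + D.N y w' := by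
  refine le_of_forall_le_add_mul (K := 2) fun ε hε _ => ?_
  obtain ⟨g, hg, hg'⟩ := D.exists_bump_norm_lt y w hε
  obtain ⟨h, hh, hh'⟩ := D.exists_bump_norm_lt y w' hε
  refine (D.N_le (mul_mem_bumps hg hh) _).trans ?_
  rw [smul_add, map_add, map_mul]
  refine (norm_add_le _ _).trans ?_
  have h1 := D.norm_ι_mul_smul_le hg (ofRealC h) w'
  have h2 := D.norm_ι_mul_smul_le hh (ofRealC g) w
  rw [mul_comm] at h2
  linarith

theorem N_eq_zero_of_apply_eq_zero {f : C(X, ℂ)} (hf : f y = 0) (w : V) : D.N y (f • w) = 0 := by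
  refine le_antisymm (le_of_forall_le_add_mul (K := ‖D.ι w‖) fun ε hε _ => ?_) (D.N_nonneg _ _)
  obtain ⟨h, hh, hh'⟩ := exists_bump_norm_mul_le hf hε
  refine (D.N_le hh _).trans ?_
  rw [← mul_smul, zero_add]
  exact (D.norm_smul_le _ _).trans (mul_le_mul_of_nonneg_right hh' (norm_nonneg _))

theorem N_complex_smul (y : X) (c : ℂ) (w : V) : D.N y (c • w) = ‖c‖ * D.N y w := by
  rw [N, N, Real.mul_iInf_of_nonneg (norm_nonneg c)]
  congr 1
  ext h
  rw [smul_comm, D.ι_complex_smul, norm_smul]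

theorem N_real_smul (y : X) {r : ℝ} (hr : 0 ≤ r) (w : V) : D.N y ((r : ℂ) • w) = r * D.N y w := by
  rw [N_complex_smul, Complex.norm_real, Real.norm_of_nonneg hr]

theorem N_neg (y : X) (w : V) : D.N y (-w) = D.N y w := by
  simpa using D.N_complex_smul y (-1) w

theorem N_le_add_sub (y : X) (w w' : V) : D.N y w ≤ D.N y w' + D.N y (w - w') := by
  simpa using D.N_add_le y w' (w - w')

/-- The real part of an element. -/
noncomputable def re (w : V) : V := (2⁻¹ : ℂ) • (w + D.adj w)

theorem ι_smul_re (f : C(X, ℝ)) (w : V) : D.ι (ofRealC f • D.re w)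
    = (2⁻¹ : ℂ) • (D.ι (ofRealC f • w) + star (D.ι (ofRealC f • w))) := by
  rw [re, smul_comm, D.ι_complex_smul, smul_add, map_add, D.ι_smul_adj, star_ofRealC]

theorem ι_re (w : V) : D.ι (D.re w) = (2⁻¹ : ℂ) • (D.ι w + star (D.ι w)) := by
  simpa using D.ι_smul_re 1 w

theorem isSelfAdjoint_ι_re (w : V) : IsSelfAdjoint (D.ι (D.re w)) := by
  rw [ι_re, IsSelfAdjoint, star_smul, star_add, star_star, add_comm]
  simp

theorem norm_ι_smul_re_le (f : C(X, ℝ)) (w : V) :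
    ‖D.ι (ofRealC f • D.re w)‖ ≤ ‖D.ι (ofRealC f • w)‖ := by
  rw [ι_smul_re, norm_smul]
  have := norm_add_le (D.ι (ofRealC f • w)) (star (D.ι (ofRealC f • w)))
  rw [norm_star] at this
  norm_num
  linarith

theorem norm_ι_re_le (w : V) : ‖D.ι (D.re w)‖ ≤ ‖D.ι w‖ := by
  simpa using D.norm_ι_smul_re_le 1 w

theorem N_re_le (y : X) (w : V) : D.N y (D.re w) ≤ D.N y w :=
  D.le_N fun _ hh => (D.N_le hh _).trans (D.norm_ι_smul_re_le _ _)

theorem ι_re_eq_of_isSelfAdjoint {w : V} (hw : IsSelfAdjoint (D.ι w)) : D.ι (D.re w) = D.ι w := by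
  rw [ι_re, hw.star_eq, ← two_smul ℂ, smul_smul]; norm_num

theorem N_e_le_one (y : X) : D.N y D.e ≤ 1 := by
  refine (D.N_le_norm y D.e).trans ?_
  simpa [θ] using (D.norm_θ_le 1).trans (norm_le_one_of_star_mul_self (by simp))

variable [PartialOrder B] [StarOrderedRing B] [T2Space X]

/-- In a nonzero operator system `‖v + μ‖ = ‖v‖ + μ` for `v ≥ 0`. The maximum with `0` allows for a
vanishing fibre. -/
theorem N_le_max_of_nonneg {v : V} (hv : 0 ≤ D.ι v) {μ : ℝ} (hμ : 0 ≤ μ) :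
    D.N y v ≤ max (D.N y (v + (μ : ℂ) • D.e) - μ) 0 := by
  refine le_of_forall_le_add_mul (K := 1 + μ + D.N y v) fun ε hε hε1 => ?_
  obtain ⟨h, hh, hh'⟩ := D.exists_bump_norm_lt y (v + (μ : ℂ) • D.e) hε
  set m := D.N y (v + (μ : ℂ) • D.e) + ε with hm
  -- `g` vanishes where `h ≤ 1 - ε`, so `g h ≥ (1 - ε) g`. Multiplying `h • (v + μ e) ≤ m` by `g`
  -- therefore bounds `(1 - ε) g • v` by a multiple of `θ g`.
  set g : C(X, ℝ) := clamp (ε⁻¹ • (h - (1 - ε) • 1)) with hg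
  have hgb : g ∈ bumps y := ⟨clamp_nonneg _, clamp_le_one _, clamp_eq_one (by
    change (1 : ℝ) ≤ ε⁻¹ * (h y - (1 - ε) * 1)
    rw [hh.2.2]; field_simp; linarith)⟩
  have hgh : ∀ x, 0 ≤ (g * h - (1 - ε) • g) x := fun x => by
    change 0 ≤ g x * h x - (1 - ε) * g x
    rcases le_total (h x) (1 - ε) with hx | hx
    · have : g x = 0 := clamp_eq_zero (by
        change ε⁻¹ * (h x - (1 - ε) * 1) ≤ 0
        exact mul_nonpos_of_nonneg_of_nonpos (by positivity) (by linarith))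
      rw [this]; simp
    · nlinarith [clamp_nonneg (ε⁻¹ • (h - (1 - ε) • 1)) x]
  have hvsa : IsSelfAdjoint (D.ι v) := .of_nonneg hv
  have hsa : IsSelfAdjoint (D.ι (v + (μ : ℂ) • D.e)) := by
    rw [map_add, D.ι_complex_smul, D.ι_e, Complex.coe_smul]
    exact hvsa.add (by rw [IsSelfAdjoint, star_smul, star_one, star_trivial])
  have hpos : 0 ≤ D.ι ((m : ℂ) • D.e - ofRealC h • (v + (μ : ℂ) • D.e)) := by
    rw [map_sub, D.ι_complex_smul, D.ι_e, Complex.coe_smul, sub_nonneg]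
    exact (D.isSelfAdjoint_smul hsa h).le_smul_one_of_norm_le hh'.le
  have h1 := D.ι_smul_nonneg hgb.1 hpos
  have h2 := D.ι_smul_nonneg hgh hv
  have h3 := D.θ_nonneg hgh
  have h4 : 0 ≤ D.ι (ofRealC g • v) := D.ι_smul_nonneg hgb.1 hv
  have hθ1 : D.θ (ofRealC g) ≤ 1 := by simpa using D.θ_mono (g := 1) hgb.2.1
  have hθ0 : 0 ≤ D.θ (ofRealC g) := D.θ_nonneg hgb.1
  have e1 : D.ι (ofRealC g • ((m : ℂ) • D.e - ofRealC h • (v + (μ : ℂ) • D.e)))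
      = m • D.θ (ofRealC g) - D.ι (ofRealC (g * h) • v) - μ • D.θ (ofRealC (g * h)) := by
    rw [smul_sub, smul_smul, smul_add, map_sub, map_add, smul_comm _ (m : ℂ), smul_comm _ (μ : ℂ),
      D.ι_complex_smul, D.ι_complex_smul, Complex.coe_smul, Complex.coe_smul, map_mul, sub_sub]
    rfl
  have e2 : D.ι (ofRealC (g * h - (1 - ε) • g) • v)
      = D.ι (ofRealC (g * h) • v) - (1 - ε) • D.ι (ofRealC g • v) := by
    rw [map_sub, sub_smul, map_sub, ofRealC_smul, smul_assoc, D.ι_complex_smul, Complex.coe_smul]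
  have e3 : D.θ (ofRealC (g * h - (1 - ε) • g))
      = D.θ (ofRealC (g * h)) - (1 - ε) • D.θ (ofRealC g) := by
    rw [map_sub, θ_sub, ofRealC_smul, θ_smul, Complex.coe_smul]
  rw [e1] at h1; rw [e2] at h2; rw [e3] at h3
  set M : ℝ := max (m - (1 - ε) * μ) 0 with hM
  have hM0 : 0 ≤ M := le_max_right _ _
  have h5 : (1 - ε) • D.ι (ofRealC g • v) ≤ M • (1 : B) := by
    have h6 : (1 - ε) • D.ι (ofRealC g • v) ≤ (m - (1 - ε) * μ) • D.θ (ofRealC g) := by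
      have := add_nonneg (add_nonneg h1 h2) (smul_nonneg hμ h3)
      rw [← sub_nonneg]
      refine this.trans (le_of_eq ?_)
      module
    refine h6.trans ((smul_le_smul_of_nonneg_right (le_max_left _ 0) hθ0).trans ?_)
    exact smul_le_smul_of_nonneg_left hθ1 hM0
  have h7 : (1 - ε) * D.N y v ≤ M := by
    have h8 := CStarAlgebra.norm_le_of_nonneg_of_le_smul_one hM0
      (smul_nonneg (by linarith) h4) h5
    rw [norm_smul, Real.norm_of_nonneg (by linarith)] at h8
    exact (mul_le_mul_of_nonneg_left (D.N_le hgb v) (by linarith)).trans h8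
  have h9 : M ≤ max (D.N y (v + (μ : ℂ) • D.e) - μ) 0 + ε * (1 + μ) := by
    refine max_le ?_ (add_nonneg (le_max_right _ _) (by positivity))
    have := le_max_left (D.N y (v + (μ : ℂ) • D.e) - μ) 0
    rw [hm]; nlinarith
  nlinarith

/-- `N_le_max_of_nonneg` with `v = e` and `μ = 1` reads `N e ≤ max (2 N e - 1) 0`, while `N e ≤ 1`.
-/
theorem N_e_eq (y : X) : D.N y D.e = 0 ∨ D.N y D.e = 1 := by
  have h := D.N_le_max_of_nonneg (y := y) (v := D.e) (μ := 1) (by rw [D.ι_e]; exact zero_le_one)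
    zero_le_one
  have e : D.e + ((1 : ℝ) : ℂ) • D.e = ((2 : ℝ) : ℂ) • D.e := by
    rw [← one_smul ℂ D.e, smul_smul, ← add_smul]; norm_num
  rw [e, N_real_smul _ _ zero_le_two] at h
  have h0 := D.N_nonneg y D.e
  have h1 := D.N_e_le_one y
  rcases le_max_iff.1 h with h | h
  · exact .inr (by linarith)
  · exact .inl (by linarith)

/-- If `N y e = 0` the shift changes nothing; otherwise `N y e = 1` and `N_le_max_of_nonneg`
supplies the lower bound. This makes the shift in `P` irrelevant. -/
theorem N_add_smul_e {v : V} (hv : 0 ≤ D.ι v) {μ : ℝ} (hμ : 0 ≤ μ) :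
    D.N y (v + (μ : ℂ) • D.e) = D.N y v + μ * D.N y D.e := by
  refine le_antisymm ?_ ?_
  · exact (D.N_add_le _ _ _).trans (by rw [N_real_smul _ _ hμ])
  have h := D.N_le_max_of_nonneg (y := y) hv hμ
  have h2 : μ * D.N y D.e ≤ D.N y (v + (μ : ℂ) • D.e) + D.N y v := by
    have := D.N_le_add_sub y ((μ : ℂ) • D.e) (v + (μ : ℂ) • D.e)
    rwa [sub_add_cancel_right, N_neg, N_real_smul _ _ hμ] at this
  have h3 : D.N y v ≤ D.N y (v + (μ : ℂ) • D.e) + μ * D.N y D.e := by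
    have := D.N_le_add_sub y v (v + (μ : ℂ) • D.e)
    rwa [sub_add_cancel_left, N_neg, N_real_smul _ _ hμ] at this
  have h0 := D.N_nonneg y v
  rcases D.N_e_eq y with h4 | h4
  · rw [h4] at h3 ⊢; linarith
  · rw [h4] at h2 ⊢
    rcases le_max_iff.1 h with h | h <;> linarith

theorem ι_norm_smul_e_sub_nonneg {w : V} (hw : IsSelfAdjoint (D.ι w)) {l : ℝ} (hl : ‖D.ι w‖ ≤ l) :
    0 ≤ D.ι ((l : ℂ) • D.e - w) := by
  rw [map_sub, D.ι_complex_smul, D.ι_e, Complex.coe_smul, sub_nonneg]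
  exact hw.le_smul_one_of_norm_le hl

theorem ι_add_norm_smul_e_nonneg {w : V} (hw : IsSelfAdjoint (D.ι w)) {l : ℝ} (hl : ‖D.ι w‖ ≤ l) :
    0 ≤ D.ι (w + (l : ℂ) • D.e) := by
  have h : IsSelfAdjoint (D.ι (-w)) := by rw [map_neg]; exact hw.neg
  have := D.ι_norm_smul_e_sub_nonneg h (l := l) (by rwa [map_neg, norm_neg])
  rwa [sub_neg_eq_add, add_comm] at this

/-- For every bump `h` one has `0 ≤ h • (l e - w) ≤ l h • e`, and the norm is monotone on the
positive cone. -/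
theorem N_sub_le_of_nonneg {w : V} (hw : 0 ≤ D.ι w) {l : ℝ} (hl : ‖D.ι w‖ ≤ l) :
    D.N y ((l : ℂ) • D.e - w) ≤ l * D.N y D.e := by
  have hl0 : 0 ≤ l := (norm_nonneg _).trans hl
  rw [← N_real_smul _ _ hl0]
  refine D.le_N fun h hh => (D.N_le hh _).trans ?_
  refine CStarAlgebra.norm_le_norm_of_nonneg_of_le
    (D.ι_smul_nonneg hh.1 (D.ι_norm_smul_e_sub_nonneg (.of_nonneg hw) hl)) ?_
  rw [smul_sub, map_sub, sub_le_self_iff]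
  exact D.ι_smul_nonneg hh.1 hw

end CXSystem

/-! ### The Hahn–Banach theorem below a sublinear functional. -/

section Sublinear

variable {V : Type*} [AddCommGroup V] [Module ℝ V] {p : V → ℝ}

theorem sublinear_zero (hp : ∀ c : ℝ, 0 < c → ∀ w, p (c • w) = c * p w) : p 0 = 0 := by
  have := hp 2 two_pos 0
  rw [smul_zero] at this
  linarith

theorem exists_linear_le_sublinear (hp : ∀ c : ℝ, 0 < c → ∀ w, p (c • w) = c * p w)
    (hadd : ∀ w w', p (w + w') ≤ p w + p w') : ∃ g : V →ₗ[ℝ] ℝ, ∀ w, g w ≤ p w := by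
  obtain ⟨g, -, hg⟩ := exists_extension_of_le_sublinear (⊥ : V →ₗ.[ℝ] ℝ) p hp hadd (by
    rintro ⟨x, hx⟩
    have h0 : x = 0 := (Submodule.mem_bot ℝ).1 hx
    subst h0
    rw [show (⟨0, hx⟩ : (⊥ : V →ₗ.[ℝ] ℝ).domain) = 0 from rfl, LinearPMap.map_zero]
    exact (sublinear_zero hp).ge)
  exact ⟨g, hg⟩

/-- A linear functional below `p` can be chosen close to prescribed values at finitely many points
if the prescribed values are compatible with `p` up to a small error. -/
theorem exists_linear_le_sublinear_near (hp : ∀ c : ℝ, 0 < c → ∀ w, p (c • w) = c * p w)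
    (hadd : ∀ w w', p (w + w') ≤ p w + p w') {κ : Type*} [Fintype κ] [DecidableEq κ]
    (ws : κ → V) (α : κ → ℝ) {δ : ℝ}
    (hδ : 0 ≤ δ)
    (h : ∀ c : κ → ℝ, ∑ k, c k * α k ≤ p (∑ k, c k • ws k) + δ * ‖c‖) :
    ∃ g : V →ₗ[ℝ] ℝ, (∀ w, g w ≤ p w) ∧ ∀ k, |g (ws k) - α k| ≤ δ := by
  -- The infimum over `c` is the infimal convolution of `p` with the prescribed values on
  -- combinations of the `ws`, loosened by `δ ‖c‖`. The choice `c = 0` puts it below `p`, and `c = ±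
  -- Pi.single k 1` confines the value at `ws k` to within `δ`.
  set F : V → (κ → ℝ) → ℝ := fun w c =>
    p (w - ∑ k, c k • ws k) + ∑ k, c k * α k + δ * ‖c‖ with hF
  have hbdd : ∀ w, BddBelow (Set.range (F w)) := by
    intro w
    refine ⟨-p (-w), ?_⟩
    rintro _ ⟨c, rfl⟩
    have h1 := h (-c)
    simp only [Pi.neg_apply, neg_mul, neg_smul, Finset.sum_neg_distrib, norm_neg] at h1
    have h2 := hadd (w - ∑ k, c k • ws k) (-w)
    rw [show w - ∑ k, c k • ws k + -w = -∑ k, c k • ws k by abel] at h2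
    simp only [hF]
    linarith
  set q : V → ℝ := fun w => ⨅ c, F w c with hq
  have hqle : ∀ w c, q w ≤ F w c := fun w c => ciInf_le (hbdd w) c
  have hqhom : ∀ r : ℝ, 0 < r → ∀ w, q (r • w) = r * q w := by
    intro r hr w
    have e : ∀ c, F (r • w) (r • c) = r * F w c := by
      intro c
      simp only [hF, Pi.smul_apply, smul_eq_mul, norm_smul, Real.norm_of_nonneg hr.le, mul_smul,
        ← Finset.smul_sum, ← smul_sub, hp r hr, mul_assoc, ← Finset.mul_sum]
      ring
    simp only [hq]
    rw [Real.mul_iInf_of_nonneg hr.le]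
    refine le_antisymm (le_ciInf fun c => ?_) (le_ciInf fun c => ?_)
    · rw [← e]; exact ciInf_le (hbdd _) _
    · have e' := e (r⁻¹ • c)
      rw [smul_smul, mul_inv_cancel₀ hr.ne', one_smul] at e'
      rw [e']
      refine ciInf_le (f := fun c => r * F w c) ?_ (r⁻¹ • c)
      obtain ⟨b, hb⟩ := hbdd w
      refine ⟨r * b, ?_⟩
      rintro _ ⟨c, rfl⟩
      exact mul_le_mul_of_nonneg_left (hb ⟨c, rfl⟩) hr.le
  have hqadd : ∀ w w', q (w + w') ≤ q w + q w' := by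
    intro w w'
    refine le_ciInf_add_ciInf fun c c' => (hqle _ (c + c')).trans ?_
    have h1 := hadd (w - ∑ k, c k • ws k) (w' - ∑ k, c' k • ws k)
    have h2 := mul_le_mul_of_nonneg_left (norm_add_le c c') hδ
    simp only [hF, Pi.add_apply, add_smul, add_mul, Finset.sum_add_distrib]
    rw [show w + w' - (∑ k, c k • ws k + ∑ k, c' k • ws k)
      = w - ∑ k, c k • ws k + (w' - ∑ k, c' k • ws k) by abel]
    linarith
  obtain ⟨g, hg⟩ := exists_linear_le_sublinear hqhom hqadd
  refine ⟨g, fun w => (hg w).trans ((hqle w 0).trans (le_of_eq (by simp [hF]))), fun k => ?_⟩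
  have hp0 := sublinear_zero hp
  have h1 : g (ws k) ≤ α k + δ := by
    refine (hg _).trans ((hqle _ (Pi.single k 1)).trans (le_of_eq ?_))
    have hn : ‖(Pi.single k 1 : κ → ℝ)‖ = 1 := by rw [Pi.norm_single, norm_one]
    simp [hF, Pi.single_apply, hp0, hn]
  have h2 : g (-ws k) ≤ -α k + δ := by
    refine (hg _).trans ((hqle _ (-Pi.single k 1)).trans (le_of_eq ?_))
    have hn : ‖(Pi.single k 1 : κ → ℝ)‖ = 1 := by rw [Pi.norm_single, norm_one]
    simp [hF, Pi.single_apply, hp0, hn]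
  rw [map_neg] at h2
  rw [abs_le]; constructor <;> linarith

end Sublinear

/-! ### States of the fibres and their support functional `P`. -/

namespace CXSystem

variable {X V B : Type*} [TopologicalSpace X] [CompactSpace X] [AddCommGroup V]
    [Module ℂ V] [Module C(X, ℂ) V] [IsScalarTower ℂ C(X, ℂ) V] [CStarAlgebra B]
    (D : CXSystem X V B) [PartialOrder B] [StarOrderedRing B] [T2Space X]

/-- States of the fibre at `y` (which is the zero functional if the fibre vanishes), regarded as
functionals on `V`. -/
structure IsFibreState (y : X) (s : V →ₗ[ℂ] ℂ) : Prop where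
  map_e : s D.e = D.N y D.e
  nonneg : ∀ w, 0 ≤ D.ι w → 0 ≤ s w
  map_smul : ∀ (f : C(X, ℂ)) (w : V), s (f • w) = f y * s w

/-- The supremum of the values of the fibre states at `re w`. -/
noncomputable def P (y : X) (w : V) : ℝ :=
  D.N y (D.re w + ((‖D.ι w‖ : ℝ) : ℂ) • D.e) - ‖D.ι w‖ * D.N y D.e

namespace IsFibreState

variable {D} {y : X} {s : V →ₗ[ℂ] ℂ}

theorem eq_of_ι_eq (hs : D.IsFibreState y s) {w w' : V} (h : D.ι w = D.ι w') : s w = s w' := by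
  have h1 := hs.nonneg (w - w') (by rw [map_sub, h, sub_self])
  have h2 := hs.nonneg (w' - w) (by rw [map_sub, h, sub_self])
  rw [map_sub, sub_nonneg] at h1 h2
  exact le_antisymm h2 h1

theorem le_of_isSelfAdjoint (hs : D.IsFibreState y s) {w : V} (hw : IsSelfAdjoint (D.ι w)) :
    s w ≤ ((‖D.ι w‖ * D.N y D.e : ℝ) : ℂ) := by
  have h := hs.nonneg _ (D.ι_norm_smul_e_sub_nonneg hw le_rfl)
  rw [map_sub, LinearMap.map_smul, hs.map_e, smul_eq_mul, sub_nonneg] at h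
  simpa using h

theorem map_re (hs : D.IsFibreState y s) (w : V) : s (D.re w) = ((s w).re : ℂ) := by
  have him : ∀ w, IsSelfAdjoint (D.ι w) → (s w).im = 0 := fun w hw => by
    have := (Complex.le_def.1 (hs.le_of_isSelfAdjoint hw)).2
    simpa only [Complex.ofReal_im] using this
  have h1 := him _ (D.isSelfAdjoint_ι_re w)
  have h2 := him _ (D.isSelfAdjoint_ι_re (-Complex.I • w))
  have h3 : s w = s (D.re w) + Complex.I * s (D.re (-Complex.I • w)) := by
    rw [← smul_eq_mul, ← LinearMap.map_smul, ← map_add]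
    refine hs.eq_of_ι_eq ?_
    rw [map_add, D.ι_complex_smul, ι_re, ι_re, D.ι_complex_smul, star_smul]
    simp only [RCLike.star_def, map_neg, Complex.conj_I, neg_neg, smul_add, smul_smul, neg_smul,
      smul_neg]
    match_scalars <;> ring_nf <;> simp only [Complex.I_sq] <;> ring
  apply Complex.ext
  · rw [Complex.ofReal_re, h3, Complex.add_re, Complex.I_mul_re, h2, neg_zero, add_zero]
  · rw [Complex.ofReal_im, h1]

theorem norm_le_norm_ι (hs : D.IsFibreState y s) (w : V) : ‖s w‖ ≤ ‖D.ι w‖ := by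
  obtain ⟨c, hc, hcw⟩ : ∃ c : ℂ, ‖c‖ = 1 ∧ c * s w = (‖s w‖ : ℂ) := by
    rcases eq_or_ne (s w) 0 with h | h
    · exact ⟨1, by simp, by simp [h]⟩
    · refine ⟨star (s w) / ‖s w‖, ?_, ?_⟩
      · rw [norm_div, norm_star, Complex.norm_real, norm_norm, div_self (norm_ne_zero_iff.2 h)]
      · rw [div_mul_eq_mul_div, RCLike.star_def, Complex.conj_mul', pow_two, mul_div_assoc,
          div_self (by exact_mod_cast norm_ne_zero_iff.2 h), mul_one]
  have h1 := hs.map_re (c • w)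
  rw [LinearMap.map_smul, smul_eq_mul, hcw, Complex.ofReal_re] at h1
  have h2 := hs.le_of_isSelfAdjoint (D.isSelfAdjoint_ι_re (c • w))
  rw [h1, Complex.real_le_real] at h2
  have h3 := D.norm_ι_re_le (c • w)
  rw [D.ι_complex_smul, norm_smul, hc, one_mul] at h3
  refine h2.trans ((mul_le_of_le_one_right (norm_nonneg _) (D.N_e_le_one y)).trans h3)

/-- A bump at `y` does not change the value of `s`, so the bound by the norm localises. -/
theorem norm_le_N (hs : D.IsFibreState y s) (w : V) : ‖s w‖ ≤ D.N y w :=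
  D.le_N fun h hh => by
    have := hs.norm_le_norm_ι (ofRealC h • w)
    rwa [hs.map_smul, ofRealC_apply, hh.2.2, Complex.ofReal_one, one_mul] at this

theorem re_le_P (hs : D.IsFibreState y s) (w : V) : (s w).re ≤ D.P y w := by
  have h := hs.norm_le_N (D.re w + ((‖D.ι w‖ : ℝ) : ℂ) • D.e)
  rw [map_add, LinearMap.map_smul, hs.map_re, hs.map_e, smul_eq_mul] at h
  have h2 := (Complex.re_le_norm _).trans h
  rw [Complex.add_re, Complex.ofReal_re, ← Complex.ofReal_mul, Complex.ofReal_re] at h2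
  rw [P]
  linarith

end IsFibreState

variable {y : X}

/-- Shifts of positive elements by the unit are additive in `N`, so every shift beyond the norm
gives the same value. Subadditivity and homogeneity of `P` follow by choosing a shift that suits
both sides. -/
theorem P_eq {w : V} {l : ℝ} (hl : ‖D.ι w‖ ≤ l) :
    D.P y w = D.N y (D.re w + (l : ℂ) • D.e) - l * D.N y D.e := by
  have h := D.N_add_smul_e (y := y)
    (D.ι_add_norm_smul_e_nonneg (D.isSelfAdjoint_ι_re w) (D.norm_ι_re_le w))
    (sub_nonneg.2 hl)
  rw [add_assoc, ← add_smul, ← Complex.ofReal_add, add_sub_cancel] at h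
  rw [P, h]; ring

theorem P_add_le (y : X) (w w' : V) : D.P y (w + w') ≤ D.P y w + D.P y w' := by
  have h1 : ‖D.ι (w + w')‖ ≤ ‖D.ι w‖ + ‖D.ι w'‖ := by rw [map_add]; exact norm_add_le _ _
  rw [D.P_eq h1, P, P]
  have h2 : D.ι (D.re (w + w') + ((‖D.ι w‖ + ‖D.ι w'‖ : ℝ) : ℂ) • D.e)
      = D.ι ((D.re w + ((‖D.ι w‖ : ℝ) : ℂ) • D.e) + (D.re w' + ((‖D.ι w'‖ : ℝ) : ℂ) • D.e)) := by
    simp only [map_add, ι_re, D.ι_complex_smul, star_add, Complex.ofReal_add]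
    module
  rw [D.N_congr h2]
  have := D.N_add_le y (D.re w + ((‖D.ι w‖ : ℝ) : ℂ) • D.e) (D.re w' + ((‖D.ι w'‖ : ℝ) : ℂ) • D.e)
  linarith

theorem P_smul (y : X) {r : ℝ} (hr : 0 < r) (w : V) : D.P y (r • w) = r * D.P y w := by
  have hrw : r • w = (r : ℂ) • w := (Complex.coe_smul r w).symm
  have h1 : ‖D.ι (r • w)‖ ≤ r * ‖D.ι w‖ := by
    rw [hrw, D.ι_complex_smul, norm_smul, Complex.norm_real, Real.norm_of_nonneg hr.le]
  rw [D.P_eq h1, P]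
  have h2 : D.ι (D.re (r • w) + ((r * ‖D.ι w‖ : ℝ) : ℂ) • D.e)
      = D.ι ((r : ℂ) • (D.re w + ((‖D.ι w‖ : ℝ) : ℂ) • D.e)) := by
    simp only [hrw, map_add, ι_re, D.ι_complex_smul, star_smul, Complex.ofReal_mul,
      RCLike.star_def, Complex.conj_ofReal]
    module
  rw [D.N_congr h2, N_real_smul _ _ hr.le]
  ring

theorem P_le_N_re (y : X) (w : V) : D.P y w ≤ D.N y (D.re w) := by
  have := D.N_add_le y (D.re w) (((‖D.ι w‖ : ℝ) : ℂ) • D.e)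
  rw [N_real_smul _ _ (norm_nonneg _)] at this
  rw [P]; linarith

theorem P_le_N (y : X) (w : V) : D.P y w ≤ D.N y w := (D.P_le_N_re y w).trans (D.N_re_le y w)

theorem P_le_norm (y : X) (w : V) : D.P y w ≤ ‖D.ι w‖ := (D.P_le_N y w).trans (D.N_le_norm y w)

theorem P_neg_nonpos {w : V} (hw : 0 ≤ D.ι w) : D.P y (-w) ≤ 0 := by
  have h := D.N_sub_le_of_nonneg (y := y) hw le_rfl
  have e : D.ι (D.re (-w) + ((‖D.ι w‖ : ℝ) : ℂ) • D.e) = D.ι (((‖D.ι w‖ : ℝ) : ℂ) • D.e - w) := by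
    rw [map_add, D.ι_re_eq_of_isSelfAdjoint (by rw [map_neg]; exact (IsSelfAdjoint.of_nonneg hw).neg),
      map_sub, map_neg]
    abel
  rw [D.P_eq (l := ‖D.ι w‖) (by rw [map_neg, norm_neg]), D.N_congr e]
  linarith

/-- Together with `P_le_N` this forces a functional below `P` to take the value `N y e` at the unit.
-/
theorem P_neg_e (y : X) : D.P y (-D.e) = -D.N y D.e := by
  have h1 : ‖D.ι (-D.e)‖ ≤ 1 := by
    rw [map_neg, norm_neg]
    simpa [θ] using (D.norm_θ_le 1).trans (norm_le_one_of_star_mul_self (by simp))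
  have e : D.ι (D.re (-D.e) + ((1 : ℝ) : ℂ) • D.e) = D.ι ((0 : ℂ) • D.e) := by
    rw [map_add, D.ι_re_eq_of_isSelfAdjoint (by rw [map_neg, D.ι_e]; exact (IsSelfAdjoint.one _).neg)]
    simp
  rw [D.P_eq h1, D.N_congr e, N_complex_smul]
  simp

theorem P_sub_le (y : X) (w w' : V) : D.P y w ≤ D.P y w' + ‖D.ι (w - w')‖ := by
  have h := D.P_add_le y w' (w - w')
  rw [add_sub_cancel] at h
  have := D.P_le_norm y (w - w')
  linarith

theorem continuous_P (hN : ∀ w, Continuous fun y => D.N y w) (w : V) :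
    Continuous fun y => D.P y w :=
  (hN _).sub (continuous_const.mul (hN _))

/-- Real functionals dominated by `P` are the real parts of the fibre states. -/
theorem exists_isFibreState {g : V →ₗ[ℝ] ℝ} (hg : ∀ w, g w ≤ D.P y w) :
    ∃ s : V →ₗ[ℂ] ℂ, D.IsFibreState y s ∧ ∀ w, (s w).re = g w := by
  have hzero : ∀ w, D.N y (D.re w) = 0 → D.N y (D.re (-w)) = 0 → g w = 0 := by
    intro w h1 h2
    have h3 := (hg w).trans (D.P_le_N_re y w)
    have h4 := (hg (-w)).trans (D.P_le_N_re y (-w))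
    rw [map_neg] at h4
    linarith
  have hre : ∀ w, D.N y w = 0 → D.N y (D.re w) = 0 := fun w h =>
    le_antisymm ((D.N_re_le y w).trans h.le) (D.N_nonneg _ _)
  -- The real parts of `i w` and `-i w` vanish, and `P` is dominated by `N` of the real part.
  have hI : ∀ w, IsSelfAdjoint (D.ι w) → g (Complex.I • w) = 0 := by
    intro w hw
    have : ∀ c : ℂ, star c = -c → D.N y (D.re (c • w)) = 0 := by
      intro c hc
      have e : D.ι (D.re (c • w)) = D.ι ((0 : ℂ) • w) := by
        rw [ι_re, D.ι_complex_smul, D.ι_complex_smul, star_smul, hw.star_eq, hc]; simp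
      rw [D.N_congr e, N_complex_smul]; simp
    refine hzero _ (this _ (by simp)) ?_
    rw [← neg_smul]
    exact this _ (by simp)
  let s : V →ₗ[ℂ] ℂ :=
    { toFun := fun w => (g w : ℂ) - Complex.I * (g (Complex.I • w) : ℂ)
      map_add' := fun w w' => by simp only [smul_add, map_add]; push_cast; ring
      map_smul' := fun c w => by
        have e1 : c • w = c.re • w + c.im • (Complex.I • w) := by
          rw [← Complex.coe_smul, ← Complex.coe_smul, smul_smul, ← add_smul, Complex.re_add_im]
        have e2 : Complex.I • c • w = c.re • (Complex.I • w) - c.im • w := by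
          rw [← Complex.coe_smul, ← Complex.coe_smul, smul_smul, smul_smul, ← sub_smul]
          congr 1
          apply Complex.ext <;> simp
        simp only [e2]
        simp only [e1, map_add, map_sub, LinearMap.map_smul, smul_eq_mul, RingHom.id_apply]
        apply Complex.ext
        · simp
        · simp; ring }
  have hs : ∀ w, s w = (g w : ℂ) - Complex.I * (g (Complex.I • w) : ℂ) := fun w => rfl
  refine ⟨s, ⟨?_, ?_, ?_⟩, fun w => ?_⟩
  · have h1 := (hg D.e).trans (D.P_le_N y D.e)
    have h2 := hg (-D.e)
    rw [P_neg_e, map_neg] at h2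
    rw [hs, hI _ (by rw [D.ι_e]; exact .one _), le_antisymm h1 (by linarith)]
    simp
  · intro w hw
    have h2 := (hg (-w)).trans (D.P_neg_nonpos hw)
    rw [map_neg] at h2
    rw [hs, hI _ (.of_nonneg hw)]
    have : 0 ≤ g w := by linarith
    simpa using this
  · intro f w
    have hz : ∀ h : C(X, ℂ), h y = 0 → ∀ w, g (h • w) = 0 := by
      intro h hh w
      refine hzero _ (hre _ (D.N_eq_zero_of_apply_eq_zero hh w)) (hre _ ?_)
      rw [N_neg]; exact D.N_eq_zero_of_apply_eq_zero hh w
    have hf0 : (f - f y • (1 : C(X, ℂ))) y = 0 := by simp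
    have h0 : s ((f - f y • (1 : C(X, ℂ))) • w) = 0 := by
      rw [hs, ← smul_comm, hz _ hf0, hz _ hf0]; simp
    rw [sub_smul, smul_assoc, one_smul, map_sub, LinearMap.map_smul, smul_eq_mul] at h0
    exact sub_eq_zero.1 h0
  · rw [hs]; simp

theorem exists_isFibreState_near {κ : Type*} [Fintype κ] [DecidableEq κ] (ws : κ → V) (α : κ → ℝ)
    {δ : ℝ} (hδ : 0 ≤ δ) (h : ∀ c : κ → ℝ, ∑ k, c k * α k ≤ D.P y (∑ k, c k • ws k) + δ * ‖c‖) :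
    ∃ s : V →ₗ[ℂ] ℂ, D.IsFibreState y s ∧ ∀ k, |(s (ws k)).re - α k| ≤ δ := by
  obtain ⟨g, hg, hg'⟩ := exists_linear_le_sublinear_near
    (fun c hc w => D.P_smul y hc w) (D.P_add_le y) ws α hδ h
  obtain ⟨s, hs, hs'⟩ := D.exists_isFibreState hg
  exact ⟨s, hs, fun k => by rw [hs']; exact hg' k⟩

/-- The supremum of the fibre states at `re w` is attained. -/
theorem exists_isFibreState_re_eq (y : X) (w : V) :
    ∃ s : V →ₗ[ℂ] ℂ, D.IsFibreState y s ∧ (s w).re = D.P y w := by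
  obtain ⟨s, hs, h⟩ := D.exists_isFibreState_near (y := y) (κ := Fin 1) (fun _ => w) (fun _ => D.P y w)
    le_rfl (fun c => by
      have h0 : D.P y 0 = 0 := sublinear_zero (fun c hc w => D.P_smul y hc w)
      simp only [Finset.univ_unique, Finset.sum_singleton, zero_mul, add_zero]
      rcases lt_trichotomy (c default) 0 with hc | hc | hc
      · have h1 := D.P_add_le y w (-w)
        rw [add_neg_cancel, h0] at h1
        have h2 : c default • w = (-c default) • (-w) := by simp
        rw [h2, P_smul _ _ (by linarith)]
        nlinarith
      · rw [hc]; simp [h0]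
      · rw [P_smul _ _ hc])
  refine ⟨s, hs, ?_⟩
  have := h 0
  simpa [sub_eq_zero] using this

end CXSystem

/-! ### Michael's selection theorem. -/

section Selection

variable {X E : Type*} [TopologicalSpace X] [CompactSpace X] [T2Space X] [NormedAddCommGroup E]
  [NormedSpace ℝ E]

/-- Lower semicontinuity of a set-valued map into a normed space. -/
def IsLSC (F : X → Set E) : Prop :=
  ∀ y₀, ∀ e ∈ F y₀, ∀ ε : ℝ, 0 < ε → ∀ᶠ y in 𝓝 y₀, ∃ e' ∈ F y, ‖e' - e‖ < ε

/-- Points chosen at finitely many nodes are averaged by a partition of unity; the average is close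
to a convex combination of nearby points of `F y`. -/
theorem IsLSC.exists_approximate_selection {F : X → Set E} (hF : IsLSC F)
    (hne : ∀ y, (F y).Nonempty) (hconv : ∀ y, Convex ℝ (F y)) {ε : ℝ} (hε : 0 < ε) :
    ∃ f : C(X, E), ∀ y, ∃ e ∈ F y, ‖f y - e‖ < ε := by
  choose σ hσ using hne
  obtain ⟨n, p, χ, h0, h1, h2⟩ := exists_finite_partition_of_unity
    (fun x => {y | ∃ e ∈ F y, ‖e - σ x‖ < ε / 2}) (fun x => by
      rw [isOpen_iff_mem_nhds]
      rintro y ⟨e, he, hlt⟩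
      filter_upwards [hF y e he (ε / 2 - ‖e - σ x‖) (by linarith)] with z hz
      obtain ⟨e', he', hlt'⟩ := hz
      refine ⟨e', he', ?_⟩
      have := norm_sub_le_norm_sub_add_norm_sub e' e (σ x)
      linarith) (fun x => ⟨σ x, hσ x, by simpa using hε⟩)
  refine ⟨⟨fun y => ∑ l, χ l y • σ (p l), by fun_prop⟩, fun y => ?_⟩
  have hch : ∀ l, ∃ e ∈ F y, χ l y ≠ 0 → ‖e - σ (p l)‖ < ε / 2 := by
    intro l
    by_cases h : χ l y = 0
    · exact ⟨σ y, hσ y, fun h' => absurd h h'⟩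
    · obtain ⟨e, he, hlt⟩ := h2 l y h
      exact ⟨e, he, fun _ => hlt⟩
  choose e he hlt using hch
  refine ⟨∑ l, χ l y • e l, (hconv y).sum_mem (fun l _ => h0 l y) (h1 y) (fun l _ => he l), ?_⟩
  change ‖∑ l, χ l y • σ (p l) - ∑ l, χ l y • e l‖ < ε
  rw [← Finset.sum_sub_distrib]
  calc _ ≤ ∑ l, χ l y * (ε / 2) := by
        refine norm_sum_le_of_le _ fun l _ => ?_
        rw [← smul_sub, norm_smul, Real.norm_of_nonneg (h0 l y)]
        by_cases h : χ l y = 0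
        · simp [h]
        · refine mul_le_mul_of_nonneg_left ?_ (h0 l y)
          rw [norm_sub_rev]; exact (hlt l h).le
    _ < ε := by rw [← Finset.sum_mul, h1, one_mul]; linarith

theorem IsLSC.inter_ball {F : X → Set E} (hF : IsLSC F) (f : C(X, E)) (r : ℝ) :
    IsLSC fun y => F y ∩ {e | ‖f y - e‖ < r} := by
  rintro y₀ e ⟨he, her⟩ ε hε
  have her' : 0 < r - ‖f y₀ - e‖ := sub_pos.2 her
  have hc : ∀ᶠ y in 𝓝 y₀, ‖f y - f y₀‖ < (r - ‖f y₀ - e‖) / 2 := by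
    have := (f.continuous.tendsto y₀).eventually (Metric.ball_mem_nhds _ (half_pos her'))
    simpa [dist_eq_norm] using this
  filter_upwards [hc, hF y₀ e he (min ε ((r - ‖f y₀ - e‖) / 2)) (by positivity)] with y h1 h2
  obtain ⟨e', he', hlt⟩ := h2
  refine ⟨e', ⟨he', ?_⟩, hlt.trans_le (min_le_left _ _)⟩
  have h3 := hlt.trans_le (min_le_right _ _)
  have h4 := norm_sub_le_norm_sub_add_norm_sub (f y) (f y₀) e'
  have h5 := norm_sub_le_norm_sub_add_norm_sub (f y₀) e e'
  rw [norm_sub_rev e e'] at h5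
  change ‖f y - e'‖ < r
  linarith

/-- Michael's selection theorem on a compact Hausdorff space. -/
theorem IsLSC.exists_selection [CompleteSpace E] {F : X → Set E} (hF : IsLSC F)
    (hne : ∀ y, (F y).Nonempty) (hconv : ∀ y, Convex ℝ (F y)) (hcl : ∀ y, IsClosed (F y)) :
    ∃ f : C(X, E), ∀ y, f y ∈ F y := by
  let Good : ℕ → C(X, E) → Prop := fun n f => ∀ y, ∃ e ∈ F y, ‖f y - e‖ < (1 / 2 : ℝ) ^ n
  obtain ⟨f₀, hf₀⟩ := hF.exists_approximate_selection hne hconv one_pos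
  have hstep : ∀ n (f : C(X, E)), Good n f →
      ∃ g, Good (n + 1) g ∧ dist f g ≤ 2 * (1 / 2 : ℝ) ^ n := by
    intro n f hf
    -- The next approximation is selected from the part of `F` within `2⁻ⁿ` of the present one, so
    -- the approximations form a geometric Cauchy sequence.
    obtain ⟨g, hg⟩ := (hF.inter_ball f ((1 / 2 : ℝ) ^ n)).exists_approximate_selection
      (fun y => by obtain ⟨e, he, hlt⟩ := hf y; exact ⟨e, he, hlt⟩)
      (fun y => (hconv y).inter (by
        have : {e | ‖f y - e‖ < (1 / 2 : ℝ) ^ n} = Metric.ball (f y) ((1 / 2 : ℝ) ^ n) := by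
          ext e; simp [dist_eq_norm, norm_sub_rev]
        rw [this]; exact convex_ball _ _))
      (show 0 < (1 / 2 : ℝ) ^ (n + 1) by positivity)
    refine ⟨g, fun y => by obtain ⟨e, he, hlt⟩ := hg y; exact ⟨e, he.1, hlt⟩, ?_⟩
    rw [ContinuousMap.dist_le (by positivity)]
    intro y
    obtain ⟨e, he, hlt⟩ := hg y
    have h1 : ‖f y - e‖ < (1 / 2 : ℝ) ^ n := he.2
    rw [dist_eq_norm]
    have h2 := norm_sub_le_norm_sub_add_norm_sub (f y) e (g y)
    rw [norm_sub_rev e] at h2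
    have h3 : (1 / 2 : ℝ) ^ (n + 1) ≤ (1 / 2 : ℝ) ^ n :=
      pow_le_pow_of_le_one (by norm_num) (by norm_num) (Nat.le_succ n)
    linarith
  choose! G hG hd using hstep
  let φ : ℕ → C(X, E) := fun n => Nat.rec f₀ (fun n f => G n f) n
  have hφ : ∀ n, Good n (φ n) := by
    intro n
    induction n with
    | zero =>
      change ∀ y, ∃ e ∈ F y, ‖f₀ y - e‖ < (1 / 2 : ℝ) ^ 0
      simpa using hf₀
    | succ n ih => exact hG n _ ih
  have hcs : CauchySeq φ := by
    refine cauchySeq_of_le_geometric (1 / 2) 2 (by norm_num) fun n => ?_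
    exact hd n _ (hφ n)
  obtain ⟨f, hf⟩ := cauchySeq_tendsto_of_complete hcs
  refine ⟨f, fun y => ?_⟩
  choose e he hlt using fun n => hφ n y
  have hfy : Tendsto (fun n => φ n y) atTop (𝓝 (f y)) :=
    ((continuous_eval_const y).tendsto f).comp hf
  have hdiff : Tendsto (fun n => φ n y - e n) atTop (𝓝 0) :=
    squeeze_zero_norm (fun n => (hlt n).le)
      (tendsto_pow_atTop_nhds_zero_of_lt_one (by norm_num) (by norm_num))
  have he' : Tendsto e atTop (𝓝 (f y)) := by
    simpa using hfy.sub hdiff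
  exact (hcl y).mem_of_tendsto he' (Eventually.of_forall he)

/-- Michael's selection theorem with a prescribed value at one point. -/
theorem IsLSC.exists_selection_apply_eq [CompleteSpace E] {F : X → Set E} (hF : IsLSC F)
    (hne : ∀ y, (F y).Nonempty) (hconv : ∀ y, Convex ℝ (F y)) (hcl : ∀ y, IsClosed (F y))
    {x₀ : X} {e₀ : E} (he₀ : e₀ ∈ F x₀) : ∃ f : C(X, E), (∀ y, f y ∈ F y) ∧ f x₀ = e₀ := by
  classical
  -- Shrinking the value at one point preserves lower semicontinuity, because the complement of the
  -- point is open.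
  let F' : X → Set E := fun y => if y = x₀ then {e₀} else F y
  have hsub : ∀ y, F' y ⊆ F y := by
    intro y e he
    by_cases h : y = x₀
    · subst h; simp only [F', if_pos] at he; rw [he]; exact he₀
    · simpa [F', h] using he
  have hlsc : IsLSC F' := by
    intro y₀ e he ε hε
    have h1 := hF y₀ e (hsub y₀ he) ε hε
    by_cases h : y₀ = x₀
    · subst h
      have hee : e = e₀ := by simpa [F'] using he
      filter_upwards [h1] with y hy
      by_cases h' : y = y₀
      · exact ⟨e₀, by simp [F', h'], by simpa [hee] using hε⟩
      · simpa [F', h'] using hy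
    · filter_upwards [h1, isOpen_ne.mem_nhds h] with y hy hne
      have : y ≠ x₀ := hne
      simpa [F', this] using hy
  obtain ⟨f, hf⟩ := hlsc.exists_selection
    (fun y => by
      by_cases h : y = x₀
      · simp [F', h]
      · simpa [F', h] using hne y)
    (fun y => by
      by_cases h : y = x₀
      · simp [F', h]
      · simpa [F', h] using hconv y)
    (fun y => by
      by_cases h : y = x₀
      · simp [F', h]
      · simpa [F', h] using hcl y)
  exact ⟨f, fun y => hsub y (hf y), by simpa [F'] using hf x₀⟩

end Selection

/-! ### Continuous families of fibre states. -/

namespace CXSystem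

variable {X V B : Type*} [TopologicalSpace X] [CompactSpace X] [AddCommGroup V]
    [Module ℂ V] [Module C(X, ℂ) V] [IsScalarTower ℂ C(X, ℂ) V] [CStarAlgebra B]
    {D : CXSystem X V B} [PartialOrder B] [StarOrderedRing B] [T2Space X] {y : X}

theorem IsFibreState.convex {s s' : V →ₗ[ℂ] ℂ} (hs : D.IsFibreState y s)
    (hs' : D.IsFibreState y s') {a b : ℝ} (ha : 0 ≤ a) (hb : 0 ≤ b) (hab : a + b = 1) :
    D.IsFibreState y ((a : ℂ) • s + (b : ℂ) • s') where
  map_e := by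
    have : (a : ℂ) + b = 1 := by exact_mod_cast hab
    simp only [LinearMap.add_apply, LinearMap.smul_apply, hs.map_e, hs'.map_e, smul_eq_mul,
      ← add_mul, this, one_mul]
  nonneg w hw := by
    simp only [LinearMap.add_apply, LinearMap.smul_apply, smul_eq_mul]
    exact add_nonneg (mul_nonneg (by exact_mod_cast ha) (hs.nonneg w hw))
      (mul_nonneg (by exact_mod_cast hb) (hs'.nonneg w hw))
  map_smul f w := by
    simp only [LinearMap.add_apply, LinearMap.smul_apply, smul_eq_mul, hs.map_smul, hs'.map_smul]
    ring

/-- Every sequence of fibre states has a pointwise limit along an ultrafilter. -/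
theorem IsFibreState.exists_limit (U : Ultrafilter ℕ) {s : ℕ → V →ₗ[ℂ] ℂ}
    (hs : ∀ m, D.IsFibreState y (s m)) :
    ∃ t : V →ₗ[ℂ] ℂ, D.IsFibreState y t ∧ ∀ w, Tendsto (fun m => s m w) U (𝓝 (t w)) := by
  have hlim : ∀ w, ∃ z, Tendsto (fun m => s m w) U (𝓝 z) := by
    intro w
    obtain ⟨z, -, hz⟩ := (isCompact_closedBall (0 : ℂ) ‖D.ι w‖).ultrafilter_le_nhds
      (U.map fun m => s m w) (by
        rw [le_principal_iff, Ultrafilter.coe_map, Filter.mem_map]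
        exact Filter.univ_mem' fun m => by
          simpa using (hs m).norm_le_norm_ι w)
    exact ⟨z, hz⟩
  choose t ht using hlim
  refine ⟨⟨⟨t, fun w w' => ?_⟩, fun c w => ?_⟩, ⟨?_, fun w hw => ?_, fun f w => ?_⟩, ht⟩
  · refine tendsto_nhds_unique (ht _) ?_
    simpa using (ht w).add (ht w')
  · refine tendsto_nhds_unique (ht _) ?_
    simpa using (ht w).const_mul c
  · refine tendsto_nhds_unique (ht _) ?_
    simp only [(hs _).map_e]
    exact tendsto_const_nhds
  · exact ge_of_tendsto (ht w) (Eventually.of_forall fun m => (hs m).nonneg w hw)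
  · refine tendsto_nhds_unique (ht _) ?_
    simp only [(hs _).map_smul]
    exact (ht w).const_mul _

/-- Joint continuity: continuous in the point for fixed coefficients, and Lipschitz in the
coefficients with a constant that does not depend on the point. -/
theorem continuous_P_sum (hN : ∀ w, Continuous fun y => D.N y w) {κ : Type*} [Fintype κ]
    (ws : κ → V) : Continuous fun z : X × (κ → ℝ) => D.P z.1 (∑ k, z.2 k • ws k) := by
  refine continuous_prod_of_continuous_lipschitzWith' (fun z : X × (κ → ℝ) =>
    D.P z.1 (∑ k, z.2 k • ws k)) (∑ k, ‖D.ι (ws k)‖₊) (fun y => ?_) 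
    (fun c => D.continuous_P hN (∑ k, c k • ws k))
  refine LipschitzWith.of_le_add_mul _ fun c c' => ?_
  refine (D.P_sub_le _ _ _).trans (add_le_add_right ?_ _)
  rw [← Finset.sum_sub_distrib, map_sum]
  push_cast
  rw [Finset.sum_mul]
  refine norm_sum_le_of_le _ fun k _ => ?_
  rw [← sub_smul, ← Complex.coe_smul, D.ι_complex_smul, norm_smul, mul_comm, Complex.norm_real]
  refine mul_le_mul_of_nonneg_left ?_ (norm_nonneg _)
  exact dist_le_pi_dist c c' k

/-- Fibre states can be moved to nearby fibres, approximately on finitely many elements. -/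
theorem IsFibreState.eventually_exists_near (hN : ∀ w, Continuous fun y => D.N y w)
    {s : V →ₗ[ℂ] ℂ} (hs : D.IsFibreState y s) {κ : Type*} [Fintype κ] [DecidableEq κ] (ws : κ → V)
    {δ : ℝ} (hδ : 0 < δ) :
    ∀ᶠ z in 𝓝 y, ∃ s', D.IsFibreState z s' ∧ ∀ k, |(s' (ws k)).re - (s (ws k)).re| ≤ δ := by
  have hcont := continuous_P_sum hN ws
  -- Compactness makes the neighbourhood uniform over unit vectors of coefficients; homogeneity of
  -- `P` then gives the error `δ ‖c‖` that `exists_isFibreState_near` allows.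
  have hev : ∀ᶠ z in 𝓝 y, ∀ c ∈ Metric.sphere (0 : κ → ℝ) 1,
      D.P y (∑ k, c k • ws k) < D.P z (∑ k, c k • ws k) + δ := by
    refine (isCompact_sphere (0 : κ → ℝ) 1).eventually_forall_of_forall_eventually fun c _ => ?_
    have h1 : Continuous fun z : X × (κ → ℝ) => D.P y (∑ k, z.2 k • ws k) :=
      hcont.comp (continuous_const.prodMk continuous_snd)
    have := isOpen_lt h1 (hcont.add (continuous_const (y := δ)))
    exact this.mem_nhds (show D.P y (∑ k, c k • ws k) < D.P y (∑ k, c k • ws k) + δ by linarith)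
  filter_upwards [hev] with z hz
  refine D.exists_isFibreState_near ws (fun k => (s (ws k)).re) hδ.le fun c => ?_
  have hsum : ∑ k, c k * (s (ws k)).re = (s (∑ k, c k • ws k)).re := by
    rw [map_sum, Complex.re_sum]
    refine Finset.sum_congr rfl fun k _ => ?_
    rw [← Complex.coe_smul, LinearMap.map_smul, smul_eq_mul, Complex.re_ofReal_mul]
  rw [hsum]
  refine (hs.re_le_P _).trans ?_
  rcases eq_or_ne c 0 with rfl | hc
  · have h0 : ∀ z, D.P z 0 = 0 := fun z => sublinear_zero fun c hc w => D.P_smul z hc w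
    simp [h0]
  have hn : 0 < ‖c‖ := norm_pos_iff.2 hc
  have h1 := hz (‖c‖⁻¹ • c) (by simp [norm_smul, hn.ne'])
  have e : ∑ k, c k • ws k = ‖c‖ • ∑ k, (‖c‖⁻¹ • c) k • ws k := by
    rw [Finset.smul_sum]
    refine Finset.sum_congr rfl fun k _ => ?_
    rw [smul_smul, Pi.smul_apply, smul_eq_mul, mul_inv_cancel_left₀ hn.ne']
  rw [e, D.P_smul _ hn, D.P_smul _ hn]
  nlinarith

/-- A fibre state extends to a `C(X)`-linear family of fibre states. -/
theorem IsFibreState.exists_extension (hN : ∀ w, Continuous fun y => D.N y w)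
    (d : ℕ → V) (hd : ∀ w, ∀ ε : ℝ, 0 < ε → ∃ k, ‖D.ι (w - d k)‖ < ε)
    {x₀ : X} {s₀ : V →ₗ[ℂ] ℂ} (hs₀ : D.IsFibreState x₀ s₀) :
    ∃ t : V →ₗ[C(X, ℂ)] C(X, ℂ), (∀ w, t w x₀ = s₀ w) ∧
      ∀ y, ∃ s, D.IsFibreState y s ∧ ∀ w, t w y = s w := by
  -- With these weights the `k`-th coordinate of every coded state is at most `2⁻ᵏ`, so that
  -- closeness in norm concerns only finitely many coordinates.
  let cc : ℕ → ℝ := fun k => (1 / 2 : ℝ) ^ k / (1 + ‖D.ι (d k)‖)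
  have hcc : ∀ k, 0 < cc k := fun k => by positivity
  have hbound : ∀ {y s}, D.IsFibreState y s → ∀ k, ‖(cc k : ℂ) * s (d k)‖ ≤ (1 / 2 : ℝ) ^ k := by
    intro y s hs k
    rw [norm_mul, Complex.norm_real, Real.norm_of_nonneg (hcc k).le]
    have h1 := hs.norm_le_norm_ι (d k)
    change (1 / 2 : ℝ) ^ k / (1 + ‖D.ι (d k)‖) * _ ≤ _
    rw [div_mul_eq_mul_div, div_le_iff₀ (by positivity)]
    exact mul_le_mul_of_nonneg_left (by linarith) (by positivity)
  let F : X → Set (BoundedContinuousFunction ℕ ℂ) := fun y =>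
    {e | ∃ s, D.IsFibreState y s ∧ ∀ k, e k = cc k * s (d k)}
  have hF : ∀ {y s}, D.IsFibreState y s → ∃ e : BoundedContinuousFunction ℕ ℂ,
      ∀ k, e k = cc k * s (d k) := by
    intro y s hs
    exact ⟨BoundedContinuousFunction.ofNormedAddCommGroupDiscrete (fun k => (cc k : ℂ) * s (d k)) 1
      (fun k => (hbound hs k).trans (pow_le_one₀ (by norm_num) (by norm_num))), fun k => rfl⟩
  have hne : ∀ y, (F y).Nonempty := by
    intro y
    obtain ⟨s, hs, -⟩ := D.exists_isFibreState_re_eq y 0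
    obtain ⟨e, he⟩ := hF hs
    exact ⟨e, s, hs, he⟩
  have hconv : ∀ y, Convex ℝ (F y) := by
    rintro y e ⟨s, hs, he⟩ e' ⟨s', hs', he'⟩ a b ha hb hab
    refine ⟨_, hs.convex hs' ha hb hab, fun k => ?_⟩
    simp only [BoundedContinuousFunction.coe_add, BoundedContinuousFunction.coe_smul,
      Pi.add_apply, he, he', LinearMap.add_apply, LinearMap.smul_apply, smul_eq_mul,
      Complex.real_smul]
    ring
  have hcl : ∀ y, IsClosed (F y) := by
    intro y
    rw [← isSeqClosed_iff_isClosed]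
    intro e e' he hlim
    choose s hs hse using he
    -- Along a free ultrafilter the states converge pointwise to a fibre state, which codes the
    -- limit sequence.
    obtain ⟨t, ht, htlim⟩ := IsFibreState.exists_limit (hyperfilter ℕ) hs
    refine ⟨t, ht, fun k => ?_⟩
    have h1 : Tendsto (fun m => e m k) (hyperfilter ℕ : Filter ℕ) (𝓝 (e' k)) :=
      (((continuous_eval_const (F := BoundedContinuousFunction ℕ ℂ) k).tendsto e').comp hlim).mono_left
        Nat.hyperfilter_le_atTop
    refine tendsto_nhds_unique h1 ?_
    simp only [hse]
    exact (htlim (d k)).const_mul _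
  have hlsc : IsLSC F := by
    rintro y₀ e ⟨s, hs, he⟩ ε hε
    obtain ⟨K, hK⟩ := exists_pow_lt_of_lt_one (show 0 < ε / 4 by positivity)
      (show (1 / 2 : ℝ) < 1 by norm_num)
    -- Only real parts are controlled; the imaginary part of `s (d k)` is the real part of `s` at
    -- `-i d k`, whence the factor `Bool`.
    have hev := hs.eventually_exists_near hN (κ := Fin K × Bool)
      (fun p => if p.2 then d p.1 else -Complex.I • d p.1) (show 0 < ε / 4 by positivity)
    filter_upwards [hev] with y hy
    obtain ⟨s', hs', hnear⟩ := hy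
    obtain ⟨e', he'⟩ := hF hs'
    refine ⟨e', ⟨s', hs', he'⟩, lt_of_le_of_lt ?_ (show ε / 2 < ε by linarith)⟩
    rw [BoundedContinuousFunction.norm_le (by positivity)]
    intro k
    rw [BoundedContinuousFunction.coe_sub, Pi.sub_apply, he, he']
    by_cases hk : k < K
    · have h1 := hnear (⟨k, hk⟩, true)
      have h2 := hnear (⟨k, hk⟩, false)
      simp only [if_true, LinearMap.map_smul, smul_eq_mul, Bool.false_eq_true, if_false] at h1 h2
      rw [← mul_sub, norm_mul, Complex.norm_real, Real.norm_of_nonneg (hcc k).le]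
      have h3 : ‖s' (d k) - s (d k)‖ ≤ ε / 4 + ε / 4 := by
        refine (Complex.norm_le_abs_re_add_abs_im _).trans (add_le_add ?_ ?_)
        · simpa using h1
        · simpa using h2
      have h4 : cc k ≤ 1 := by
        change (1 / 2 : ℝ) ^ k / (1 + ‖D.ι (d k)‖) ≤ 1
        rw [div_le_one (by positivity)]
        have : (1 / 2 : ℝ) ^ k ≤ 1 := pow_le_one₀ (by norm_num) (by norm_num)
        have := norm_nonneg (D.ι (d k))
        linarith
      calc cc k * ‖s' (d k) - s (d k)‖ ≤ 1 * (ε / 4 + ε / 4) :=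
            mul_le_mul h4 h3 (norm_nonneg _) zero_le_one
        _ = ε / 2 := by ring
    · refine (norm_sub_le _ _).trans ((add_le_add (hbound hs' k) (hbound hs k)).trans ?_)
      have : (1 / 2 : ℝ) ^ k ≤ (1 / 2 : ℝ) ^ K :=
        pow_le_pow_of_le_one (by norm_num) (by norm_num) (not_lt.1 hk)
      linarith
  obtain ⟨e₀, he₀⟩ := hF hs₀
  obtain ⟨f, hf, hf₀⟩ := hlsc.exists_selection_apply_eq hne hconv hcl (x₀ := x₀) (e₀ := e₀)
    ⟨s₀, hs₀, he₀⟩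
  choose σ hσ hσf using hf
  have hd_cont : ∀ k, Continuous fun y => σ y (d k) := by
    intro k
    have h1 : ∀ y, σ y (d k) = (cc k : ℂ)⁻¹ * f y k := fun y => by
      rw [hσf, inv_mul_cancel_left₀ (by exact_mod_cast (hcc k).ne')]
    simp only [h1]
    exact continuous_const.mul
      ((continuous_eval_const (F := BoundedContinuousFunction ℕ ℂ) k).comp f.continuous)
  have hcont : ∀ w, Continuous fun y => σ y w := by
    intro w
    refine continuous_of_uniform_approx_of_continuous fun u hu => ?_
    obtain ⟨ε, hε, hεu⟩ := Metric.mem_uniformity_dist.1 hu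
    obtain ⟨k, hk⟩ := hd w ε hε
    refine ⟨fun y => σ y (d k), hd_cont k, fun y => hεu ?_⟩
    rw [dist_eq_norm, ← map_sub]
    exact ((hσ y).norm_le_norm_ι _).trans_lt hk
  refine ⟨⟨⟨fun w => ⟨fun y => σ y w, hcont w⟩, fun w w' => by ext y; simp⟩,
    fun g w => by ext y; exact (hσ y).map_smul g w⟩, fun w => ?_, fun y => ⟨σ y, hσ y, fun w => rfl⟩⟩
  change σ x₀ w = s₀ w
  have hk : ∀ k, σ x₀ (d k) = s₀ (d k) := by
    intro k
    have h1 := hσf x₀ k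
    rw [hf₀, he₀] at h1
    exact (mul_left_cancel₀ (by exact_mod_cast (hcc k).ne') h1).symm
  refine eq_of_forall_dist_le fun ε hε => ?_
  obtain ⟨k, hkε⟩ := hd w (ε / 2) (by positivity)
  have h1 := ((hσ x₀).norm_le_norm_ι (w - d k)).trans hkε.le
  have h2 := (hs₀.norm_le_norm_ι (w - d k)).trans hkε.le
  rw [map_sub] at h1 h2
  rw [hk] at h1
  rw [dist_eq_norm]
  have := norm_sub_le_norm_sub_add_norm_sub (σ x₀ w) (s₀ (d k)) (s₀ w)
  rw [norm_sub_rev (s₀ (d k))] at this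
  linarith

end CXSystem

/-! ### Positivity and Gram matrices in C⋆-algebras. -/

section FaithfulFamily

variable {A : Type*} [CStarAlgebra A] [PartialOrder A] [StarOrderedRing A]

/-- Positivity can be tested on a jointly injective family of ⋆-homomorphisms. -/
theorem CStarAlgebra.nonneg_of_forall_map_nonneg {α : Type*} {B : α → Type*}
    [∀ y, NonUnitalCStarAlgebra (B y)] [∀ y, PartialOrder (B y)] [∀ y, StarOrderedRing (B y)]
    (π : ∀ y, A →⋆ₙₐ[ℂ] B y) (hπ : ∀ a, (∀ y, π y a = 0) → a = 0) {a : A}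
    (ha : ∀ y, 0 ≤ π y a) : 0 ≤ a := by
  have hsa : IsSelfAdjoint a := by
    rw [IsSelfAdjoint, ← sub_eq_zero]
    refine hπ _ fun y => ?_
    rw [map_sub, map_star, (IsSelfAdjoint.of_nonneg (ha y)).star_eq, sub_self]
  have hneg : 0 ≤ a⁻ := CFC.negPart_nonneg a
  have hstar : star a⁻ = a⁻ := (IsSelfAdjoint.of_nonneg hneg).star_eq
  have hmul : a⁻ * a * a⁻ = -(a⁻ * a⁻ * a⁻) := by
    nth_rewrite 2 [← CFC.posPart_sub_negPart a hsa]
    rw [mul_sub, CFC.negPart_mul_posPart, zero_sub, neg_mul]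
  -- In each image this cube is positive, while its negative is the conjugate of `π y a` by a
  -- self-adjoint element.
  have hcube : a⁻ * a⁻ * a⁻ = 0 := by
    refine hπ _ fun y => ?_
    have hy : star (π y a⁻) = π y a⁻ := by rw [← map_star, hstar]
    have hpos : 0 ≤ π y a⁻ := by
      obtain ⟨b, hb⟩ := CStarAlgebra.nonneg_iff_eq_star_mul_self.1 hneg
      rw [hb, map_mul, map_star]
      exact star_mul_self_nonneg _
    refine le_antisymm ?_ ?_
    · have h := star_left_conjugate_nonneg (ha y) (π y a⁻)
      rw [hy, ← map_mul, ← map_mul, hmul, map_neg] at h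
      exact neg_nonneg.1 h
    · have h := star_left_conjugate_nonneg hpos (π y a⁻)
      rwa [hy, ← map_mul, ← map_mul] at h
  have hzero : a⁻ = 0 := by
    have h4 : (a⁻ * a⁻) * (a⁻ * a⁻) = 0 := by rw [← mul_assoc, hcube, zero_mul]
    have h2 : a⁻ * a⁻ = 0 := by
      rw [← CStarRing.star_mul_self_eq_zero_iff, star_mul, hstar, h4]
    rw [← CStarRing.star_mul_self_eq_zero_iff, hstar, h2]
  rw [← CFC.posPart_sub_negPart a hsa, hzero, sub_zero]
  exact CFC.posPart_nonneg a

theorem CStarAlgebra.exists_eq_star_mul_self {a : A} (ha : 0 ≤ a) : ∃ b, a = star b * b :=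
  CStarAlgebra.nonneg_iff_eq_star_mul_self.1 ha

end FaithfulFamily

namespace CStarMatrix

variable {A : Type*} [CStarAlgebra A] [PartialOrder A] [StarOrderedRing A]
  {m n : Type*} [Fintype m] [DecidableEq m] [Fintype n] [DecidableEq n]

theorem finset_sum_apply {α : Type*} (s : Finset α) (M : α → CStarMatrix m m A) (i j : m) :
    (∑ r ∈ s, M r) i j = ∑ r ∈ s, M r i j := by
  induction s using Finset.cons_induction with
  | empty => simp
  | cons a s ha ih => simp [Finset.sum_cons, ih]

/-- Gram matrices are positive. -/
theorem nonneg_of_gram {M : CStarMatrix m m A} (C : n → m → A)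
    (h : ∀ i j, M i j = ∑ r, star (C r i) * C r j) : 0 ≤ M := by
  rcases isEmpty_or_nonempty m with hm | ⟨⟨i₀⟩⟩
  · have : M = 0 := by ext i; exact isEmptyElim i
    exact this.ge
  -- Square matrices that carry `C r` in row `i₀` and zeros elsewhere.
  let R : n → CStarMatrix m m A := fun r =>
    ofMatrix <| Matrix.of fun i j => if i = i₀ then C r j else 0
  have hM : M = ∑ r, star (R r) * R r := by
    ext i j
    rw [h, finset_sum_apply]
    refine Finset.sum_congr rfl fun r _ => ?_
    have hR : ∀ p q, R r p q = if p = i₀ then C r q else 0 := fun p q => rfl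
    simp only [mul_apply, star_apply, hR]
    rw [Finset.sum_eq_single i₀ (fun p _ hp => by simp [hp]) (by simp)]
    simp
  rw [hM]
  exact Finset.sum_nonneg fun r _ => star_mul_self_nonneg _

/-- Positive matrices are Gram matrices. -/
theorem exists_gram {M : CStarMatrix m m A} (hM : 0 ≤ M) :
    ∃ C : m → m → A, ∀ i j, M i j = ∑ r, star (C r i) * C r j := by
  obtain ⟨C, hC⟩ := CStarAlgebra.exists_eq_star_mul_self hM
  exact ⟨C, fun i j => by rw [hC, mul_apply]; simp only [star_apply]⟩

/-- `c • M` is the Gram matrix of the upper triangular block matrix with rows `(c, v)` and `(0, r)`,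
where `star r * r = c² - star v * v`. -/
theorem block_nonneg {v : CStarMatrix m m A} {c : ℝ} (hc : 0 < c) (hv : ‖v‖ ≤ c)
    {M : CStarMatrix (m ⊕ m) (m ⊕ m) A}
    (h11 : ∀ i j, M (.inl i) (.inl j) = c • (1 : CStarMatrix m m A) i j)
    (h12 : ∀ i j, M (.inl i) (.inr j) = v i j)
    (h21 : ∀ i j, M (.inr i) (.inl j) = star (v j i))
    (h22 : ∀ i j, M (.inr i) (.inr j) = c • (1 : CStarMatrix m m A) i j) : 0 ≤ M := by
  have h := CStarAlgebra.star_mul_self_le_smul_one hv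
  obtain ⟨r, hr⟩ := exists_gram (sub_nonneg.2 h)
  have hcM : 0 ≤ c • M := by
    refine nonneg_of_gram (n := m ⊕ m) (fun p q => match p, q with
      | .inl l, .inl j => c • (1 : CStarMatrix m m A) l j
      | .inl l, .inr j => v l j
      | .inr l, .inl j => 0
      | .inr l, .inr j => r l j) ?_
    rintro (i | i) (j | j)
    · simp only [smul_apply, h11, Fintype.sum_sum_type, one_apply, star_zero, zero_mul,
        Finset.sum_const_zero, add_zero]
      rw [Finset.sum_eq_single i (fun p _ hp => by simp [hp]) (by simp)]
      simp
    · simp only [smul_apply, h12, Fintype.sum_sum_type, one_apply, star_zero, zero_mul,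
        Finset.sum_const_zero, add_zero]
      rw [Finset.sum_eq_single i (fun p _ hp => by simp [hp]) (by simp)]
      simp
    · simp only [smul_apply, h21, Fintype.sum_sum_type, one_apply, mul_zero,
        Finset.sum_const_zero, add_zero]
      rw [Finset.sum_eq_single j (fun p _ hp => by simp [hp]) (by simp)]
      simp
    · have := hr i j
      change c ^ 2 • (1 : CStarMatrix m m A) i j - (star v * v) i j = _ at this
      rw [mul_apply] at this
      simp only [star_apply] at this
      simp only [smul_apply, h22, Fintype.sum_sum_type, ← this, smul_smul, sq]
      abel
  have := smul_nonneg (inv_nonneg.2 hc.le) hcM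
  rwa [smul_smul, inv_mul_cancel₀ hc.ne', one_smul] at this

/-- The Schur complement in a block matrix that is a Gram matrix is, up to the factor `c`, itself a
Gram matrix. -/
theorem _root_.Matrix.conjTranspose_mul_self_of_blocks {l : Type*} [Fintype l] (C₁ C₂ : Matrix l m A)
    (v : Matrix m m A) (c : ℝ) (e11 : C₁.conjTranspose * C₁ = c • (1 : Matrix m m A))
    (e12 : C₁.conjTranspose * C₂ = v) (e21 : C₂.conjTranspose * C₁ = v.conjTranspose)
    (e22 : C₂.conjTranspose * C₂ = c • (1 : Matrix m m A)) :
    (C₁ * v - c • C₂).conjTranspose * (C₁ * v - c • C₂)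
      = c • (c ^ 2 • (1 : Matrix m m A) - v.conjTranspose * v) := by
  have h1 : v.conjTranspose * C₁.conjTranspose * (C₁ * v) = c • (v.conjTranspose * v) := by
    rw [Matrix.mul_assoc, ← Matrix.mul_assoc C₁.conjTranspose, e11, Matrix.smul_mul,
      Matrix.one_mul, Matrix.mul_smul]
  have h2 : v.conjTranspose * C₁.conjTranspose * C₂ = v.conjTranspose * v := by
    rw [Matrix.mul_assoc, e12]
  have h3 : C₂.conjTranspose * (C₁ * v) = v.conjTranspose * v := by
    rw [← Matrix.mul_assoc, e21]
  rw [Matrix.conjTranspose_sub, Matrix.conjTranspose_mul, Matrix.conjTranspose_smul, star_trivial,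
    Matrix.sub_mul, Matrix.mul_sub, Matrix.mul_sub, h1, Matrix.mul_smul, h2, Matrix.smul_mul, h3,
    Matrix.smul_mul, Matrix.mul_smul, e22, smul_sub, smul_smul, smul_smul]
  rw [smul_smul, show c * c * c = c * c ^ 2 by ring]
  abel

theorem norm_le_of_block_nonneg {v : CStarMatrix m m A} {c : ℝ} (hc : 0 < c)
    {M : CStarMatrix (m ⊕ m) (m ⊕ m) A} (hM : 0 ≤ M)
    (h11 : ∀ i j, M (.inl i) (.inl j) = c • (1 : CStarMatrix m m A) i j)
    (h12 : ∀ i j, M (.inl i) (.inr j) = v i j)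
    (h21 : ∀ i j, M (.inr i) (.inl j) = star (v j i))
    (h22 : ∀ i j, M (.inr i) (.inr j) = c • (1 : CStarMatrix m m A) i j) : ‖v‖ ≤ c := by
  obtain ⟨C, hC⟩ := exists_gram hM
  let C₁ : CStarMatrix (m ⊕ m) m A := ofMatrix <| Matrix.of fun r i => C r (.inl i)
  let C₂ : CStarMatrix (m ⊕ m) m A := ofMatrix <| Matrix.of fun r i => C r (.inr i)
  have e11 : C₁.conjTranspose * C₁ = c • (1 : CStarMatrix m m A) := by
    ext i j; rw [smul_apply, ← h11, hC]; rfl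
  have e12 : C₁.conjTranspose * C₂ = v := by
    ext i j; rw [← h12, hC]; rfl
  have e21 : C₂.conjTranspose * C₁ = star v := by
    ext i j; rw [star_apply, ← h21, hC]; rfl
  have e22 : C₂.conjTranspose * C₂ = c • (1 : CStarMatrix m m A) := by
    ext i j; rw [smul_apply, ← h22, hC]; rfl
  have hpos : 0 ≤ c • (c ^ 2 • (1 : CStarMatrix m m A) - star v * v) := by
    let G : CStarMatrix (m ⊕ m) m A := C₁ * v - c • C₂
    have hG : c • (c ^ 2 • (1 : CStarMatrix m m A) - star v * v) = G.conjTranspose * G :=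
      (Matrix.conjTranspose_mul_self_of_blocks C₁ C₂ v c e11 e12 e21 e22).symm
    exact nonneg_of_gram (fun r i => G r i) fun i j => by rw [hG]; rfl
  have h1 := smul_nonneg (inv_nonneg.2 hc.le) hpos
  rw [smul_smul, inv_mul_cancel₀ hc.ne', one_smul, sub_nonneg] at h1
  have := CStarAlgebra.norm_sq_le_of_star_mul_self_le (sq_nonneg c) h1
  exact le_of_sq_le_sq this hc.le

end CStarMatrix

/-! ### Matrices over `W` and their fibre norms. -/

namespace OperatorSystem

variable {X : Type u} [TopologicalSpace X] [CompactSpace X] [T2Space X]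
    {A : Type v} [CStarAlgebra A] [PartialOrder A] [StarOrderedRing A]
    (W : OperatorSystem A)
    [Module C(X, ℂ) W] [IsScalarTower ℂ C(X, ℂ) W]
    {m n : Type*} [Fintype m] [DecidableEq m] [Fintype n] [DecidableEq n]

/-- The inclusion of the matrices over `W` into the matrices over `A`. -/
noncomputable def matIncl (m : Type*) : Matrix m m W →ₗ[ℂ] CStarMatrix m m A where
  toFun w := CStarMatrix.ofMatrix (w.map fun a => (a : A))
  map_add' _ _ := rfl
  map_smul' _ _ := rfl

theorem matIncl_apply (w : Matrix m m W) (i j : m) : W.matIncl m w i j = (w i j : A) := rfl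

/-- The hypotheses concern the index types `Fin n`, whereas blocks are indexed by sums. Reindexing
is an injective ⋆-homomorphism, hence isometric. -/
theorem norm_matIncl_submatrix (e : m ≃ n) (w : Matrix n n W) :
    ‖W.matIncl m (w.submatrix e e)‖ = ‖W.matIncl n w‖ := by
  have h := NonUnitalStarAlgHom.norm_map
    (CStarMatrix.reindexₐ ℂ A e : CStarMatrix m m A ≃⋆ₐ[ℂ] CStarMatrix n n A)
    (EquivLike.injective _) (W.matIncl m (w.submatrix e e))
  rw [← h]
  congr 1
  ext i j
  rw [CStarMatrix.reindexₐ_apply]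
  change ((w.submatrix e e (e.symm i) (e.symm j) : W) : A) = w i j
  simp

variable {W}

theorem IsCXModule.norm_matIncl_smul_le (hW : W.IsCXModule (X := X)) (f : C(X, ℂ))
    (w : Matrix m m W) : ‖W.matIncl m (f • w)‖ ≤ ‖f‖ * ‖W.matIncl m w‖ := by
  have h := hW.matNorm_smul_le (Fintype.card m) f
    (w.submatrix (Fintype.equivFin m).symm (Fintype.equivFin m).symm)
  have h1 := W.norm_matIncl_submatrix (Fintype.equivFin m).symm w
  have h2 := W.norm_matIncl_submatrix (Fintype.equivFin m).symm (f • w)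
  rw [← h1, ← h2]
  exact h

/-- The matrices over an operator system with an action of `C(X)`. -/
noncomputable def IsCXModule.matSystem (hW : W.IsCXModule (X := X)) (m : Type*) [Fintype m]
    [DecidableEq m] : CXSystem X (Matrix m m W) (CStarMatrix m m A) where
  ι := W.matIncl m
  e := Matrix.of fun i j => if i = j then W.unit else 0
  adj w := Matrix.of fun i j => W.adj (w j i)
  ι_e := by
    ext i j
    rw [matIncl_apply, Matrix.of_apply, CStarMatrix.one_apply]
    split_ifs <;> rfl
  ι_smul_adj f w := by
    ext i j
    rw [CStarMatrix.star_apply, matIncl_apply, matIncl_apply, Matrix.smul_apply, Matrix.smul_apply,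
      Matrix.of_apply]
    have := hW.adj_smul (star f) (w j i)
    rw [star_star] at this
    rw [← this]
    rfl
  norm_smul_le f w := hW.norm_matIncl_smul_le f w

variable (hW : W.IsCXModule (X := X))

theorem IsCXModule.matSystem_e (i j : m) :
    (hW.matSystem m).e i j = if i = j then W.unit else 0 := rfl

theorem IsCXModule.N_submatrix (e : m ≃ n) (x : X) (w : Matrix n n W) :
    (hW.matSystem m).N x (w.submatrix e e) = (hW.matSystem n).N x w := by
  refine le_antisymm ((hW.matSystem n).le_N fun h hh => ?_)
    ((hW.matSystem m).le_N fun h hh => ?_)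
  · refine ((hW.matSystem m).N_le hh _).trans ?_
    exact (W.norm_matIncl_submatrix e (ofRealC h • w)).le
  · refine ((hW.matSystem n).N_le hh _).trans ?_
    exact (W.norm_matIncl_submatrix e (ofRealC h • w)).ge

theorem continuous_matIncl : Continuous (W.matIncl m) := by
  refine continuous_matrix fun i j => ?_
  exact continuous_subtype_val.comp (continuous_id.matrix_elem i j)

theorem smul_mem_fibreKer {x : X} {f : C(X, ℂ)} (hf : f x = 0) (w : W) :
    f • w ∈ W.fibreKer x :=
  Submodule.le_topologicalClosure _ (Submodule.subset_span ⟨f, w, hf, rfl⟩)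

theorem IsCXModule.N_single_eq_zero {x : X} {v : W} (hv : v ∈ W.fibreKer x) (i j : m) :
    (hW.matSystem m).N x (Matrix.single i j v) = 0 := by
  let D := hW.matSystem m
  -- A closed subspace that contains the products `f • w` with `f x = 0`, hence all of `W.fibreKer
  -- x`.
  let K : Submodule ℂ W :=
    { carrier := {v | D.N x (Matrix.single i j v) = 0}
      add_mem' := fun {v v'} h h' => by
        refine le_antisymm ?_ (D.N_nonneg _ _)
        rw [Matrix.single_add]
        refine (D.N_add_le x _ _).trans ?_
        rw [h, h', add_zero]
      zero_mem' := by
        change D.N x (Matrix.single i j 0) = 0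
        rw [Matrix.single_zero]
        simpa using D.N_complex_smul x 0 0
      smul_mem' := fun c v h => by
        change D.N x (Matrix.single i j (c • v)) = 0
        rw [← Matrix.smul_single, D.N_complex_smul, h, mul_zero] }
  have hcl : IsClosed (K : Set W) := by
    rw [← isSeqClosed_iff_isClosed]
    intro a b ha hab
    change D.N x (Matrix.single i j b) = 0
    refine le_antisymm ?_ (D.N_nonneg _ _)
    have hlim : Tendsto (fun k => ‖D.ι (Matrix.single i j (b - a k))‖) atTop (𝓝 0) := by
      have hc : Continuous fun v : W => ‖D.ι (Matrix.single i j v)‖ :=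
        by
        refine continuous_norm.comp (continuous_matIncl.comp (continuous_matrix fun p q => ?_))
        simp only [Matrix.single_apply]
        split_ifs <;> fun_prop
      have := (hc.tendsto (b - b)).comp (hab.const_sub b)
      rw [sub_self, Matrix.single_zero, map_zero, norm_zero] at this
      exact this
    refine ge_of_tendsto' hlim fun k => ?_
    have h1 := D.N_le_add_sub x (Matrix.single i j b) (Matrix.single i j (a k))
    rw [show D.N x (Matrix.single i j (a k)) = 0 from ha k, zero_add] at h1
    have h2 : Matrix.single i j b - Matrix.single i j (a k) = Matrix.single i j (b - a k) :=
      ((Matrix.singleLinearMap ℂ i j).map_sub b (a k)).symm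
    rw [h2] at h1
    exact h1.trans (D.N_le_norm _ _)
  have hle : W.fibreKer x ≤ K := by
    refine Submodule.topologicalClosure_minimal _ (Submodule.span_le.2 ?_) hcl
    rintro _ ⟨f, w, hf, rfl⟩
    change D.N x (Matrix.single i j (f • w)) = 0
    rw [← Matrix.smul_single]
    exact D.N_eq_zero_of_apply_eq_zero hf _
  exact hle hv

theorem IsCXModule.N_sum_le {α : Type*} (x : X) (s : Finset α) (w : α → Matrix m m W) :
    (hW.matSystem m).N x (∑ a ∈ s, w a) ≤ ∑ a ∈ s, (hW.matSystem m).N x (w a) := by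
  induction s using Finset.cons_induction with
  | empty => simpa using (hW.matSystem m).N_le_norm x 0
  | cons a s ha ih =>
    rw [Finset.sum_cons, Finset.sum_cons]
    exact ((hW.matSystem m).N_add_le x _ _).trans (by linarith)

theorem IsCXModule.N_eq_zero_of_mem_fibreKer {x : X} {w : Matrix m m W}
    (hw : ∀ i j, w i j ∈ W.fibreKer x) : (hW.matSystem m).N x w = 0 := by
  refine le_antisymm ?_ ((hW.matSystem m).N_nonneg _ _)
  rw [Matrix.matrix_eq_sum_single w]
  refine (hW.N_sum_le x _ _).trans (Finset.sum_nonpos fun i _ => ?_)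
  refine (hW.N_sum_le x _ _).trans (Finset.sum_nonpos fun j _ => ?_)
  rw [hW.N_single_eq_zero (hw i j)]

theorem IsCXModule.map_toFibre_smul {x : X} {h : C(X, ℝ)} (hh : h ∈ bumps x)
    (w : Matrix m m W) : (ofRealC h • w).map (W.toFibre x) = w.map (W.toFibre x) := by
  ext i j
  rw [Matrix.map_apply, Matrix.map_apply, Matrix.smul_apply, ← sub_eq_zero, ← map_sub, toFibre,
    Submodule.mkQ_apply, Submodule.Quotient.mk_eq_zero]
  have : ofRealC h • w i j - w i j = (ofRealC h - 1) • w i j := by rw [sub_smul, one_smul]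
  rw [this]
  refine smul_mem_fibreKer ?_ _
  simp [hh.2.2]

/-- The fibre norm is computed by localizing at the point. -/
theorem IsCXModule.fibreNorm_eq_N (x : X) {k : ℕ} (w : Matrix (Fin k) (Fin k) W) :
    W.fibreNorm x (w.map (W.toFibre x)) = (hW.matSystem (Fin k)).N x w := by
  let D := hW.matSystem (Fin k)
  refine le_antisymm (D.le_N fun h hh => ?_) ?_
  · refine csInf_le ⟨0, ?_⟩ ⟨_, IsCXModule.map_toFibre_smul hh w, rfl⟩
    rintro r ⟨w', -, rfl⟩
    exact norm_nonneg _
  · refine le_csInf ⟨_, w, rfl, rfl⟩ ?_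
    rintro r ⟨w', hw', rfl⟩
    have h0 : D.N x (w - w') = 0 := by
      refine hW.N_eq_zero_of_mem_fibreKer fun i j => ?_
      have h1 := congrFun (congrFun hw' i) j
      rw [Matrix.map_apply, Matrix.map_apply] at h1
      rw [Matrix.sub_apply, ← Submodule.Quotient.mk_eq_zero, ← Submodule.mkQ_apply]
      change W.toFibre x (w i j - w' i j) = 0
      rw [map_sub, h1, sub_self]
    have h1 := D.N_le_add_sub x w w'
    rw [h0, add_zero] at h1
    exact h1.trans (D.N_le_norm x w')

theorem IsCXModule.continuous_N (hcont : ∀ (n : ℕ) (w : Matrix (Fin n) (Fin n) W),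
      Continuous fun x : X => W.fibreNorm x (w.map (W.toFibre x))) (w : Matrix m m W) :
    Continuous fun x => (hW.matSystem m).N x w := by
  have h := hcont (Fintype.card m) (w.submatrix (Fintype.equivFin m).symm (Fintype.equivFin m).symm)
  simp only [hW.fibreNorm_eq_N, hW.N_submatrix] at h
  exact h

theorem IsCXModule.exists_dense_seq [TopologicalSpace.SeparableSpace W] :
    ∃ d : ℕ → Matrix m m W, ∀ w, ∀ ε : ℝ, 0 < ε → ∃ k, ‖(hW.matSystem m).ι (w - d k)‖ < ε := by
  have : TopologicalSpace.SeparableSpace (Matrix m m W) :=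
    inferInstanceAs (TopologicalSpace.SeparableSpace (m → m → W))
  refine ⟨TopologicalSpace.denseSeq _, fun w ε hε => ?_⟩
  have hc : Continuous fun v : Matrix m m W => ‖(hW.matSystem m).ι (w - v)‖ :=
    continuous_norm.comp (continuous_matIncl.comp (continuous_const.sub continuous_id))
  obtain ⟨v, hv, k, rfl⟩ := (TopologicalSpace.denseRange_denseSeq (Matrix m m W)).inter_open_nonempty
    {v | ‖(hW.matSystem m).ι (w - v)‖ < ε} (isOpen_lt hc continuous_const)
    ⟨w, by simpa using hε⟩
  exact ⟨k, hv⟩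

end OperatorSystem

/-! ### Quadratic forms and positivity of complex matrices. -/

section ComplexMatrix

open Matrix

variable {m n : Type*} [Fintype m] [DecidableEq m] [Fintype n] [DecidableEq n]

open scoped MatrixOrder in
theorem Matrix.PosSemidef.exists_eq_conjTranspose_mul_self {F : Matrix m m ℂ}
    (hF : F.PosSemidef) : ∃ G : Matrix m m ℂ, F = Gᴴ * G :=
  CStarAlgebra.nonneg_iff_eq_star_mul_self.1 (Matrix.nonneg_iff_posSemidef.2 hF)

theorem Matrix.posSemidef_of_forall_dotProduct_nonneg {F : Matrix m m ℂ}
    (hF : ∀ ξ : m → ℂ, 0 ≤ star ξ ⬝ᵥ (F *ᵥ ξ)) : F.PosSemidef := by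
  rw [← Matrix.isPositive_toEuclideanLin_iff, LinearMap.isPositive_iff_complex]
  intro ξ
  have h : inner ℂ (F.toEuclideanLin ξ) ξ = star (star (ξ.ofLp) ⬝ᵥ (F *ᵥ ξ.ofLp)) := by
    rw [EuclideanSpace.inner_eq_star_dotProduct, ← star_dotProduct_star, star_star, dotProduct_comm]
    rfl
  have h0 := hF ξ.ofLp
  rw [h, (IsSelfAdjoint.of_nonneg h0).star_eq]
  rw [Complex.nonneg_iff] at h0
  exact ⟨Complex.ext rfl h0.2, h0.1⟩

theorem Matrix.norm_star_dotProduct_mulVec_le (F : Matrix m m ℂ) (ξ : m → ℂ) :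
    ‖star ξ ⬝ᵥ (F *ᵥ ξ)‖ ≤ (∑ i, ∑ j, ‖F i j‖) * ∑ i, ‖ξ i‖ ^ 2 := by
  have hle : ∀ i, ‖ξ i‖ ^ 2 ≤ ∑ i, ‖ξ i‖ ^ 2 := fun i =>
    Finset.single_le_sum (f := fun i => ‖ξ i‖ ^ 2) (fun _ _ => sq_nonneg _) (Finset.mem_univ i)
  rw [Finset.sum_mul, dotProduct]
  refine norm_sum_le_of_le _ fun i _ => ?_
  rw [Finset.sum_mul, mulVec, dotProduct, Finset.mul_sum]
  refine norm_sum_le_of_le _ fun j _ => ?_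
  rw [norm_mul, norm_mul, Pi.star_apply, norm_star]
  have h1 := hle i
  have h2 := hle j
  calc ‖ξ i‖ * (‖F i j‖ * ‖ξ j‖) = ‖F i j‖ * (‖ξ i‖ * ‖ξ j‖) := by ring
    _ ≤ ‖F i j‖ * ∑ i, ‖ξ i‖ ^ 2 := by
      refine mul_le_mul_of_nonneg_left ?_ (norm_nonneg _)
      nlinarith [sq_nonneg (‖ξ i‖ - ‖ξ j‖)]

theorem Matrix.star_dotProduct_self (ξ : m → ℂ) : star ξ ⬝ᵥ ξ = ((∑ i, ‖ξ i‖ ^ 2 : ℝ) : ℂ) := by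
  rw [dotProduct, Complex.ofReal_sum]
  refine Finset.sum_congr rfl fun i _ => ?_
  rw [Pi.star_apply, Complex.star_def, Complex.conj_mul']
  push_cast
  rfl

theorem Matrix.star_dotProduct_conjTranspose_mul_mul_mulVec (b : Matrix n m ℂ) (q : Matrix n n ℂ)
    (ξ η : m → ℂ) : star ξ ⬝ᵥ ((bᴴ * q * b) *ᵥ η) = star (b *ᵥ ξ) ⬝ᵥ (q *ᵥ (b *ᵥ η)) := by
  rw [Matrix.mul_assoc, ← Matrix.mulVec_mulVec, Matrix.dotProduct_mulVec, ← Matrix.star_mulVec,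
    ← Matrix.mulVec_mulVec]

end ComplexMatrix

section TwoLevel

open Matrix

variable {X : Type*} [TopologicalSpace X] [CompactSpace X]
  {k n : Type*} [Fintype k] [DecidableEq k] [Fintype n] [DecidableEq n]

/-- Merging the two levels of indices gives a positive semidefinite complex matrix; its
factorisation, read in blocks, is a Gram factorisation. -/
theorem CStarMatrix.nonneg_of_form_nonneg {M : CStarMatrix k k (CStarMatrix n n ℂ)}
    (h : ∀ ξ : k → n → ℂ, 0 ≤ ∑ a, ∑ b, star (ξ a) ⬝ᵥ ((ofMatrix.symm (M a b)) *ᵥ ξ b)) :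
    0 ≤ M := by
  let Q : Matrix (k × n) (k × n) ℂ := Matrix.of fun p q => M p.1 q.1 p.2 q.2
  have hQ : Q.PosSemidef := by
    refine Matrix.posSemidef_of_forall_dotProduct_nonneg fun ξ => ?_
    refine (h fun a i => ξ (a, i)).trans_eq ?_
    simp only [dotProduct, mulVec, Fintype.sum_prod_type, Finset.mul_sum]
    refine Finset.sum_congr rfl fun a _ => ?_
    rw [Finset.sum_comm]
    rfl
  obtain ⟨G, hG⟩ := hQ.exists_eq_conjTranspose_mul_self
  refine nonneg_of_gram (n := k)
    (fun c a => (ofMatrix (Matrix.of fun l i => G (c, l) (a, i)) : CStarMatrix n n ℂ)) ?_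
  intro a b
  ext i j
  rw [finset_sum_apply]
  have := congrFun (congrFun hG (a, i)) (b, j)
  rw [Matrix.mul_apply, Fintype.sum_prod_type] at this
  exact this

theorem CStarMatrix.form_nonneg {M : CStarMatrix k k (CStarMatrix n n ℂ)} (hM : 0 ≤ M)
    (ξ : k → n → ℂ) : 0 ≤ ∑ a, ∑ b, star (ξ a) ⬝ᵥ ((ofMatrix.symm (M a b)) *ᵥ ξ b) := by
  obtain ⟨C, hC⟩ := exists_gram hM
  have key : ∀ a b, star (ξ a) ⬝ᵥ ((ofMatrix.symm (M a b)) *ᵥ ξ b)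
      = ∑ c, star (ofMatrix.symm (C c a) *ᵥ ξ a) ⬝ᵥ (ofMatrix.symm (C c b) *ᵥ ξ b) := by
    intro a b
    have : ofMatrix.symm (M a b) = ∑ c, (ofMatrix.symm (C c a))ᴴ * ofMatrix.symm (C c b) := hC a b
    rw [this, Matrix.sum_mulVec, dotProduct_sum]
    refine Finset.sum_congr rfl fun c _ => ?_
    rw [← Matrix.mulVec_mulVec, Matrix.dotProduct_mulVec, ← Matrix.star_mulVec]
  have : ∑ a, ∑ b, star (ξ a) ⬝ᵥ ((ofMatrix.symm (M a b)) *ᵥ ξ b)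
      = ∑ c, star (∑ a, ofMatrix.symm (C c a) *ᵥ ξ a) ⬝ᵥ
          (∑ b, ofMatrix.symm (C c b) *ᵥ ξ b) := by
    simp only [key]
    rw [Finset.sum_congr rfl fun a _ => Finset.sum_comm, Finset.sum_comm]
    refine Finset.sum_congr rfl fun c _ => ?_
    rw [star_sum, sum_dotProduct]
    exact Finset.sum_congr rfl fun a _ => (dotProduct_sum _ _ _).symm
  rw [this]
  exact Finset.sum_nonneg fun c _ => dotProduct_star_self_nonneg _

/-- Positivity of matrices over `M_n(C(X))` is tested pointwise by quadratic forms. -/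
theorem CStarMatrix.nonneg_of_pointwise_form_nonneg
    {M : CStarMatrix k k (CStarMatrix n n C(X, ℂ))}
    (h : ∀ y, ∀ ξ : k → n → ℂ,
      0 ≤ ∑ a, ∑ b, star (ξ a) ⬝ᵥ ((Matrix.of fun i j => M a b i j y) *ᵥ ξ b)) :
    0 ≤ M := by
  let ev : X → (C(X, ℂ) →⋆ₙₐ[ℂ] ℂ) := fun y =>
    { toFun := fun f => f y
      map_smul' := fun _ _ => rfl
      map_zero' := rfl
      map_add' := fun _ _ => rfl
      map_mul' := fun _ _ => rfl
      map_star' := fun _ => rfl }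
  refine CStarAlgebra.nonneg_of_forall_map_nonneg (B := fun _ => CStarMatrix k k (CStarMatrix n n ℂ))
    (fun y => mapₙₐ (mapₙₐ (ev y))) ?_ ?_
  · intro a ha
    ext p q i j y
    have := ha y
    exact congrFun (congrFun (congrFun (congrFun this p) q) i) j
  · intro y
    exact nonneg_of_form_nonneg (h y)

end TwoLevel

/-! ### Adjoints of fibre states, and vanishing fibres. -/

namespace CXSystem

variable {X V B : Type*} [TopologicalSpace X] [CompactSpace X] [AddCommGroup V]
    [Module ℂ V] [Module C(X, ℂ) V] [IsScalarTower ℂ C(X, ℂ) V] [CStarAlgebra B]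
    {D : CXSystem X V B} [PartialOrder B] [StarOrderedRing B] [T2Space X] {y : X}

theorem IsFibreState.map_adj {s : V →ₗ[ℂ] ℂ} (hs : D.IsFibreState y s) (w : V) :
    s (D.adj w) = star (s w) := by
  have h := hs.map_re w
  rw [re, LinearMap.map_smul, map_add, smul_eq_mul] at h
  have h2 : s (D.adj w) = 2 * ((s w).re : ℂ) - s w := by
    rw [← h]; ring
  rw [h2, Complex.star_def]
  apply Complex.ext <;> simp; ring

/-- If a fibre vanishes, so does a neighbourhood of the point under `θ`. -/
theorem exists_θ_eq_zero_of_N_e (hy : D.N y D.e = 0) :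
    ∃ g : C(X, ℝ), g y = 1 ∧ D.θ (ofRealC g) = 0 := by
  obtain ⟨h, hh, hlt⟩ := D.exists_bump_norm_lt y D.e (show (0 : ℝ) < 1 / 4 by norm_num)
  rw [hy, zero_add] at hlt
  -- The cutoffs are such that `f = 1` where `g` does not vanish and `f ≤ 2 h`, so that `θ f` has
  -- norm at most `1 / 2`.
  let g : C(X, ℝ) := clamp ((4 : ℝ) • h - .const X 3)
  let f : C(X, ℝ) := clamp ((4 : ℝ) • h - .const X 2)
  have hgy : g y = 1 := clamp_eq_one (by
    have := hh.2.2
    simp [this]; norm_num)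
  have hfg : ofRealC f * ofRealC g = ofRealC g := by
    rw [← map_mul]
    congr 1
    ext x
    rcases le_total (h x) (3 / 4) with hx | hx
    · have : g x = 0 := clamp_eq_zero (by simp; linarith)
      simp [this]
    · have : f x = 1 := clamp_eq_one (by simp; linarith)
      simp [this]
  have hf2 : ∀ x, f x ≤ 2 * h x := by
    intro x
    rcases le_total (h x) (1 / 2) with hx | hx
    · have : f x = 0 := clamp_eq_zero (by simp; linarith)
      rw [this]; have := hh.1 x; linarith
    · have := clamp_le_one ((4 : ℝ) • h - .const X 2) x
      change clamp _ x ≤ _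
      linarith
  have hf : ‖D.θ (ofRealC f)‖ ≤ 1 / 2 := by
    refine CStarAlgebra.norm_le_of_nonneg_of_le_smul_one (by norm_num)
      (D.θ_nonneg (clamp_nonneg _)) ?_
    have h1 : D.θ (ofRealC f) ≤ D.θ (ofRealC ((2 : ℝ) • h)) :=
      D.θ_mono fun x => by simpa using hf2 x
    refine h1.trans ((D.isSelfAdjoint_θ _).le_smul_one_of_norm_le ?_)
    rw [ofRealC_smul, D.θ_smul, norm_smul]
    have : ‖D.θ (ofRealC h)‖ < 1 / 4 := hlt
    simp; linarith
  refine ⟨g, hgy, ?_⟩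
  -- Scaled to norm one, `g • e` is a positive contraction fixed by `f`. It therefore lies below `θ
  -- f`, whose norm is at most `1 / 2`.
  by_contra hne
  have hpos : 0 < ‖D.θ (ofRealC g)‖ := norm_pos_iff.2 hne
  set β := ‖D.θ (ofRealC g)‖ with hβ
  have hι : D.ι (((β⁻¹ : ℝ) : ℂ) • (ofRealC g • D.e)) = ((β⁻¹ : ℝ) : ℂ) • D.θ (ofRealC g) :=
    D.ι_complex_smul _ _
  have hsm : (((β⁻¹ : ℝ) : ℂ) • (ofRealC g • D.e)) = ofRealC (β⁻¹ • g) • D.e := by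
    rw [ofRealC_smul, smul_assoc]
  have hnorm : ‖D.ι (((β⁻¹ : ℝ) : ℂ) • (ofRealC g • D.e))‖ = 1 := by
    rw [hι, norm_smul, Complex.norm_real, Real.norm_of_nonneg (inv_nonneg.2 hpos.le), ← hβ,
      inv_mul_cancel₀ hpos.ne']
  have hsa : IsSelfAdjoint (D.ι (((β⁻¹ : ℝ) : ℂ) • (ofRealC g • D.e))) := by
    rw [hsm]; exact D.isSelfAdjoint_θ _
  have hle := D.ι_smul_le_θ_of_le_one (f := f) (clamp_nonneg _) (clamp_le_one _) hsa hnorm.le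
  have hfw : ofRealC f • (((β⁻¹ : ℝ) : ℂ) • (ofRealC g • D.e))
      = ((β⁻¹ : ℝ) : ℂ) • (ofRealC g • D.e) := by
    rw [hsm, smul_smul, ofRealC_smul, mul_smul_comm, hfg]
  rw [hfw] at hle
  have hnn : 0 ≤ D.ι (((β⁻¹ : ℝ) : ℂ) • (ofRealC g • D.e)) := by
    rw [hsm]
    exact D.θ_nonneg fun x => mul_nonneg (inv_nonneg.2 hpos.le) (clamp_nonneg _ x)
  have := CStarAlgebra.norm_le_norm_of_nonneg_of_le hnn hle
  linarith

end CXSystem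

/-! ### Completely positive maps from positive functionals. -/

namespace OperatorSystem

open Matrix

variable {X : Type u} [TopologicalSpace X] [CompactSpace X] [T2Space X]
    {A : Type v} [CStarAlgebra A] [PartialOrder A] [StarOrderedRing A]
    {W : OperatorSystem A}
    [Module C(X, ℂ) W] [IsScalarTower ℂ C(X, ℂ) W]
    {m n κ : Type*} [Fintype m] [DecidableEq m] [Fintype n] [DecidableEq n]
    [Fintype κ] [DecidableEq κ]

/-- Complete positivity of a map into complex matrices, in terms of quadratic forms. -/
def IsCPForm (W : OperatorSystem A) (q : W → Matrix m m ℂ) : Prop :=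
  ∀ (κ : Type) [Fintype κ] [DecidableEq κ] (w : Matrix κ κ W), 0 ≤ W.matIncl κ w →
    ∀ ξ : κ → m → ℂ, 0 ≤ ∑ a, ∑ b, star (ξ a) ⬝ᵥ (q (w a b) *ᵥ ξ b)

theorem IsCPForm.add {q q' : W → Matrix m m ℂ} (hq : W.IsCPForm q) (hq' : W.IsCPForm q') :
    W.IsCPForm fun w => q w + q' w := by
  intro κ _ _ w hw ξ
  simp only [Matrix.add_mulVec, dotProduct_add, Finset.sum_add_distrib]
  exact add_nonneg (hq κ w hw ξ) (hq' κ w hw ξ)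

theorem IsCPForm.smul {q : W → Matrix m m ℂ} (hq : W.IsCPForm q) {c : ℂ} (hc : 0 ≤ c) :
    W.IsCPForm fun w => c • q w := by
  intro κ _ _ w hw ξ
  simp only [Matrix.smul_mulVec, dotProduct_smul, ← Finset.smul_sum]
  exact smul_nonneg hc (hq κ w hw ξ)

theorem IsCPForm.conj {q : W → Matrix m m ℂ} (hq : W.IsCPForm q) (b : Matrix m n ℂ) :
    W.IsCPForm fun w => bᴴ * q w * b := by
  intro κ _ _ w hw ξ
  simp only [Matrix.star_dotProduct_conjTranspose_mul_mul_mulVec]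
  exact hq κ w hw fun a => b *ᵥ ξ a

/-- Combining the columns of a Gram factor with scalar coefficients gives a Gram factor of the
compression. -/
theorem matIncl_compress_nonneg {w : Matrix κ κ W} (hw : 0 ≤ W.matIncl κ w) (ξ : κ → m → ℂ) :
    0 ≤ W.matIncl m (Matrix.of fun i j => ∑ a, ∑ b, (star (ξ a i) * ξ b j) • w a b) := by
  obtain ⟨C, hC⟩ := CStarMatrix.exists_gram hw
  refine CStarMatrix.nonneg_of_gram (fun r i => ∑ a, ξ a i • C r a) fun i j => ?_
  have h1 : W.matIncl m (Matrix.of fun i j => ∑ a, ∑ b, (star (ξ a i) * ξ b j) • w a b) i j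
      = ∑ a, ∑ b, (star (ξ a i) * ξ b j) • W.matIncl κ w a b := by
    rw [matIncl_apply, Matrix.of_apply]
    push_cast
    rfl
  rw [h1]
  have h2 : ∀ r, star (∑ a, ξ a i • C r a) * ∑ b, ξ b j • C r b
      = ∑ a, ∑ b, (star (ξ a i) * ξ b j) • (star (C r a) * C r b) := by
    intro r
    rw [star_sum, Finset.sum_mul_sum]
    refine Finset.sum_congr rfl fun a _ => Finset.sum_congr rfl fun b _ => ?_
    rw [star_smul, smul_mul_smul_comm]
  simp only [h2, hC, Finset.smul_sum]
  rw [Finset.sum_congr rfl fun a _ => Finset.sum_comm, Finset.sum_comm]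

/-- The matrix-valued map that belongs to a functional on the matrices over `W`. -/
noncomputable def functionalMap (s : Matrix m m W →ₗ[ℂ] ℂ) (w : W) : Matrix m m ℂ :=
  Matrix.of fun i j => s (Matrix.single i j w)

theorem functional_eq_sum (s : Matrix m m W →ₗ[ℂ] ℂ) (w : Matrix m m W) :
    s w = ∑ i, ∑ j, functionalMap s (w i j) i j := by
  conv_lhs => rw [Matrix.matrix_eq_sum_single w]
  simp only [map_sum]
  rfl

theorem functionalMap_smul_apply (s : Matrix m m W →ₗ[ℂ] ℂ) (c : ℂ) (w : W) (i j : m) :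
    functionalMap s (c • w) i j = c * functionalMap s w i j := by
  change s (Matrix.single i j (c • w)) = c * s (Matrix.single i j w)
  rw [← Matrix.smul_single, LinearMap.map_smul, smul_eq_mul]

theorem functionalMap_sum_apply {α : Type*} (s : Matrix m m W →ₗ[ℂ] ℂ) (t : Finset α) (w : α → W)
    (i j : m) : functionalMap s (∑ a ∈ t, w a) i j = ∑ a ∈ t, functionalMap s (w a) i j := by
  change (s ∘ₗ Matrix.singleLinearMap ℂ i j) (∑ a ∈ t, w a) = _
  rw [map_sum]
  rfl

/-- The quadratic form at `ξ` is the value of `s` at the compression of `w` by `ξ`. -/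
theorem isCPForm_functionalMap {s : Matrix m m W →ₗ[ℂ] ℂ}
    (hs : ∀ w, 0 ≤ W.matIncl m w → 0 ≤ s w) : W.IsCPForm (functionalMap s) := by
  intro κ _ _ w hw ξ
  refine (hs _ (matIncl_compress_nonneg hw ξ)).trans_eq ?_
  rw [functional_eq_sum]
  simp only [Matrix.of_apply, functionalMap_sum_apply, functionalMap_smul_apply, dotProduct, mulVec,
    Finset.mul_sum]
  have : ∀ (F : m → m → κ → κ → ℂ), ∑ i, ∑ j, ∑ a, ∑ b, F i j a b
      = ∑ a, ∑ b, ∑ i, ∑ j, F i j a b := by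
    intro F
    rw [Finset.sum_congr rfl fun i _ => Finset.sum_comm, Finset.sum_comm]
    refine Finset.sum_congr rfl fun a _ => ?_
    rw [Finset.sum_congr rfl fun i _ => Finset.sum_comm, Finset.sum_comm]
  rw [this]
  refine Finset.sum_congr rfl fun a _ => Finset.sum_congr rfl fun b _ =>
    Finset.sum_congr rfl fun i _ => Finset.sum_congr rfl fun j _ => ?_
  rw [Pi.star_apply]
  ring

/-- With `F = Gᴴ * G` the quadratic form is the sum, over rows `l` of `G` and diagonal positions
`p`, of forms of `q` at vectors supported at `p`. -/
theorem isCPForm_trace_smul {q : W → Matrix m m ℂ} (hq : W.IsCPForm q) {F : Matrix n n ℂ}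
    (hF : F.PosSemidef) : W.IsCPForm fun w => (q w).trace • F := by
  obtain ⟨G, rfl⟩ := hF.exists_eq_conjTranspose_mul_self
  intro κ _ _ w hw ξ
  have key : ∑ a, ∑ b, star (ξ a) ⬝ᵥ (((q (w a b)).trace • (Gᴴ * G)) *ᵥ ξ b)
      = ∑ l, ∑ p, ∑ a, ∑ b, star (Pi.single p ((G *ᵥ ξ a) l) : m → ℂ) ⬝ᵥ
          (q (w a b) *ᵥ Pi.single p ((G *ᵥ ξ b) l)) := by
    have h1 : ∀ a b, star (ξ a) ⬝ᵥ (((q (w a b)).trace • (Gᴴ * G)) *ᵥ ξ b)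
        = ∑ l, ∑ p, star (Pi.single p ((G *ᵥ ξ a) l) : m → ℂ) ⬝ᵥ
          (q (w a b) *ᵥ Pi.single p ((G *ᵥ ξ b) l)) := by
      intro a b
      rw [Matrix.smul_mulVec, dotProduct_smul, ← Matrix.mulVec_mulVec, Matrix.dotProduct_mulVec,
        ← Matrix.star_mulVec, dotProduct, Finset.smul_sum]
      refine Finset.sum_congr rfl fun l _ => ?_
      rw [Matrix.trace, Finset.sum_smul]
      refine Finset.sum_congr rfl fun p _ => ?_
      rw [← Pi.single_star, single_dotProduct, Matrix.mulVec_single]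
      simp [mul_comm, mul_assoc]
    simp only [h1]
    rw [Finset.sum_congr rfl fun a _ => Finset.sum_comm, Finset.sum_comm]
    refine Finset.sum_congr rfl fun l _ => ?_
    rw [Finset.sum_congr rfl fun a _ => Finset.sum_comm, Finset.sum_comm]
  rw [key]
  exact Finset.sum_nonneg fun l _ => Finset.sum_nonneg fun p _ => hq κ w hw _

theorem toFibre_smul (x : X) (f : C(X, ℂ)) (w : W) :
    W.toFibre x (f • w) = f x • W.toFibre x w := by
  rw [← map_smul, ← sub_eq_zero, ← map_sub, toFibre, Submodule.mkQ_apply,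
    Submodule.Quotient.mk_eq_zero]
  have : f • w - f x • w = (f - algebraMap ℂ C(X, ℂ) (f x)) • w := by
    rw [sub_smul, algebraMap_smul]
  rw [this]
  refine smul_mem_fibreKer ?_ _
  simp

theorem IsCXModule.N_e_eq_one (hW : W.IsCXModule (X := X)) [Nonempty m]
    (hinj : Function.Injective (fun f : C(X, ℂ) => f • W.unit)) (x : X) :
    (hW.matSystem m).N x (hW.matSystem m).e = 1 := by
  rcases (hW.matSystem m).N_e_eq x with h | h
  · exfalso
    obtain ⟨g, hg, hg0⟩ := CXSystem.exists_θ_eq_zero_of_N_e h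
    obtain ⟨i⟩ := ‹Nonempty m›
    have h1 : ofRealC g • W.unit = 0 := by
      have := congrFun (congrFun hg0 i) i
      change ((ofRealC g • (hW.matSystem m).e i i : W) : A) = 0 at this
      rw [hW.matSystem_e, if_pos rfl] at this
      exact Subtype.ext this
    have h2 : ofRealC g = 0 := hinj (by simpa using h1)
    have := congrArg (fun f : C(X, ℂ) => f x) h2
    simp [hg] at this
  · exact h

end OperatorSystem

/-! ### Extension of unital completely positive maps from a fibre. -/

namespace OperatorSystem

open Matrix

variable {X : Type u} [TopologicalSpace X] [CompactSpace X] [T2Space X]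
    {A : Type v} [CStarAlgebra A] [PartialOrder A] [StarOrderedRing A]
    {W : OperatorSystem A}
    [Module C(X, ℂ) W] [IsScalarTower ℂ C(X, ℂ) W]
    {m : Type*} [Fintype m] [DecidableEq m]

theorem IsCXModule.functionalMap_adj (hW : W.IsCXModule (X := X)) {y : X}
    {s : Matrix m m W →ₗ[ℂ] ℂ} (hs : (hW.matSystem m).IsFibreState y s) (w : W) (i j : m) :
    functionalMap s (W.adj w) i j = star (functionalMap s w j i) := by
  change s (Matrix.single i j (W.adj w)) = star (s (Matrix.single j i w))
  rw [← hs.map_adj]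
  congr 1
  ext p q
  change ((Matrix.single i j (W.adj w) p q : W) : A) = (W.adj (Matrix.single j i w q p) : W)
  rw [Matrix.single_apply, Matrix.single_apply]
  have h0 : W.adj 0 = 0 := Subtype.ext (star_zero A)
  by_cases h : i = p ∧ j = q
  · rw [if_pos h, if_pos ⟨h.2, h.1⟩]
  · rw [if_neg h, if_neg (fun h' => h ⟨h'.2, h'.1⟩), h0]

/-- With `κ` the sum of the entrywise distances from `d` to `1`, one has `d ≤ 1 + κ`, and `(1 - min
1 κ) (1 + κ) ≤ 1`. -/
theorem posSemidef_one_sub {d : Matrix m m ℂ} (hd : d.IsHermitian) :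
    (1 - (((1 - min 1 (∑ i, ∑ j, ‖d i j - (1 : Matrix m m ℂ) i j‖) : ℝ)) : ℂ) • d).PosSemidef := by
  set κ := ∑ i, ∑ j, ‖d i j - (1 : Matrix m m ℂ) i j‖ with hκ
  have hκ0 : 0 ≤ κ := Finset.sum_nonneg fun i _ => Finset.sum_nonneg fun j _ => norm_nonneg _
  have hher : (1 - (((1 - min 1 κ : ℝ)) : ℂ) • d).IsHermitian := by
    refine Matrix.isHermitian_one.sub ?_
    rw [Matrix.IsHermitian, Matrix.conjTranspose_smul, hd]
    simp
  refine Matrix.PosSemidef.of_dotProduct_mulVec_nonneg hher fun ξ => ?_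
  rw [Complex.nonneg_iff]
  refine ⟨?_, (hher.im_star_dotProduct_mulVec_self ξ).symm⟩
  have h1 := Matrix.norm_star_dotProduct_mulVec_le (d - 1) ξ
  have h2 : (star ξ ⬝ᵥ (d *ᵥ ξ)).re ≤ (1 + κ) * ∑ i, ‖ξ i‖ ^ 2 := by
    have h3 : star ξ ⬝ᵥ (d *ᵥ ξ) = star ξ ⬝ᵥ ((d - 1) *ᵥ ξ) + ((∑ i, ‖ξ i‖ ^ 2 : ℝ) : ℂ) := by
      rw [Matrix.sub_mulVec, dotProduct_sub, Matrix.one_mulVec, Matrix.star_dotProduct_self]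
      ring
    rw [h3, Complex.add_re, Complex.ofReal_re]
    have h4 := (Complex.re_le_norm (star ξ ⬝ᵥ ((d - 1) *ᵥ ξ))).trans h1
    change _ ≤ κ * _ at h4
    linarith
  rw [Matrix.sub_mulVec, dotProduct_sub, Matrix.one_mulVec, Matrix.star_dotProduct_self,
    Matrix.smul_mulVec, dotProduct_smul, smul_eq_mul, Complex.sub_re, Complex.ofReal_re,
    Complex.re_ofReal_mul, sub_nonneg]
  have hS : 0 ≤ ∑ i, ‖ξ i‖ ^ 2 := Finset.sum_nonneg fun i _ => sq_nonneg _
  have hmin : 0 ≤ 1 - min 1 κ := sub_nonneg.2 (min_le_left _ _)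
  refine (mul_le_mul_of_nonneg_left h2 hmin).trans ?_
  rw [← mul_assoc]
  refine mul_le_of_le_one_left hS ?_
  rcases le_total 1 κ with h | h
  · rw [min_eq_left h]; simp
  · rw [min_eq_right h]; nlinarith

/-- Unital completely positive maps on a fibre extend to the whole system. -/
theorem IsCXModule.exists_ucp_extension [TopologicalSpace.SeparableSpace W]
    (hW : W.IsCXModule (X := X))
    (hcont : ∀ (n : ℕ) (w : Matrix (Fin n) (Fin n) W),
      Continuous fun x : X => W.fibreNorm x (w.map (W.toFibre x)))
    (hinj : Function.Injective (fun f : C(X, ℂ) => f • W.unit)) {n : ℕ} [Nonempty (Fin n)] (x : X)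
    (φ : W.Fibre x →ₗ[ℂ] CStarMatrix (Fin n) (Fin n) ℂ)
    (hφ : IsUCP (W.fibreUnit x) (W.fibreCone x) φ) :
    ∃ ψ : W →ₗ[C(X, ℂ)] CStarMatrix (Fin n) (Fin n) C(X, ℂ),
      IsUCP W.unit W.matCone ψ ∧
      ∀ (w : W) (i j : Fin n), (ψ w i j) x = φ (W.toFibre x w) i j := by
  let D := hW.matSystem (Fin n)
  have hn : (n : ℂ) ≠ 0 := by
    have := Fin.pos_iff_nonempty.2 ‹Nonempty (Fin n)›
    exact_mod_cast this.ne'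
  have hn0 : (0 : ℂ) ≤ n := by exact_mod_cast Nat.zero_le n
  -- The functional on `M_n(W)` that corresponds to `φ`; the factor `1 / n` gives it the value `1`
  -- at the unit.
  let s₀ : Matrix (Fin n) (Fin n) W →ₗ[ℂ] ℂ :=
    { toFun := fun w => (n : ℂ)⁻¹ * ∑ i, ∑ j, φ (W.toFibre x (w i j)) i j
      map_add' := fun w w' => by
        simp only [Matrix.add_apply, map_add, CStarMatrix.add_apply, Finset.sum_add_distrib, mul_add]
      map_smul' := fun c w => by
        simp only [Matrix.smul_apply, map_smul, CStarMatrix.smul_apply, smul_eq_mul,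
          RingHom.id_apply, ← Finset.mul_sum]
        ring }
  have hs₀ : D.IsFibreState x s₀ := by
    refine ⟨?_, fun w hw => ?_, fun f w => ?_⟩
    · rw [hW.N_e_eq_one hinj x]
      change (n : ℂ)⁻¹ * ∑ i, ∑ j, φ (W.toFibre x (D.e i j)) i j = _
      have h1 : ∀ i j, φ (W.toFibre x (D.e i j)) i j = if i = j then 1 else 0 := by
        intro i j
        rw [hW.matSystem_e]
        split_ifs with h
        · change φ (W.fibreUnit x) i j = 1
          rw [hφ.map_unit, h, CStarMatrix.one_apply_eq]
        · simp
      simp [h1, hn]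
    · have hcone : w.map (W.toFibre x) ∈ W.fibreCone x n := by
        intro ε hε
        refine ⟨w, rfl, add_nonneg hw ?_⟩
        have h1 : (0 : CStarMatrix (Fin n) (Fin n) A) ≤ 1 := zero_le_one
        have := smul_nonneg hε.le h1
        have e : (ε : ℂ) • (1 : CStarMatrix (Fin n) (Fin n) A) = ε • 1 :=
          CStarMatrix.ext fun i j => Complex.coe_smul ε _
        rwa [e]
      have h1 := CStarMatrix.form_nonneg (hφ.map_cone n _ hcone) (fun a => Pi.single a 1)
      refine mul_nonneg (inv_nonneg.2 hn0) (h1.trans_eq ?_)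
      refine Finset.sum_congr rfl fun i _ => Finset.sum_congr rfl fun j _ => ?_
      rw [Matrix.mulVec_single_one, ← Pi.single_star, single_dotProduct]
      simp
    · change (n : ℂ)⁻¹ * ∑ i, ∑ j, φ (W.toFibre x ((f • w) i j)) i j
        = f x * ((n : ℂ)⁻¹ * ∑ i, ∑ j, φ (W.toFibre x (w i j)) i j)
      simp only [Matrix.smul_apply, toFibre_smul, map_smul, CStarMatrix.smul_apply,
        smul_eq_mul, ← Finset.mul_sum]
      ring
  obtain ⟨d, hd⟩ := hW.exists_dense_seq (m := Fin n)
  obtain ⟨t, ht₀, ht⟩ := hs₀.exists_extension (hW.continuous_N hcont) d hd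
  choose σ hσ htσ using ht
  let t' : Fin n → Fin n → W →ₗ[C(X, ℂ)] C(X, ℂ) := fun i j =>
    t ∘ₗ Matrix.singleLinearMap C(X, ℂ) i j
  have ht' : ∀ i j w y, t' i j w y = functionalMap (σ y) w i j := fun i j w y => htσ y _
  let τ : W →ₗ[C(X, ℂ)] C(X, ℂ) := ∑ i, t' i i
  have hτ : ∀ w y, τ w y = (functionalMap (σ y) w).trace := by
    intro w y
    simp only [τ, LinearMap.sum_apply, ContinuousMap.sum_apply, ht', Matrix.trace, Matrix.diag]
  -- The extended map is unital only at `x`. The factor `K`, with `K x = 1`, shrinks it until its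
  -- value at the unit is at most `1`; `F` is what is then missing from the identity matrix. Adding
  -- `F` times the unital positive functional `τ` restores unitality and changes nothing at `x`,
  -- where `F` vanishes.
  let K : C(X, ℂ) := ofRealC (1 - (1 ⊓ ∑ i, ∑ j,
    ⟨fun y => ‖(n : ℂ) * t' i j W.unit y - (1 : Matrix (Fin n) (Fin n) ℂ) i j‖, by fun_prop⟩))
  let F : Fin n → Fin n → C(X, ℂ) := fun i j =>
    (if i = j then 1 else 0) - K * ((n : ℂ) • t' i j W.unit)
  let dm : X → Matrix (Fin n) (Fin n) ℂ := fun y => (n : ℂ) • functionalMap (σ y) W.unit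
  have hK : ∀ y, K y = ((1 - min 1 (∑ i, ∑ j, ‖dm y i j - (1 : Matrix (Fin n) (Fin n) ℂ) i j‖) : ℝ)
      : ℂ) := by
    intro y
    simp only [K, ofRealC_apply, ContinuousMap.sub_apply, ContinuousMap.one_apply,
      ContinuousMap.inf_apply, ContinuousMap.sum_apply, ContinuousMap.coe_mk, ht']
    rfl
  have hF : ∀ y, (Matrix.of fun i j => F i j y) = 1 - K y • dm y := by
    intro y
    ext i j
    simp only [F, dm, Matrix.of_apply, Matrix.sub_apply, Matrix.smul_apply, Matrix.one_apply,
      ContinuousMap.sub_apply, ContinuousMap.mul_apply, ContinuousMap.smul_apply, ht', smul_eq_mul]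
    split_ifs <;> rfl
  have hadj : W.adj W.unit = W.unit := Subtype.ext (star_one A)
  have hdm : ∀ y, (dm y).IsHermitian := by
    intro y
    ext i j
    have := hW.functionalMap_adj (hσ y) W.unit i j
    rw [hadj] at this
    simp only [dm, Matrix.conjTranspose_apply, Matrix.smul_apply, this, smul_eq_mul, star_mul',
      star_natCast]
  have hFpos : ∀ y, (Matrix.of fun i j => F i j y).PosSemidef := by
    intro y
    rw [hF, hK]
    exact posSemidef_one_sub (hdm y)
  let ψ : W →ₗ[C(X, ℂ)] CStarMatrix (Fin n) (Fin n) C(X, ℂ) :=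
    { toFun := fun w => CStarMatrix.ofMatrix <| Matrix.of fun i j =>
        (n : ℂ) • (K * t' i j w) + τ w * F i j
      map_add' := fun w w' => by
        refine CStarMatrix.ext fun i j => ?_
        simp only [CStarMatrix.ofMatrix_apply, Matrix.of_apply, CStarMatrix.add_apply, map_add,
          mul_add, add_mul, smul_add]
        abel
      map_smul' := fun f w => by
        refine CStarMatrix.ext fun i j => ?_
        simp only [CStarMatrix.ofMatrix_apply, Matrix.of_apply, CStarMatrix.smul_apply, map_smul,
          smul_eq_mul, RingHom.id_apply, mul_add, mul_smul_comm]
        rw [mul_left_comm K f, mul_assoc f] }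
  have hψ : ∀ w y, (Matrix.of fun i j => ψ w i j y)
      = ((n : ℂ) * K y) • functionalMap (σ y) w
        + (functionalMap (σ y) w).trace • Matrix.of fun i j => F i j y := by
    intro w y
    ext i j
    change ((n : ℂ) • (K * t' i j w) + τ w * F i j) y = _
    simp only [ContinuousMap.add_apply, ContinuousMap.smul_apply, ContinuousMap.mul_apply, ht', hτ,
      Matrix.add_apply, Matrix.smul_apply, smul_eq_mul, Matrix.of_apply, mul_assoc]
  have hτ1 : τ W.unit = 1 := by
    ext y
    rw [hτ]
    have h1 := (hσ y).map_e
    rw [hW.N_e_eq_one hinj y, functional_eq_sum] at h1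
    rw [Matrix.trace, ContinuousMap.one_apply]
    rw [Complex.ofReal_one] at h1
    refine Eq.trans (Finset.sum_congr rfl fun i _ => ?_) h1
    rw [Finset.sum_eq_single i (fun j _ hj => ?_) (by simp), hW.matSystem_e, if_pos rfl]
    · rfl
    · rw [hW.matSystem_e, if_neg hj.symm]
      simpa using functionalMap_smul_apply (σ y) 0 0 i j
  have hx : ∀ w i j, (n : ℂ) * functionalMap (σ x) w i j = φ (W.toFibre x w) i j := by
    intro w i j
    have h1 : functionalMap (σ x) w i j = s₀ (Matrix.single i j w) := by
      rw [← ht₀, htσ]; rfl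
    rw [h1]
    change (n : ℂ) * ((n : ℂ)⁻¹ * ∑ p, ∑ q, φ (W.toFibre x (Matrix.single i j w p q)) p q) = _
    rw [mul_inv_cancel_left₀ hn, Finset.sum_eq_single i (fun p _ hp => ?_) (by simp),
      Finset.sum_eq_single j (fun q _ hq => ?_) (by simp), Matrix.single_apply_same]
    · rw [Matrix.single_apply_of_col_ne _ _ hq.symm]; simp
    · refine Finset.sum_eq_zero fun q _ => ?_
      rw [Matrix.single_apply_of_row_ne hp.symm]; simp
  refine ⟨ψ, ⟨?_, fun k M hM => ?_⟩, fun w i j => ?_⟩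
  · refine CStarMatrix.ext fun i j => ?_
    change (n : ℂ) • (K * t' i j W.unit) + τ W.unit * F i j = _
    rw [hτ1, one_mul, ← mul_smul_comm, CStarMatrix.one_apply]
    simp only [F]
    abel
  · refine CStarMatrix.nonneg_of_pointwise_form_nonneg fun y ξ => ?_
    have h1 : W.IsCPForm fun w => (Matrix.of fun i j => ψ w i j y) := by
      simp only [hψ]
      have h2 := isCPForm_functionalMap (hσ y).nonneg
      refine (h2.smul (mul_nonneg hn0 ?_)).add (isCPForm_trace_smul h2 (hFpos y))
      rw [hK]
      exact_mod_cast sub_nonneg.2 (min_le_left _ _)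
    exact h1 (Fin k) M hM ξ
  · have hdm1 : dm x = 1 := by
      ext i j
      change (n : ℂ) * functionalMap (σ x) W.unit i j = _
      rw [hx]
      change φ (W.fibreUnit x) i j = _
      rw [hφ.map_unit]
      rfl
    have hKx : K x = 1 := by
      rw [hK, hdm1]; simp
    have h1 := congrFun (congrFun (hψ w x) i) j
    rw [hF, hdm1, hKx, one_smul, sub_self, smul_zero, add_zero, mul_one, Matrix.smul_apply,
      smul_eq_mul, hx] at h1
    exact h1

end OperatorSystem

/-! ### Self-adjoint blocks and completely contractive maps. -/

namespace CXSystem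

variable {X V B : Type*} [TopologicalSpace X] [CompactSpace X] [AddCommGroup V]
    [Module ℂ V] [Module C(X, ℂ) V] [IsScalarTower ℂ C(X, ℂ) V] [CStarAlgebra B]
    {D : CXSystem X V B} [PartialOrder B] [StarOrderedRing B] [T2Space X] {y : X}

/-- A bump `g` that nearly attains the fibre norm of `w + l` gives `g • (w + l) ≤ p' + l` with `p' <
p`. A second bump `h`, chosen to make `h (1 - g)` small, cancels the shift by `l`. -/
theorem exists_bump_le_of_P_lt {w : V} (hw : IsSelfAdjoint (D.ι w)) {p : ℝ} (hp : D.P y w < p)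
    (hp0 : 0 < p) : ∃ h ∈ bumps y, D.ι (ofRealC h • w) ≤ p • (1 : B) := by
  obtain ⟨p', hp', hlt⟩ := exists_between (max_lt hp hp0)
  have hp'0 : 0 < p' := (le_max_right _ _).trans_lt hp'
  set l := ‖D.ι w‖ with hl
  have hl0 : 0 ≤ l := norm_nonneg _
  have hP := D.P_eq (y := y) (w := w) (le_refl l)
  have hN := D.N_e_le_one y
  have hlN : D.N y (D.re w + (l : ℂ) • D.e) < p' + l := by
    have := (le_max_left _ _).trans_lt hp'
    nlinarith
  obtain ⟨g, hg, hgn⟩ := D.exists_bump_norm_lt y (D.re w + (l : ℂ) • D.e) (sub_pos.2 hlN)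
  rw [add_sub_cancel] at hgn
  have hsa : IsSelfAdjoint (D.ι (D.re w + (l : ℂ) • D.e)) := by
    rw [map_add]
    refine (D.isSelfAdjoint_ι_re w).add ?_
    have := D.isSelfAdjoint_θ (l • 1)
    rwa [ofRealC_smul, D.θ_smul, map_one, D.θ_one, ← D.ι_e, ← D.ι_complex_smul] at this
  have h1 := D.ι_norm_smul_e_sub_nonneg (D.isSelfAdjoint_smul hsa g) hgn.le
  obtain ⟨h, hh, hhn⟩ := exists_bump_norm_mul_le (y := y) (f := 1 - ofRealC g) (by simp [hg.2.2])
    (show 0 < (p - p') / (l + 1) by have := sub_pos.2 hlt; positivity)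
  refine ⟨h * g, mul_mem_bumps hh hg, ?_⟩
  have h2 := D.ι_smul_nonneg hh.1 h1
  have e1 : ofRealC h • (((p' + l : ℝ) : ℂ) • D.e - ofRealC g • (D.re w + (l : ℂ) • D.e))
      = ofRealC (h * ((p' : ℝ) • 1 + l • (1 - g))) • D.e - ofRealC (h * g) • D.re w := by
    have hc : ∀ c : ℂ, c • D.e = (c • (1 : C(X, ℂ))) • D.e := fun c => by
      rw [smul_assoc, one_smul]
    rw [hc, hc, smul_add, smul_smul, ← sub_sub, smul_sub, smul_sub, smul_smul, smul_smul, smul_smul,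
      ← map_mul ofRealC h g, sub_right_comm, ← sub_smul]
    congr 2
    rw [map_mul, map_add, ofRealC_smul, ofRealC_smul, map_sub, map_one]
    ext x
    simp
    ring
  rw [e1, map_sub, sub_nonneg, D.ι_smul_eq_of_ι_eq (D.ι_re_eq_of_isSelfAdjoint hw)] at h2
  refine h2.trans ?_
  have h3 : D.θ (ofRealC (h * ((p' : ℝ) • 1 + l • (1 - g)))) ≤ D.θ (ofRealC (p • 1)) := by
    refine D.θ_mono fun x => ?_
    have h4 : h x * (1 - g x) ≤ (p - p') / (l + 1) := by
      have := (ContinuousMap.norm_coe_le_norm (ofRealC h * (1 - ofRealC g)) x).trans hhn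
      have e : (ofRealC h * (1 - ofRealC g)) x = ((h x * (1 - g x) : ℝ) : ℂ) := by simp
      rw [e, Complex.norm_real] at this
      exact (le_abs_self _).trans this
    have h5 : l * ((p - p') / (l + 1)) ≤ p - p' := by
      rw [mul_div_assoc', div_le_iff₀ (by positivity)]
      nlinarith
    have h6 := mul_le_mul_of_nonneg_left h4 hl0
    have h7 := mul_le_mul_of_nonneg_right (hh.2.1 x) hp'0.le
    simp only [ContinuousMap.mul_apply, ContinuousMap.add_apply, ContinuousMap.smul_apply,
      ContinuousMap.one_apply, ContinuousMap.sub_apply, smul_eq_mul, mul_one]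
    nlinarith
  refine h3.trans_eq ?_
  rw [ofRealC_smul, map_one, D.θ_smul, D.θ_one, Complex.coe_smul]

end CXSystem

namespace OperatorSystem

open Matrix

variable {X : Type u} [TopologicalSpace X] [CompactSpace X] [T2Space X]
    {A : Type v} [CStarAlgebra A] [PartialOrder A] [StarOrderedRing A]
    {W : OperatorSystem A}
    [Module C(X, ℂ) W] [IsScalarTower ℂ C(X, ℂ) W]
    {m κ : Type*} [Fintype m] [DecidableEq m] [Fintype κ] [DecidableEq κ]

/-- The block matrix with constant diagonal `c` and off-diagonal blocks `w` and `w⋆`. -/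
noncomputable def selfAdjointBlock (c : ℝ) (w : Matrix κ κ W) : Matrix (κ ⊕ κ) (κ ⊕ κ) W :=
  Matrix.fromBlocks (Matrix.of fun i j => if i = j then (c : ℂ) • W.unit else 0) w
    (Matrix.of fun i j => W.adj (w j i)) (Matrix.of fun i j => if i = j then (c : ℂ) • W.unit else 0)

theorem diag_unit_apply (c : ℝ) (i j : κ) :
    (((if i = j then (c : ℂ) • W.unit else 0 : W)) : A) = c • (1 : CStarMatrix κ κ A) i j := by
  rw [CStarMatrix.one_apply]
  split_ifs
  · exact Complex.coe_smul c (1 : A)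
  · simp

theorem selfAdjointBlock_nonneg {c : ℝ} (hc : 0 < c) {w : Matrix κ κ W} (hw : ‖W.matIncl κ w‖ ≤ c) :
    0 ≤ W.matIncl (κ ⊕ κ) (selfAdjointBlock c w) :=
  CStarMatrix.block_nonneg hc hw (fun i j => diag_unit_apply c i j) (fun _ _ => rfl)
    (fun _ _ => rfl) (fun i j => diag_unit_apply c i j)

theorem norm_le_of_selfAdjointBlock_nonneg {c : ℝ} (hc : 0 < c) {w : Matrix κ κ W}
    (h : 0 ≤ W.matIncl (κ ⊕ κ) (selfAdjointBlock c w)) : ‖W.matIncl κ w‖ ≤ c :=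
  CStarMatrix.norm_le_of_block_nonneg hc h (fun i j => diag_unit_apply c i j) (fun _ _ => rfl)
    (fun _ _ => rfl) (fun i j => diag_unit_apply c i j)

/-- The fibre norm is dominated by the upper bound of the self-adjoint off-diagonal block. -/
theorem IsCXModule.N_le_P_selfAdjointBlock (hW : W.IsCXModule (X := X)) (x : X) (w : Matrix κ κ W) :
    (hW.matSystem κ).N x w ≤ max 0 ((hW.matSystem (κ ⊕ κ)).P x (selfAdjointBlock 0 w)) := by
  let D := hW.matSystem (κ ⊕ κ)
  have hadj0 : ∀ a : W, W.adj (-a) = -W.adj a := fun a => Subtype.ext (star_neg (a : A))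
  have hsa : IsSelfAdjoint (D.ι (selfAdjointBlock 0 w)) := by
    refine CStarMatrix.ext fun i j => ?_
    rw [CStarMatrix.star_apply]
    rcases i with i | i <;> rcases j with j | j
    · change star (((if j = i then ((0 : ℝ) : ℂ) • W.unit else 0 : W)) : A)
        = ((if i = j then ((0 : ℝ) : ℂ) • W.unit else 0 : W) : A)
      simp
    · exact star_star _
    · rfl
    · change star (((if j = i then ((0 : ℝ) : ℂ) • W.unit else 0 : W)) : A)
        = ((if i = j then ((0 : ℝ) : ℂ) • W.unit else 0 : W) : A)
      simp
  refine le_of_forall_gt_imp_ge_of_dense fun p hp => ?_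
  have hp0 : 0 < p := (le_max_left _ _).trans_lt hp
  obtain ⟨h, hh, hle⟩ := CXSystem.exists_bump_le_of_P_lt hsa ((le_max_right _ _).trans_lt hp) hp0
  refine ((hW.matSystem κ).N_le hh w).trans ?_
  rw [← norm_neg, ← map_neg]
  refine norm_le_of_selfAdjointBlock_nonneg hp0 ?_
  -- Subtracting the localised block from `p` gives the block matrix with diagonal `p` and corner
  -- `-(h • w)`; its positivity bounds the norm of that corner.
  have e : W.matIncl (κ ⊕ κ) (selfAdjointBlock p (-(ofRealC h • w)))
      = p • 1 - D.ι (ofRealC h • selfAdjointBlock 0 w) := by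
    refine CStarMatrix.ext fun i j => ?_
    change _ = p • (1 : CStarMatrix (κ ⊕ κ) (κ ⊕ κ) A) i j
      - ((ofRealC h • selfAdjointBlock 0 w i j : W) : A)
    rcases i with i | i <;> rcases j with j | j
    · change ((if i = j then (p : ℂ) • W.unit else 0 : W) : A) = p • _ -
        ((ofRealC h • (if i = j then ((0 : ℝ) : ℂ) • W.unit else 0 : W) : W) : A)
      rw [diag_unit_apply]
      simp [CStarMatrix.one_apply]
    · change ((-(ofRealC h • w i j) : W) : A) = p • _ - ((ofRealC h • w i j : W) : A)
      simp
    · change ((W.adj (-(ofRealC h • w j i)) : W) : A)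
        = p • _ - ((ofRealC h • W.adj (w j i) : W) : A)
      rw [hadj0, hW.adj_smul, star_ofRealC]
      simp
    · change ((if i = j then (p : ℂ) • W.unit else 0 : W) : A) = p • _ -
        ((ofRealC h • (if i = j then ((0 : ℝ) : ℂ) • W.unit else 0 : W) : W) : A)
      rw [diag_unit_apply]
      simp [CStarMatrix.one_apply]
  rw [e, sub_nonneg]
  exact hle

/-- The squared Euclidean norm. -/
noncomputable def vecNormSq (v : m → ℂ) : ℝ := ∑ i, ‖v i‖ ^ 2

theorem vecNormSq_nonneg (v : m → ℂ) : 0 ≤ vecNormSq v := Finset.sum_nonneg fun _ _ => sq_nonneg _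

theorem star_dotProduct_self_eq (v : m → ℂ) : star v ⬝ᵥ v = (vecNormSq v : ℂ) :=
  Matrix.star_dotProduct_self v

/-- A completely positive map that is contractive at the unit is completely contractive. -/
theorem IsCPForm.sum_vecNormSq_le {κ : Type} [Fintype κ] [DecidableEq κ] {q : W →ₗ[ℂ] Matrix m m ℂ}
    (hq : W.IsCPForm q)
    (hadj : ∀ w, q (W.adj w) = (q w)ᴴ)
    (hunit : ∀ ξ : m → ℂ, (star ξ ⬝ᵥ (q W.unit *ᵥ ξ)).re ≤ vecNormSq ξ)
    {w : Matrix κ κ W} {c : ℝ} (hc : 0 < c) (hw : ‖W.matIncl κ w‖ ≤ c) (η : κ → m → ℂ) :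
    ∑ a, vecNormSq (∑ b, q (w a b) *ᵥ η b) ≤ c ^ 2 * ∑ b, vecNormSq (η b) := by
  set v : κ → m → ℂ := fun a => ∑ b, q (w a b) *ᵥ η b with hv
  -- For unital `q`, the choice `-v / c` of the first component minimises the form when the second
  -- is `η`.
  have h := hq (κ ⊕ κ) _ (selfAdjointBlock_nonneg hc hw)
    (Sum.elim (fun a => -((c⁻¹ : ℝ) : ℂ) • v a) η)
  simp only [Fintype.sum_sum_type, Sum.elim_inl, Sum.elim_inr, selfAdjointBlock,
    Matrix.fromBlocks_apply₁₁, Matrix.fromBlocks_apply₁₂, Matrix.fromBlocks_apply₂₁,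
    Matrix.fromBlocks_apply₂₂, Matrix.of_apply, hadj] at h
  have hdiag : ∀ ζ : κ → m → ℂ, ∑ a, ∑ b, star (ζ a) ⬝ᵥ
      (q (if a = b then (c : ℂ) • W.unit else 0) *ᵥ ζ b)
      = ∑ a, (c : ℂ) * (star (ζ a) ⬝ᵥ (q W.unit *ᵥ ζ a)) := by
    intro ζ
    refine Finset.sum_congr rfl fun a _ => ?_
    rw [Finset.sum_eq_single a (fun b _ hb => by simp [hb.symm]) (by simp), if_pos rfl,
      map_smul, Matrix.smul_mulVec, dotProduct_smul, smul_eq_mul]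
  have hcross : ∑ a, ∑ b, star (-((c⁻¹ : ℝ) : ℂ) • v a) ⬝ᵥ (q (w a b) *ᵥ η b)
      = ((-c⁻¹ * ∑ a, vecNormSq (v a) : ℝ) : ℂ) := by
    push_cast
    rw [Finset.mul_sum]
    refine Finset.sum_congr rfl fun a _ => ?_
    rw [← dotProduct_sum, star_smul, smul_dotProduct, star_dotProduct_self_eq]
    simp
  have hcross' : ∑ a, ∑ b, star (η a) ⬝ᵥ ((q (w b a))ᴴ *ᵥ (-((c⁻¹ : ℝ) : ℂ) • v b))
      = ((-c⁻¹ * ∑ a, vecNormSq (v a) : ℝ) : ℂ) := by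
    have h1 := congrArg star hcross
    rw [Complex.star_def, Complex.conj_ofReal, ← Complex.star_def, star_sum] at h1
    rw [← h1, Finset.sum_comm]
    refine Finset.sum_congr rfl fun a _ => ?_
    rw [star_sum]
    refine Finset.sum_congr rfl fun b _ => ?_
    rw [Matrix.dotProduct_mulVec, ← Matrix.star_mulVec, ← star_dotProduct_star, star_star]
  rw [Finset.sum_add_distrib, Finset.sum_add_distrib, hdiag (fun a => -((c⁻¹ : ℝ) : ℂ) • v a),
    hdiag η, hcross, hcross'] at h
  have hre := (Complex.nonneg_iff.1 h).1
  simp only [Complex.add_re, Complex.ofReal_re, Complex.re_sum, Complex.re_ofReal_mul,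
    ← Finset.mul_sum] at hre
  have h1 : ∑ a, (star (-((c⁻¹ : ℝ) : ℂ) • v a) ⬝ᵥ (q W.unit *ᵥ (-((c⁻¹ : ℝ) : ℂ) • v a))).re
      ≤ c⁻¹ ^ 2 * ∑ a, vecNormSq (v a) := by
    rw [Finset.mul_sum]
    refine Finset.sum_le_sum fun a _ => (hunit _).trans_eq ?_
    simp only [vecNormSq, Pi.smul_apply, norm_smul, norm_neg, Complex.norm_real, mul_pow,
      ← Finset.mul_sum, Real.norm_eq_abs, sq_abs]
  have h2 : ∑ a, (star (η a) ⬝ᵥ (q W.unit *ᵥ η a)).re ≤ ∑ b, vecNormSq (η b) :=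
    Finset.sum_le_sum fun a _ => hunit _
  set Q := ∑ a, vecNormSq (v a)
  set S := ∑ b, vecNormSq (η b)
  have h3 := mul_le_mul_of_nonneg_left h1 hc.le
  have h4 := mul_le_mul_of_nonneg_left h2 hc.le
  have h5 : c * (c⁻¹ ^ 2 * Q) = c⁻¹ * Q := by field_simp
  have h6 : c⁻¹ * Q ≤ c * S := by linarith
  rw [inv_mul_le_iff₀ hc] at h6
  linarith [h6]

end OperatorSystem

namespace OperatorSystem

open Matrix

variable {X : Type u} [TopologicalSpace X] [CompactSpace X] [T2Space X]
    {A : Type v} [CStarAlgebra A] [PartialOrder A] [StarOrderedRing A]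
    {W : OperatorSystem A}
    [Module C(X, ℂ) W] [IsScalarTower ℂ C(X, ℂ) W]
    {m κ : Type*} [Fintype m] [DecidableEq m] [Fintype κ] [DecidableEq κ]

/-- The value at a point of a map into the matrices over `C(X)`. -/
noncomputable def evalMatrix (ψ : W →ₗ[C(X, ℂ)] Matrix m m C(X, ℂ)) (y : X) :
    W →ₗ[ℂ] Matrix m m ℂ where
  toFun w := Matrix.of fun i j => ψ w i j y
  map_add' w w' := by
    ext i j
    simp
  map_smul' c w := by
    have : c • w = (c • (1 : C(X, ℂ))) • w := by rw [smul_assoc, one_smul]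
    ext i j
    rw [this, map_smul]
    simp

theorem evalMatrix_apply (ψ : W →ₗ[C(X, ℂ)] Matrix m m C(X, ℂ)) (y : X) (w : W) (i j : m) :
    evalMatrix ψ y w i j = ψ w i j y := rfl

theorem evalMatrix_smul (ψ : W →ₗ[C(X, ℂ)] Matrix m m C(X, ℂ)) (y : X) (f : C(X, ℂ)) (w : W) :
    evalMatrix ψ y (f • w) = f y • evalMatrix ψ y w := by
  ext i j
  simp [evalMatrix_apply]

/-- Self-adjoint `C(X)`-linear maps into matrices that are completely contractive on all fibres. -/
structure IsCCMap (ψ : W →ₗ[C(X, ℂ)] Matrix m m C(X, ℂ)) : Prop where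
  adj : ∀ w y, evalMatrix ψ y (W.adj w) = (evalMatrix ψ y w)ᴴ
  bound : ∀ (y : X) (k : ℕ) (w : Matrix (Fin k) (Fin k) W) (η : Fin k → m → ℂ),
    ∑ a, vecNormSq (∑ b, evalMatrix ψ y (w a b) *ᵥ η b) ≤
      W.fibreNorm y (w.map (W.toFibre y)) ^ 2 * ∑ b, vecNormSq (η b)

/-- For `c` above the fibre norm some bump gives `‖h • w‖ < c`, and `h` leaves the values at `y`
unchanged. The bound with `c` passes to the limit as `c` decreases to the fibre norm. -/
theorem IsCXModule.isCCMap (hW : W.IsCXModule (X := X))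
    {ψ : W →ₗ[C(X, ℂ)] Matrix m m C(X, ℂ)} (hcp : ∀ y, W.IsCPForm (evalMatrix ψ y))
    (hadj : ∀ w y, evalMatrix ψ y (W.adj w) = (evalMatrix ψ y w)ᴴ)
    (hunit : ∀ y (ξ : m → ℂ), (star ξ ⬝ᵥ (evalMatrix ψ y W.unit *ᵥ ξ)).re ≤ vecNormSq ξ) :
    IsCCMap ψ where
  adj := hadj
  bound y k w η := by
    rw [hW.fibreNorm_eq_N]
    set N := (hW.matSystem (Fin k)).N y w
    have hN : 0 ≤ N := (hW.matSystem (Fin k)).N_nonneg y w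
    have hc : ∀ c, N < c → ∑ a, vecNormSq (∑ b, evalMatrix ψ y (w a b) *ᵥ η b) ≤
        c ^ 2 * ∑ b, vecNormSq (η b) := by
      intro c hc
      obtain ⟨h, hh, hlt⟩ := (hW.matSystem (Fin k)).exists_bump_norm_lt y w (sub_pos.2 hc)
      rw [add_sub_cancel] at hlt
      have h1 := (hcp y).sum_vecNormSq_le (fun w => hadj w y) (hunit y) (hN.trans_lt hc) hlt.le η
      have h2 : ∀ a b, evalMatrix ψ y ((ofRealC h • w) a b) = evalMatrix ψ y (w a b) := by
        intro a b
        rw [Matrix.smul_apply, evalMatrix_smul]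
        simp [hh.2.2]
      simpa only [h2] using h1
    have hlim : Tendsto (fun c : ℝ => c ^ 2 * ∑ b, vecNormSq (η b)) (𝓝[>] N)
        (𝓝 (N ^ 2 * ∑ b, vecNormSq (η b))) :=
      ((continuous_id.pow 2).mul continuous_const).continuousAt.tendsto.mono_left
        nhdsWithin_le_nhds
    exact ge_of_tendsto hlim (eventually_nhdsWithin_of_forall hc)

theorem IsCPForm.posSemidef_unit {q : W → Matrix m m ℂ} (hq : W.IsCPForm q) :
    (q W.unit).PosSemidef := by
  refine Matrix.posSemidef_of_forall_dotProduct_nonneg fun ξ => ?_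
  have h := hq Unit (Matrix.of fun _ _ => W.unit) (by
    have : W.matIncl Unit (Matrix.of fun _ _ => W.unit) = 1 := by
      ext i j
      simp only [Subsingleton.elim i j, CStarMatrix.one_apply_eq]
      rfl
    rw [this]
    exact zero_le_one) fun _ => ξ
  simpa using h

theorem trace_functionalMap_unit (hW : W.IsCXModule (X := X)) (s : Matrix m m W →ₗ[ℂ] ℂ) :
    (functionalMap s W.unit).trace = s (hW.matSystem m).e := by
  rw [functional_eq_sum, Matrix.trace]
  refine Finset.sum_congr rfl fun i _ => ?_
  rw [Finset.sum_eq_single i (fun j _ hj => ?_) (by simp), hW.matSystem_e, if_pos rfl]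
  · rfl
  · rw [hW.matSystem_e, if_neg hj.symm]
    simpa using functionalMap_smul_apply s 0 0 i j

/-- A completely contractive map that almost attains the norm of a given element of a fibre. -/
theorem IsCXModule.exists_isCCMap [TopologicalSpace.SeparableSpace W]
    (hW : W.IsCXModule (X := X))
    (hcont : ∀ (n : ℕ) (w : Matrix (Fin n) (Fin n) W),
      Continuous fun x : X => W.fibreNorm x (w.map (W.toFibre x)))
    (x : X) {k : ℕ} (w : Matrix (Fin k) (Fin k) W) {δ : ℝ} (hδ : 0 < δ) :
    ∃ ψ : W →ₗ[C(X, ℂ)] Matrix (Fin k ⊕ Fin k) (Fin k ⊕ Fin k) C(X, ℂ), IsCCMap ψ ∧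
      ∀ M : ℝ, 0 < M → (∀ η : Fin k → Fin k ⊕ Fin k → ℂ,
        ∑ a, vecNormSq (∑ b, evalMatrix ψ x (w a b) *ᵥ η b) ≤ M ^ 2 * ∑ b, vecNormSq (η b)) →
        W.fibreNorm x (w.map (W.toFibre x)) ≤ M * (1 + δ) := by
  let m := Fin k ⊕ Fin k
  let D := hW.matSystem m
  obtain ⟨s₀, hs₀, hs₀P⟩ := D.exists_isFibreState_re_eq x (selfAdjointBlock 0 w)
  obtain ⟨d, hd⟩ := hW.exists_dense_seq (m := m)
  obtain ⟨t, ht₀, ht⟩ := hs₀.exists_extension (hW.continuous_N hcont) d hd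
  choose σ hσ htσ using ht
  have hσx : σ x = s₀ := LinearMap.ext fun w => by rw [← ht₀, htσ]
  let t' : m → m → W →ₗ[C(X, ℂ)] C(X, ℂ) := fun i j =>
    t ∘ₗ Matrix.singleLinearMap C(X, ℂ) i j
  have ht' : ∀ i j w y, t' i j w y = functionalMap (σ y) w i j := fun i j w y => htσ y _
  have hcp : ∀ y, W.IsCPForm (functionalMap (σ y)) := fun y => isCPForm_functionalMap (hσ y).nonneg
  -- Adding `ε` makes the value at the unit invertible. The matrices have size `2 k`, so the trace
  -- grows by `2 k ε ≤ δ`.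
  set ε : ℝ := δ / (2 * k + 1) with hε
  have hε0 : 0 < ε := by positivity
  have hpd : (functionalMap s₀ W.unit + (ε : ℂ) • (1 : Matrix m m ℂ)).PosDef := by
    rw [← hσx]
    exact Matrix.PosDef.posSemidef_add (hcp x).posSemidef_unit
      (Matrix.PosDef.one.smul (by exact_mod_cast hε0))
  obtain ⟨B, hB⟩ := hpd.posSemidef.exists_eq_conjTranspose_mul_self
  have hBu : IsUnit B := by
    have := hpd.isUnit
    rw [hB] at this
    exact (isUnit_of_mul_isUnit_right this)
  have hBdet := (Matrix.isUnit_iff_isUnit_det B).1 hBu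
  let b := B⁻¹
  have hBb : B * b = 1 := Matrix.mul_nonsing_inv _ hBdet
  have hbB : b * B = 1 := Matrix.nonsing_inv_mul _ hBdet
  -- Conjugation by `b` makes the value at the unit at most `1` at `x`. At `y` it is at most `1 + κ
  -- y`, and the factor `g = 1 / (1 + κ)`, which is `1` at `x`, compensates for this.
  let d₁ : X → Matrix m m ℂ := fun y => bᴴ * functionalMap (σ y) W.unit * b
  have hd₁ : ∀ i j, Continuous fun y => d₁ y i j := by
    intro i j
    simp only [d₁, Matrix.mul_apply, ← ht']
    fun_prop
  let κ : X → ℝ := fun y => ∑ i, ∑ j, ‖(d₁ y - d₁ x) i j‖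
  have hκ : Continuous κ := by
    simp only [κ, Matrix.sub_apply]
    fun_prop
  have hκ0 : ∀ y, 0 ≤ κ y := fun y =>
    Finset.sum_nonneg fun i _ => Finset.sum_nonneg fun j _ => norm_nonneg _
  have hκx : κ x = 0 := by simp [κ]
  let g : C(X, ℂ) := ofRealC ⟨fun y => (1 + κ y)⁻¹,
    (continuous_const.add hκ).inv₀ fun y => by
      have := hκ0 y
      exact (by linarith : 0 < 1 + κ y).ne'⟩
  have hg : ∀ y, g y = (((1 + κ y)⁻¹ : ℝ) : ℂ) := fun y => rfl
  let ψ : W →ₗ[C(X, ℂ)] Matrix m m C(X, ℂ) :=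
    { toFun := fun w => Matrix.of fun i j =>
        ∑ r, ∑ p, ((star (b p i) * b r j) • g) * t' p r w
      map_add' := fun w w' => by
        ext i j : 2
        simp only [map_add, Finset.sum_add_distrib, mul_add, Matrix.of_apply, Matrix.add_apply]
      map_smul' := fun f w => by
        ext i j : 2
        simp only [map_smul, smul_eq_mul, mul_left_comm _ f, ← Finset.mul_sum, Matrix.of_apply,
          Matrix.smul_apply, RingHom.id_apply] }
  have hψ : ∀ y w, evalMatrix ψ y w = g y • (bᴴ * functionalMap (σ y) w * b) := by
    intro y w
    ext i j
    change (∑ r, ∑ p, ((star (b p i) * b r j) • g) * t' p r w) y = _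
    simp only [ContinuousMap.sum_apply, ContinuousMap.mul_apply, ContinuousMap.smul_apply, ht',
      Matrix.smul_apply, Matrix.mul_apply, Matrix.conjTranspose_apply, smul_eq_mul, Finset.mul_sum,
      Finset.sum_mul]
    refine Finset.sum_congr rfl fun r _ => Finset.sum_congr rfl fun p _ => ?_
    ring
  have hcc : IsCCMap ψ := by
    refine hW.isCCMap (fun y => ?_) (fun w y => ?_) (fun y ξ => ?_)
    · have : (evalMatrix ψ y : W → Matrix m m ℂ)
          = fun w => g y • (bᴴ * functionalMap (σ y) w * b) := funext (hψ y)
      rw [this]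
      refine ((hcp y).conj b).smul ?_
      rw [hg]
      have := hκ0 y
      exact_mod_cast (by positivity : 0 ≤ (1 + κ y)⁻¹)
    · have h1 : functionalMap (σ y) (W.adj w) = (functionalMap (σ y) w)ᴴ := by
        ext i j
        exact hW.functionalMap_adj (hσ y) w i j
      rw [hψ, hψ, h1, Matrix.conjTranspose_smul, Matrix.conjTranspose_mul, Matrix.conjTranspose_mul,
        Matrix.conjTranspose_conjTranspose, hg, Matrix.mul_assoc]
      simp
    · have h1 : (star ξ ⬝ᵥ (d₁ x *ᵥ ξ)).re ≤ vecNormSq ξ := by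
        have h2 : d₁ x = 1 - (ε : ℂ) • (bᴴ * b) := by
          have h3 : functionalMap (σ x) W.unit = Bᴴ * B - (ε : ℂ) • 1 := by
            rw [hσx, ← hB, add_sub_cancel_right]
          have h4 : bᴴ * Bᴴ = 1 := by rw [← Matrix.conjTranspose_mul, hBb, Matrix.conjTranspose_one]
          change bᴴ * functionalMap (σ x) W.unit * b = _
          rw [h3, mul_sub, sub_mul, ← mul_assoc, h4, one_mul, hBb, mul_smul_comm, mul_one,
            smul_mul_assoc]
        have h5 : star ξ ⬝ᵥ ((bᴴ * b) *ᵥ ξ) = (vecNormSq (b *ᵥ ξ) : ℂ) := by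
          rw [← star_dotProduct_self_eq, ← Matrix.mulVec_mulVec, Matrix.dotProduct_mulVec,
            ← Matrix.star_mulVec]
        rw [h2, Matrix.sub_mulVec, dotProduct_sub, Matrix.one_mulVec, star_dotProduct_self_eq,
          Matrix.smul_mulVec, dotProduct_smul, h5, smul_eq_mul, Complex.sub_re, Complex.ofReal_re,
          Complex.re_ofReal_mul, Complex.ofReal_re]
        have := mul_nonneg hε0.le (vecNormSq_nonneg (b *ᵥ ξ))
        linarith
      have h6 : (star ξ ⬝ᵥ ((d₁ y - d₁ x) *ᵥ ξ)).re ≤ κ y * vecNormSq ξ :=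
        (Complex.re_le_norm _).trans (Matrix.norm_star_dotProduct_mulVec_le _ _)
      rw [Matrix.sub_mulVec, dotProduct_sub, Complex.sub_re] at h6
      rw [hψ]
      change (star ξ ⬝ᵥ ((g y • d₁ y) *ᵥ ξ)).re ≤ vecNormSq ξ
      rw [Matrix.smul_mulVec, dotProduct_smul, smul_eq_mul, hg, Complex.re_ofReal_mul,
        inv_mul_le_iff₀ (by have := hκ0 y; positivity)]
      linarith
  refine ⟨ψ, hcc, fun M hM hbd => ?_⟩
  have hqx : ∀ w, functionalMap s₀ w = Bᴴ * evalMatrix ψ x w * B := by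
    intro w
    have h4 : Bᴴ * bᴴ = 1 := by rw [← Matrix.conjTranspose_mul, hbB, Matrix.conjTranspose_one]
    rw [hψ, hg, hκx, hσx]
    simp only [add_zero, inv_one, Complex.ofReal_one, one_smul]
    rw [mul_assoc, mul_assoc, hbB, mul_one, ← mul_assoc, h4, one_mul]
  -- The columns of `B`. They express `s₀` through matrix coefficients of `evalMatrix ψ x`, and
  -- their squared norms sum to the trace of `Bᴴ * B`, which is at most `1 + δ`.
  let ζ : m → m → ℂ := fun p i => B i p
  have hentry : ∀ w p r, functionalMap s₀ w p r = star (ζ p) ⬝ᵥ (evalMatrix ψ x w *ᵥ ζ r) := by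
    intro w p r
    have h1 : ∀ p, ζ p = B *ᵥ Pi.single p 1 := fun p => (Matrix.mulVec_single_one B p).symm
    rw [h1, h1, ← Matrix.star_dotProduct_conjTranspose_mul_mul_mulVec, ← hqx, ← Pi.single_star,
      single_dotProduct, Matrix.mulVec_single_one]
    simp
  set v : Fin k → m → ℂ := fun a => ∑ b, evalMatrix ψ x (w a b) *ᵥ ζ (.inr b) with hv
  have hsZ : (s₀ (selfAdjointBlock 0 w)).re = 2 * ∑ a, (star (ζ (.inl a)) ⬝ᵥ v a).re := by
    have hz : ∀ (i j : Fin k) (p r : m),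
        functionalMap s₀ (if i = j then ((0 : ℝ) : ℂ) • W.unit else 0) p r = 0 := by
      intro i j p r
      have : (if i = j then ((0 : ℝ) : ℂ) • W.unit else 0 : W) = (0 : ℂ) • W.unit := by simp
      rw [this, functionalMap_smul_apply, zero_mul]
    have h1 : ∑ a, ∑ b, functionalMap s₀ (w a b) (.inl a) (.inr b)
        = ∑ a, star (ζ (.inl a)) ⬝ᵥ v a := by
      refine Finset.sum_congr rfl fun a _ => ?_
      rw [hv, dotProduct_sum]
      exact Finset.sum_congr rfl fun b _ => hentry _ _ _
    have h2 : ∑ i, ∑ j, functionalMap s₀ (W.adj (w j i)) (.inr i) (.inl j)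
        = star (∑ a, star (ζ (.inl a)) ⬝ᵥ v a) := by
      rw [← h1, star_sum, Finset.sum_comm]
      refine Finset.sum_congr rfl fun a _ => ?_
      rw [star_sum]
      exact Finset.sum_congr rfl fun b _ => hW.functionalMap_adj hs₀ _ _ _
    rw [functional_eq_sum]
    simp only [selfAdjointBlock, m, Fintype.sum_sum_type, Matrix.fromBlocks_apply₁₁,
      Matrix.fromBlocks_apply₁₂, Matrix.fromBlocks_apply₂₁, Matrix.fromBlocks_apply₂₂,
      Matrix.of_apply, hz, Finset.sum_const_zero, add_zero, zero_add]
    rw [h1, h2, Complex.add_re, Complex.star_def, Complex.conj_re, Complex.re_sum]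
    ring
  have htr : ∑ a, vecNormSq (ζ (.inl a)) + ∑ a, vecNormSq (ζ (.inr a)) ≤ 1 + δ := by
    have h1 : ((∑ p, vecNormSq (ζ p) : ℝ) : ℂ) = (Bᴴ * B).trace := by
      push_cast
      refine Finset.sum_congr rfl fun p _ => ?_
      rw [← star_dotProduct_self_eq]
      rfl
    rw [← hB, Matrix.trace_add, trace_functionalMap_unit hW, hs₀.map_e, Matrix.trace_smul,
      Matrix.trace_one] at h1
    have h2 : ∑ p, vecNormSq (ζ p) = D.N x D.e + ε * (2 * k) := by
      have h3 : ((∑ p, vecNormSq (ζ p) : ℝ) : ℂ) = ((D.N x D.e + ε * (2 * k) : ℝ) : ℂ) := by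
        rw [h1]
        simp only [m, D, Fintype.card_sum, Fintype.card_fin, smul_eq_mul]
        push_cast
        ring
      exact_mod_cast h3
    rw [← Fintype.sum_sum_type (fun p => vecNormSq (ζ p)), h2]
    refine add_le_add (D.N_e_le_one x) ?_
    rw [hε, div_mul_eq_mul_div, div_le_iff₀ (by positivity)]
    nlinarith
  -- The weights are chosen so that the bound `M²` for the second term leaves the same factor `M` in
  -- front of both halves of the trace.
  have hYoung : ∀ ξ η : m → ℂ, 2 * (star ξ ⬝ᵥ η).re ≤ M * vecNormSq ξ + M⁻¹ * vecNormSq η := by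
    intro ξ η
    rw [dotProduct, Complex.re_sum, vecNormSq, vecNormSq, Finset.mul_sum, Finset.mul_sum,
      Finset.mul_sum, ← Finset.sum_add_distrib]
    refine Finset.sum_le_sum fun i _ => ?_
    have h1 := Complex.re_le_norm (star ξ i * η i)
    rw [norm_mul, Pi.star_apply, norm_star] at h1
    have h2 : 2 * (‖ξ i‖ * ‖η i‖) ≤ M * ‖ξ i‖ ^ 2 + M⁻¹ * ‖η i‖ ^ 2 := by
      have h3 : M * ‖ξ i‖ ^ 2 + M⁻¹ * ‖η i‖ ^ 2 - 2 * (‖ξ i‖ * ‖η i‖)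
          = M⁻¹ * (M * ‖ξ i‖ - ‖η i‖) ^ 2 := by field_simp; ring
      have : 0 ≤ M⁻¹ * (M * ‖ξ i‖ - ‖η i‖) ^ 2 := by positivity
      linarith
    exact (mul_le_mul_of_nonneg_left h1 zero_le_two).trans h2
  have hbd' := hbd fun b => ζ (.inr b)
  rw [hW.fibreNorm_eq_N]
  refine (hW.N_le_P_selfAdjointBlock x w).trans (max_le (by positivity) ?_)
  change D.P x _ ≤ _
  rw [← hs₀P, hsZ, Finset.mul_sum]
  calc ∑ a, 2 * (star (ζ (.inl a)) ⬝ᵥ v a).re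
      ≤ ∑ a, (M * vecNormSq (ζ (.inl a)) + M⁻¹ * vecNormSq (v a)) :=
        Finset.sum_le_sum fun a _ => hYoung _ _
    _ = M * ∑ a, vecNormSq (ζ (.inl a)) + M⁻¹ * ∑ a, vecNormSq (v a) := by
        rw [Finset.sum_add_distrib, Finset.mul_sum, Finset.mul_sum]
    _ ≤ M * ∑ a, vecNormSq (ζ (.inl a)) + M⁻¹ * (M ^ 2 * ∑ b, vecNormSq (ζ (.inr b))) :=
        add_le_add le_rfl (mul_le_mul_of_nonneg_left hbd' (by positivity))
    _ = M * (∑ a, vecNormSq (ζ (.inl a)) + ∑ b, vecNormSq (ζ (.inr b))) := by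
        field_simp
    _ ≤ M * (1 + δ) := mul_le_mul_of_nonneg_left htr hM.le

end OperatorSystem

/-! ### Operators on Hilbert direct sums. -/

section OperatorMatrix

variable {K : Type*} [NormedAddCommGroup K] [InnerProductSpace ℂ K] [CompleteSpace K]
  {k : Type*} [Fintype k] [DecidableEq k]

/-- A matrix of operators as an operator on the direct sum. -/
noncomputable def operatorMatrix (M : CStarMatrix k k (K →L[ℂ] K)) :
    PiLp 2 (fun _ : k => K) →L[ℂ] PiLp 2 (fun _ : k => K) :=
  (PiLp.continuousLinearEquiv 2 ℂ (fun _ : k => K)).symm.toContinuousLinearMap ∘L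
    (ContinuousLinearMap.pi fun a => ∑ b, M a b ∘L ContinuousLinearMap.proj b) ∘L
    (PiLp.continuousLinearEquiv 2 ℂ (fun _ : k => K)).toContinuousLinearMap

theorem operatorMatrix_apply (M : CStarMatrix k k (K →L[ℂ] K)) (ξ : PiLp 2 (fun _ : k => K))
    (a : k) : operatorMatrix M ξ a = ∑ b, M a b (ξ b) := by
  simp [operatorMatrix]

/-- `operatorMatrix` as a ⋆-homomorphism. -/
noncomputable def operatorMatrixHom : CStarMatrix k k (K →L[ℂ] K) →⋆ₙₐ[ℂ]
    (PiLp 2 (fun _ : k => K) →L[ℂ] PiLp 2 (fun _ : k => K)) where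
  toFun := operatorMatrix
  map_smul' c M := by
    ext ξ a
    simp [operatorMatrix_apply, Finset.smul_sum]
  map_zero' := by
    ext ξ a
    simp [operatorMatrix_apply]
  map_add' M N := by
    ext ξ a
    simp [operatorMatrix_apply, Finset.sum_add_distrib]
  map_mul' M N := by
    ext ξ a
    change _ = operatorMatrix M (operatorMatrix N ξ) a
    simp only [operatorMatrix_apply, CStarMatrix.mul_apply, _root_.sum_apply, map_sum]
    rw [Finset.sum_comm]
    rfl
  map_star' M := by
    rw [ContinuousLinearMap.star_eq_adjoint, ContinuousLinearMap.eq_adjoint_iff]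
    intro ξ η
    simp only [PiLp.inner_apply, operatorMatrix_apply, sum_inner, inner_sum]
    rw [Finset.sum_comm]
    refine Finset.sum_congr rfl fun a _ => Finset.sum_congr rfl fun b _ => ?_
    rw [CStarMatrix.star_apply, ContinuousLinearMap.star_eq_adjoint,
      ContinuousLinearMap.adjoint_inner_left]

theorem operatorMatrixHom_injective :
    Function.Injective (operatorMatrixHom (K := K) (k := k)) := by
  intro M N h
  ext a b v
  have h1 : operatorMatrix M (WithLp.toLp 2 (Pi.single b v)) a
      = operatorMatrix N (WithLp.toLp 2 (Pi.single b v)) a := by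
    have h' : operatorMatrix M = operatorMatrix N := h
    rw [h']
  rw [operatorMatrix_apply, operatorMatrix_apply,
    Finset.sum_eq_single b (fun c _ hc => by simp [hc]) (by simp),
    Finset.sum_eq_single b (fun c _ hc => by simp [hc]) (by simp)] at h1
  simpa using h1

/-- The norm of a matrix of operators is the norm of the operator on the direct sum. -/
theorem CStarMatrix.norm_le_iff_sum_le (M : CStarMatrix k k (K →L[ℂ] K)) {c : ℝ} (hc : 0 ≤ c) :
    ‖M‖ ≤ c ↔ ∀ ξ : k → K, ∑ a, ‖∑ b, M a b (ξ b)‖ ^ 2 ≤ c ^ 2 * ∑ b, ‖ξ b‖ ^ 2 := by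
  have h1 : ‖M‖ = ‖operatorMatrix M‖ :=
    (NonUnitalStarAlgHom.norm_map (operatorMatrixHom (K := K) (k := k))
      operatorMatrixHom_injective M).symm
  have h2 : ∀ ξ : PiLp 2 (fun _ : k => K), ‖operatorMatrix M ξ‖ ≤ c * ‖ξ‖ ↔
      ∑ a, ‖∑ b, M a b (ξ b)‖ ^ 2 ≤ c ^ 2 * ∑ b, ‖ξ b‖ ^ 2 := by
    intro ξ
    rw [← sq_le_sq₀ (norm_nonneg _) (by positivity), mul_pow, PiLp.norm_sq_eq_of_L2,
      PiLp.norm_sq_eq_of_L2]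
    simp only [operatorMatrix_apply]
  rw [h1, ContinuousLinearMap.opNorm_le_iff hc]
  exact ⟨fun h ξ => (h2 (WithLp.toLp 2 ξ)).1 (h _), fun h ξ => (h2 ξ).2 (h _)⟩

end OperatorMatrix

section HilbertSum

variable {I : Type*} {G : I → Type*} [∀ i, NormedAddCommGroup (G i)]
  [∀ i, InnerProductSpace ℂ (G i)]

theorem lp.hasSum_norm_sq (f : lp G 2) : HasSum (fun i => ‖f i‖ ^ 2) (‖f‖ ^ 2) := by
  have h := lp.hasSum_norm (p := 2) (by norm_num) f
  simpa using h

theorem memℓp_two_of_norm_le {f : lp G 2} {g : ∀ i, G i} {C : ℝ} (hg : ∀ i, ‖g i‖ ≤ C * ‖f i‖) :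
    Memℓp g 2 := by
  refine memℓp_gen ?_
  have h : Summable fun i => ‖g i‖ ^ 2 := by
    refine Summable.of_nonneg_of_le (fun i => sq_nonneg _) (fun i => ?_)
      ((lp.hasSum_norm_sq f).summable.mul_left (C ^ 2))
    rw [← mul_pow]
    exact pow_le_pow_left₀ (norm_nonneg _) (hg i) 2
  simpa using h

/-- The block diagonal operator of a bounded family of operators. -/
noncomputable def lp.blockDiag (T : ∀ i, G i →L[ℂ] G i) (C : ℝ) (hT : ∀ i, ‖T i‖ ≤ C) :
    lp G 2 →L[ℂ] lp G 2 :=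
  LinearMap.mkContinuous
    { toFun := fun f => ⟨fun i => T i (f i),
        memℓp_two_of_norm_le (f := f) fun i => (T i).le_of_opNorm_le (hT i) (f i)⟩
      map_add' := fun f g => by ext i; exact map_add (T i) _ _
      map_smul' := fun c f => by ext i; exact map_smul (T i) _ _ }
    -- If the index type is empty, `C` may be negative.
    |C| fun f => by
      have h1 := lp.hasSum_norm_sq (⟨fun i => T i (f i),
        memℓp_two_of_norm_le (f := f) fun i => (T i).le_of_opNorm_le (hT i) (f i)⟩ : lp G 2)
      have h2 := (lp.hasSum_norm_sq f).mul_left (C ^ 2)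
      have h3 := hasSum_le (fun i => ?_) h1 h2
      · rw [← mul_pow] at h3
        have h4 := sq_le_sq.1 h3
        rwa [abs_norm, abs_mul, abs_norm] at h4
      · change ‖T i (f i)‖ ^ 2 ≤ _
        rw [← mul_pow]
        exact pow_le_pow_left₀ (norm_nonneg _) ((T i).le_of_opNorm_le (hT i) (f i)) 2

theorem lp.blockDiag_apply (T : ∀ i, G i →L[ℂ] G i) (C : ℝ) (hT : ∀ i, ‖T i‖ ≤ C) (f : lp G 2)
    (i : I) : lp.blockDiag T C hT f i = T i (f i) := rfl

theorem lp.norm_blockDiag_le (T : ∀ i, G i →L[ℂ] G i) (C : ℝ) (hT : ∀ i, ‖T i‖ ≤ C) :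
    ‖lp.blockDiag T C hT‖ ≤ |C| := LinearMap.mkContinuous_norm_le _ (abs_nonneg C) _

end HilbertSum

/-! ### The Hilbert module `C(X, H)` and its fibres. -/

namespace HilbertCX

variable {X : Type*} [TopologicalSpace X] [CompactSpace X]
  {H : Type*} [NormedAddCommGroup H] [InnerProductSpace ℂ H]

/-- The Hilbert `C(X)`-module of the continuous functions with values in a Hilbert space. -/
noncomputable instance instCStarModuleContinuousMap : CStarModule C(X, ℂ) C(X, H) where
  inner ξ η := ⟨fun x => inner ℂ (ξ x) (η x), by fun_prop⟩
  inner_add_right {ξ η ζ} := by ext x; exact inner_add_right _ _ _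
  inner_self_nonneg {ξ} := by
    intro x
    change (0 : ℂ) ≤ inner ℂ (ξ x) (ξ x)
    exact RCLike.nonneg_iff.2 ⟨inner_self_nonneg, inner_self_im _⟩
  inner_self {ξ} := by
    constructor
    · intro h
      ext x
      have := congrArg (fun f : C(X, ℂ) => f x) h
      exact inner_self_eq_zero.1 this
    · rintro rfl
      ext x
      exact inner_zero_left _
  inner_op_smul_right {a ξ η} := by ext x; exact inner_smul_right _ _ _
  inner_smul_right_complex {z ξ η} := by ext x; exact inner_smul_right _ _ _
  star_inner ξ η := by ext x; exact inner_conj_symm _ _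
  norm_eq_sqrt_norm_inner_self ξ := by
    have h1 : ∀ x, ‖inner ℂ (ξ x) (ξ x)‖ = ‖ξ x‖ ^ 2 := fun x => by
      rw [inner_self_eq_norm_sq_to_K]; simp
    rw [eq_comm, Real.sqrt_eq_iff_mul_self_eq (norm_nonneg _) (norm_nonneg _), ← sq]
    refine le_antisymm ?_ ?_
    · rw [ContinuousMap.norm_le _ (by positivity)]
      intro x
      change ‖inner ℂ (ξ x) (ξ x)‖ ≤ _
      rw [h1]
      exact pow_le_pow_left₀ (norm_nonneg _) (ξ.norm_coe_le_norm x) 2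
    · have h2 : ‖ξ‖ ≤ √‖(⟨fun x => inner ℂ (ξ x) (ξ x), by fun_prop⟩ : C(X, ℂ))‖ := by
        rw [ContinuousMap.norm_le _ (Real.sqrt_nonneg _)]
        intro x
        refine Real.le_sqrt_of_sq_le ?_
        rw [← h1]
        exact ContinuousMap.norm_coe_le_norm
          (⟨fun x => inner ℂ (ξ x) (ξ x), by fun_prop⟩ : C(X, ℂ)) x
      exact (Real.le_sqrt (norm_nonneg _) (norm_nonneg _)).1 h2

instance instIsScalarTowerContinuousMap : IsScalarTower ℂ C(X, ℂ) C(X, H) where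
  smul_assoc c f ξ := by
    ext x
    exact smul_assoc c (f x) (ξ x)

variable (x : X)

theorem norm_toFibre (ξ : C(X, H)) : ‖toFibre x ξ‖ = ‖ξ x‖ := by
  rw [toFibre, UniformSpace.Completion.norm_coe, @norm_eq_sqrt_re_inner ℂ]
  change √(RCLike.re (inner ℂ (ξ x) (ξ x))) = _
  rw [← @norm_eq_sqrt_re_inner ℂ]

theorem toFibre_add (ξ η : C(X, H)) : toFibre x (ξ + η) = toFibre x ξ + toFibre x η :=
  UniformSpace.Completion.coe_add _ _

theorem toFibre_smul (c : ℂ) (ξ : C(X, H)) : toFibre x (c • ξ) = c • toFibre x ξ :=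
  (UniformSpace.Completion.toComplₗᵢ (𝕜 := ℂ) (E := PreFibre C(X, H) x)).map_smul c ξ

theorem toFibre_eq_of_apply_eq {ξ η : C(X, H)} (h : ξ x = η x) : toFibre x ξ = toFibre x η := by
  have h1 : ξ = η + (ξ - η) := by abel
  have h2 : toFibre x (ξ - η) = 0 := by
    rw [← norm_eq_zero, norm_toFibre]
    simp [h]
  rw [h1, toFibre_add, h2, add_zero]

variable [CompleteSpace H]

/-- The fibre of `C(X, H)` is `H`. -/
noncomputable def fibreEquiv : H ≃ₗᵢ[ℂ] Fibre C(X, H) x := by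
  refine LinearIsometryEquiv.ofSurjective
    { toFun := fun h => toFibre x (ContinuousMap.const X h)
      map_add' := fun h h' => toFibre_add x (ContinuousMap.const X h) (ContinuousMap.const X h')
      map_smul' := fun c h => toFibre_smul x c (ContinuousMap.const X h)
      norm_map' := fun h => norm_toFibre x _ } ?_
  set J : H →ₗᵢ[ℂ] Fibre C(X, H) x :=
    { toFun := fun h => toFibre x (ContinuousMap.const X h)
      map_add' := fun h h' => toFibre_add x (ContinuousMap.const X h) (ContinuousMap.const X h')
      map_smul' := fun c h => toFibre_smul x c (ContinuousMap.const X h)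
      norm_map' := fun h => norm_toFibre x _ }
  -- Since `ξ_x` depends only on `ξ x`, constant functions reach the whole dense image of the
  -- module; being an isometric image of a complete space, the range is closed.
  have hcl : IsClosed (Set.range J) := J.isometry.isClosedEmbedding.isClosed_range
  intro z
  refine UniformSpace.Completion.induction_on z hcl fun ξ => ?_
  exact ⟨(show C(X, H) from ξ) x, toFibre_eq_of_apply_eq x rfl⟩

theorem fibreEquiv_apply (ξ : C(X, H)) : fibreEquiv x (ξ x) = toFibre x ξ :=
  toFibre_eq_of_apply_eq x (ξ := ContinuousMap.const X (ξ x)) (η := ξ) rfl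

end HilbertCX

/-! ### Strong continuity of direct sums and their norms. -/

section BlockDiag

variable {I : Type*} {G : I → Type*} [∀ i, NormedAddCommGroup (G i)]
  [∀ i, InnerProductSpace ℂ (G i)]

theorem lp.finset_sum_apply_coord {α : Type*} (s : Finset α) (f : α → lp G 2) (i : I) :
    (∑ a ∈ s, f a : lp G 2) i = ∑ a ∈ s, f a i := by
  rw [lp.coeFn_sum, Finset.sum_apply]

/-- The sum of norm-continuous families need only be strongly continuous. Finitely supported vectors
present no difficulty, and the uniform bound `C` extends continuity to all vectors and then to
continuous `ξ`. -/
theorem lp.continuous_blockDiag_apply {X : Type*} [TopologicalSpace X]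
    {T : X → ∀ i, G i →L[ℂ] G i} {C : ℝ} (hT : ∀ y i, ‖T y i‖ ≤ C)
    (hcont : ∀ i, Continuous fun y => T y i) {ξ : X → lp G 2} (hξ : Continuous ξ) :
    Continuous fun y => lp.blockDiag (T y) C (hT y) (ξ y) := by
  classical
  have hle : ∀ y h, ‖lp.blockDiag (T y) C (hT y) h‖ ≤ |C| * ‖h‖ := fun y h =>
    (lp.blockDiag (T y) C (hT y)).le_of_opNorm_le (lp.norm_blockDiag_le _ _ _) h
  have hconst : ∀ h : lp G 2, Continuous fun y => lp.blockDiag (T y) C (hT y) h := by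
    intro h
    refine continuous_of_uniform_approx_of_continuous fun u hu => ?_
    obtain ⟨ε, hε, hεu⟩ := Metric.mem_uniformity_dist.1 hu
    have hs := lp.hasSum_single (p := 2) (by norm_num) h
    have hev := (Metric.tendsto_nhds.1 hs) (ε / (|C| + 1)) (by positivity)
    obtain ⟨s, hs⟩ := hev.exists
    refine ⟨fun y => lp.blockDiag (T y) C (hT y) (∑ i ∈ s, lp.single 2 i (h i)), ?_, fun y => ?_⟩
    · simp only [map_sum]
      refine continuous_finsetSum s fun i _ => ?_
      have h1 : ∀ y, lp.blockDiag (T y) C (hT y) (lp.single 2 i (h i))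
          = lp.single 2 i (T y i (h i)) := by
        intro y
        ext j
        rw [lp.blockDiag_apply]
        rcases eq_or_ne j i with rfl | hj
        · rw [lp.single_apply_self, lp.single_apply_self]
        · rw [lp.single_apply_ne _ _ _ hj, lp.single_apply_ne _ _ _ hj, map_zero]
      simp only [h1]
      exact (lp.isometry_single i).continuous.comp ((hcont i).clm_apply continuous_const)
    · refine hεu ?_
      rw [dist_eq_norm, ← map_sub]
      rw [dist_comm, dist_eq_norm] at hs
      refine (hle y _).trans_lt ?_
      rw [lt_div_iff₀ (by positivity)] at hs
      nlinarith [norm_nonneg (h - ∑ i ∈ s, lp.single 2 i (h i)), abs_nonneg C]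
  rw [continuous_iff_continuousAt]
  intro y₀
  have h1 : Tendsto (fun y => lp.blockDiag (T y) C (hT y) (ξ y - ξ y₀)) (𝓝 y₀) (𝓝 0) := by
    refine squeeze_zero_norm (fun y => hle y _) ?_
    have h : Continuous fun y => |C| * ‖ξ y - ξ y₀‖ := by fun_prop
    simpa using h.tendsto y₀
  have h2 := h1.add ((hconst (ξ y₀)).tendsto y₀)
  rw [ContinuousAt]
  simpa using h2

theorem lp.sum_norm_blockDiag_sq_le {κ : Type*} [Fintype κ] {T : κ → κ → ∀ i, G i →L[ℂ] G i}
    {C : κ → κ → ℝ} (hT : ∀ a b i, ‖T a b i‖ ≤ C a b) {N : ℝ}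
    (hN : ∀ i, ∀ ξ : κ → G i, ∑ a, ‖∑ b, T a b i (ξ b)‖ ^ 2 ≤ N ^ 2 * ∑ b, ‖ξ b‖ ^ 2)
    (ξ : κ → lp G 2) :
    ∑ a, ‖∑ b, lp.blockDiag (T a b) (C a b) (hT a b) (ξ b)‖ ^ 2 ≤ N ^ 2 * ∑ b, ‖ξ b‖ ^ 2 := by
  have h1 := hasSum_sum (s := Finset.univ) fun a _ =>
    lp.hasSum_norm_sq (∑ b, lp.blockDiag (T a b) (C a b) (hT a b) (ξ b))
  have h2 := (hasSum_sum (s := Finset.univ) fun b _ => lp.hasSum_norm_sq (ξ b)).mul_left (N ^ 2)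
  refine hasSum_le (fun i => ?_) h1 h2
  simp only [lp.finset_sum_apply_coord, lp.blockDiag_apply]
  exact hN i fun b => ξ b i

theorem lp.inner_blockDiag [∀ i, CompleteSpace (G i)] {T S : ∀ i, G i →L[ℂ] G i} {C C' : ℝ}
    (hT : ∀ i, ‖T i‖ ≤ C)
    (hS : ∀ i, ‖S i‖ ≤ C') (hTS : ∀ i, S i = ContinuousLinearMap.adjoint (T i)) (f g : lp G 2) :
    inner ℂ (lp.blockDiag T C hT f) g = inner ℂ f (lp.blockDiag S C' hS g) := by
  rw [lp.inner_eq_tsum, lp.inner_eq_tsum]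
  refine tsum_congr fun i => ?_
  rw [lp.blockDiag_apply, lp.blockDiag_apply, hTS, ContinuousLinearMap.adjoint_inner_right]

end BlockDiag

/-! ### Families of representations of the fibres and their direct sum. -/

namespace OperatorSystem

variable {X : Type*} [TopologicalSpace X] [CompactSpace X] [T2Space X]
    {A : Type*} [CStarAlgebra A] [PartialOrder A] [StarOrderedRing A]

/-- A family of completely contractive representations of the fibres. -/
structure FibreRep (X : Type*) [TopologicalSpace X] [CompactSpace X] {A : Type*} [CStarAlgebra A]
    [PartialOrder A] [StarOrderedRing A] (W : OperatorSystem A) [Module C(X, ℂ) W]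
    {I : Type*} (G : I → Type*) [∀ i, NormedAddCommGroup (G i)]
    [∀ i, InnerProductSpace ℂ (G i)] [∀ i, CompleteSpace (G i)] where
  toFun : ∀ i, X → W →ₗ[ℂ] (G i →L[ℂ] G i)
  map_smul : ∀ i y (f : C(X, ℂ)) w, toFun i y (f • w) = f y • toFun i y w
  map_adj : ∀ i y w, toFun i y (W.adj w) = ContinuousLinearMap.adjoint (toFun i y w)
  continuous : ∀ i w, Continuous fun y => toFun i y w
  bound : ∀ i (y : X) (k : ℕ) (w : Matrix (Fin k) (Fin k) W) (ξ : Fin k → G i),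
    ∑ a, ‖∑ b, toFun i y (w a b) (ξ b)‖ ^ 2 ≤
      W.fibreNorm y (w.map (W.toFibre y)) ^ 2 * ∑ b, ‖ξ b‖ ^ 2

variable {W : OperatorSystem A} [Module C(X, ℂ) W] [IsScalarTower ℂ C(X, ℂ) W]
    {I : Type*} {G : I → Type*} [∀ i, NormedAddCommGroup (G i)]
    [∀ i, InnerProductSpace ℂ (G i)] [∀ i, CompleteSpace (G i)]

theorem IsCXModule.fibreNorm_nonneg (hW : W.IsCXModule (X := X)) (y : X) {k : ℕ}
    (w : Matrix (Fin k) (Fin k) W) : 0 ≤ W.fibreNorm y (w.map (W.toFibre y)) := by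
  rw [hW.fibreNorm_eq_N]; exact (hW.matSystem (Fin k)).N_nonneg y w

namespace FibreRep

variable (hW : W.IsCXModule (X := X)) (F : FibreRep X W G)

theorem norm_apply_le (hW : W.IsCXModule (X := X)) (i : I) (y : X) (w : W) (ξ : G i) :
    ‖F.toFun i y w ξ‖ ≤ W.fibreNorm y
      ((Matrix.of fun _ _ => w : Matrix (Fin 1) (Fin 1) W).map (W.toFibre y)) * ‖ξ‖ := by
  have h1 := F.bound i y 1 (Matrix.of fun _ _ => w) fun _ => ξ
  simp only [Finset.univ_unique, Finset.sum_singleton, Matrix.of_apply] at h1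
  rw [← mul_pow] at h1
  exact le_of_sq_le_sq h1 (mul_nonneg (hW.fibreNorm_nonneg y _) (norm_nonneg _))

theorem norm_le (hW : W.IsCXModule (X := X)) (i : I) (y : X) (w : W) :
    ‖F.toFun i y w‖ ≤ ‖W.matIncl (Fin 1) (Matrix.of fun _ _ => w)‖ := by
  refine ContinuousLinearMap.opNorm_le_bound _ (norm_nonneg _) fun ξ => ?_
  refine (F.norm_apply_le hW i y w ξ).trans (mul_le_mul_of_nonneg_right ?_ (norm_nonneg _))
  rw [hW.fibreNorm_eq_N]; exact (hW.matSystem (Fin 1)).N_le_norm y _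

/-- The direct sum of the representations at a point. -/
noncomputable def atPoint (y : X) : W →ₗ[ℂ] (lp G 2 →L[ℂ] lp G 2) where
  toFun w := lp.blockDiag (fun i => F.toFun i y w) _ (fun i => F.norm_le hW i y w)
  map_add' w w' := by
    refine ContinuousLinearMap.ext fun h => lp.ext (funext fun i => ?_)
    change F.toFun i y (w + w') (h i) = F.toFun i y w (h i) + F.toFun i y w' (h i)
    rw [map_add]; rfl
  map_smul' c w := by
    refine ContinuousLinearMap.ext fun h => lp.ext (funext fun i => ?_)
    change F.toFun i y (c • w) (h i) = c • F.toFun i y w (h i)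
    rw [_root_.map_smul]; rfl

theorem atPoint_apply (y : X) (w : W) (h : lp G 2) (i : I) :
    F.atPoint hW y w h i = F.toFun i y w (h i) := rfl

theorem atPoint_smul (y : X) (f : C(X, ℂ)) (w : W) :
    F.atPoint hW y (f • w) = f y • F.atPoint hW y w := by
  refine ContinuousLinearMap.ext fun h => lp.ext (funext fun i => ?_)
  change F.toFun i y (f • w) (h i) = f y • F.toFun i y w (h i)
  rw [F.map_smul]; rfl

theorem continuous_atPoint (w : W) (ξ : C(X, lp G 2)) :
    Continuous fun y => F.atPoint hW y w (ξ y) :=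
  lp.continuous_blockDiag_apply (T := fun y i => F.toFun i y w)
    (fun y i => F.norm_le hW i y w) (fun i => F.continuous i w) ξ.continuous

theorem inner_atPoint (y : X) (w : W) (f g : lp G 2) :
    inner ℂ (F.atPoint hW y w f) g = inner ℂ f (F.atPoint hW y (W.adj w) g) :=
  lp.inner_blockDiag (fun i => F.norm_le hW i y w) (fun i => F.norm_le hW i y (W.adj w))
    (fun i => F.map_adj i y w) f g

theorem norm_atPoint_le (y : X) (w : W) (h : lp G 2) :
    ‖F.atPoint hW y w h‖ ≤ |‖W.matIncl (Fin 1) (Matrix.of fun _ _ => w)‖| * ‖h‖ :=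
  (F.atPoint hW y w).le_of_opNorm_le (lp.norm_blockDiag_le _ _ fun i => F.norm_le hW i y w) h

/-- The representation on the Hilbert module of the continuous functions with values in the direct
sum. -/
noncomputable def toModule : W →ₗ[C(X, ℂ)] (C(X, lp G 2) →ₗ[C(X, ℂ)] C(X, lp G 2)) where
  toFun w :=
    { toFun := fun ξ => ⟨fun y => F.atPoint hW y w (ξ y), F.continuous_atPoint hW w ξ⟩
      map_add' := fun ξ η => ContinuousMap.ext fun y => map_add (F.atPoint hW y w) _ _
      map_smul' := fun f ξ =>
        ContinuousMap.ext fun y => _root_.map_smul (F.atPoint hW y w) (f y) _ }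
  map_add' w w' := LinearMap.ext fun ξ => ContinuousMap.ext fun y => by
    change F.atPoint hW y (w + w') (ξ y) = F.atPoint hW y w (ξ y) + F.atPoint hW y w' (ξ y)
    rw [map_add]; rfl
  map_smul' f w := LinearMap.ext fun ξ => ContinuousMap.ext fun y => by
    change F.atPoint hW y (f • w) (ξ y) = f y • F.atPoint hW y w (ξ y)
    rw [F.atPoint_smul hW]; rfl

theorem toModule_apply (w : W) (ξ : C(X, lp G 2)) (y : X) :
    F.toModule hW w ξ y = F.atPoint hW y w (ξ y) := rfl

theorem isAdjointable_toModule (w : W) : HilbertCX.IsAdjointable (F.toModule hW w) := by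
  refine ⟨?_, F.toModule hW (W.adj w), fun ξ η => ?_⟩
  · refine AddMonoidHomClass.continuous_of_bound (F.toModule hW w)
      |‖W.matIncl (Fin 1) (Matrix.of fun _ _ => w)‖| fun ξ => ?_
    rw [ContinuousMap.norm_le _ (by positivity)]
    intro y
    refine (F.norm_atPoint_le hW y w (ξ y)).trans ?_
    exact mul_le_mul_of_nonneg_left (ξ.norm_coe_le_norm y) (abs_nonneg _)
  · ext y
    exact F.inner_atPoint hW y w (ξ y) (η y)

theorem sum_norm_atPoint_sq_le (y : X) {k : ℕ} (w : Matrix (Fin k) (Fin k) W)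
    (ξ : Fin k → lp G 2) : ∑ a, ‖∑ b, F.atPoint hW y (w a b) (ξ b)‖ ^ 2 ≤
      W.fibreNorm y (w.map (W.toFibre y)) ^ 2 * ∑ b, ‖ξ b‖ ^ 2 :=
  lp.sum_norm_blockDiag_sq_le (fun a b i => F.norm_le hW i y (w a b)) (fun i => F.bound i y k w) ξ

/-- The representation at a point, transported to the fibre of the Hilbert module. -/
noncomputable def onFibre (x : X) :
    W →ₗ[ℂ] (HilbertCX.Fibre C(X, lp G 2) x →L[ℂ] HilbertCX.Fibre C(X, lp G 2) x) where
  toFun w := (HilbertCX.fibreEquiv (H := lp G 2) x).toContinuousLinearEquiv.toContinuousLinearMap ∘L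
    F.atPoint hW x w ∘L
    (HilbertCX.fibreEquiv (H := lp G 2) x).symm.toContinuousLinearEquiv.toContinuousLinearMap
  map_add' w w' := by
    rw [map_add, ContinuousLinearMap.add_comp, ContinuousLinearMap.comp_add]
  map_smul' c w := by
    rw [_root_.map_smul, ContinuousLinearMap.smul_comp, ContinuousLinearMap.comp_smul]
    rfl

theorem onFibre_apply (x : X) (w : W) (z : HilbertCX.Fibre C(X, lp G 2) x) :
    F.onFibre hW x w z = HilbertCX.fibreEquiv x
      (F.atPoint hW x w ((HilbertCX.fibreEquiv x).symm z)) := rfl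

/-- The fibre norm vanishes on the kernel and bounds every member of the family. -/
theorem fibreKer_le_ker_onFibre (x : X) : W.fibreKer x ≤ LinearMap.ker (F.onFibre hW x) := by
  intro w hw
  have hR : ∀ i h, F.toFun i x w h = 0 := by
    intro i h
    have h1 := F.norm_apply_le hW i x w h
    have h0 : (hW.matSystem (Fin 1)).N x (Matrix.of fun _ _ => w) = 0 :=
      hW.N_eq_zero_of_mem_fibreKer fun _ _ => hw
    rw [hW.fibreNorm_eq_N, h0, zero_mul] at h1
    exact norm_le_zero_iff.1 h1
  have hT0 : F.atPoint hW x w = 0 :=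
    ContinuousLinearMap.ext fun h => lp.ext (funext fun i => hR i (h i))
  rw [LinearMap.mem_ker]
  refine ContinuousLinearMap.ext fun z => ?_
  rw [onFibre_apply, hT0]
  exact map_zero (HilbertCX.fibreEquiv x)

/-- The map induced on the fibre. -/
noncomputable def fibreMap (x : X) : W.Fibre x →ₗ[ℂ]
    (HilbertCX.Fibre C(X, lp G 2) x →L[ℂ] HilbertCX.Fibre C(X, lp G 2) x) :=
  (W.fibreKer x).liftQ (F.onFibre hW x) (F.fibreKer_le_ker_onFibre hW x)

theorem fibreMap_toFibre (x : X) (w : W) : F.fibreMap hW x (W.toFibre x w) = F.onFibre hW x w :=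
  rfl

theorem fibreMap_toFibre_toFibre (x : X) (w : W) (ξ : C(X, lp G 2)) :
    F.fibreMap hW x (W.toFibre x w) (HilbertCX.toFibre x ξ)
      = HilbertCX.toFibre x (F.toModule hW w ξ) := by
  rw [fibreMap_toFibre, onFibre_apply, ← HilbertCX.fibreEquiv_apply,
    LinearIsometryEquiv.symm_apply_apply, ← toModule_apply, HilbertCX.fibreEquiv_apply]

theorem norm_sum_onFibre (x : X) {k : ℕ} (w : Fin k → W)
    (ξ : Fin k → HilbertCX.Fibre C(X, lp G 2) x) :
    ‖∑ b, F.onFibre hW x (w b) (ξ b)‖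
      = ‖∑ b, F.atPoint hW x (w b) ((HilbertCX.fibreEquiv x).symm (ξ b))‖ := by
  have h : ∑ b, F.onFibre hW x (w b) (ξ b) = HilbertCX.fibreEquiv x
      (∑ b, F.atPoint hW x (w b) ((HilbertCX.fibreEquiv x).symm (ξ b))) := by
    rw [map_sum]
    rfl
  rw [h, LinearIsometryEquiv.norm_map]

/-- The members of the family determine all the matrix norms of the fibres. -/
def IsNorming (F : FibreRep X W G) : Prop :=
  ∀ (x : X) (k : ℕ) (w : Matrix (Fin k) (Fin k) W) (δ : ℝ), 0 < δ → ∃ i, ∀ M : ℝ, 0 < M →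
    (∀ ξ : Fin k → G i,
      ∑ a, ‖∑ b, F.toFun i x (w a b) (ξ b)‖ ^ 2 ≤ M ^ 2 * ∑ b, ‖ξ b‖ ^ 2) →
    W.fibreNorm x (w.map (W.toFibre x)) ≤ M * (1 + δ)

theorem IsNorming.norm_fibreMap {F : FibreRep X W G} (hF : F.IsNorming) (x : X) (k : ℕ)
    (y : Matrix (Fin k) (Fin k) (W.Fibre x)) :
    ‖(CStarMatrix.ofMatrix (y.map (F.fibreMap hW x)) : CStarMatrix (Fin k) (Fin k)
        (HilbertCX.Fibre C(X, lp G 2) x →L[ℂ] HilbertCX.Fibre C(X, lp G 2) x))‖ =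
      W.fibreNorm x y := by
  classical
  obtain ⟨w, rfl⟩ : ∃ w : Matrix (Fin k) (Fin k) W, w.map (W.toFibre x) = y := by
    choose w hw using fun a b => (W.fibreKer x).mkQ_surjective (y a b)
    exact ⟨Matrix.of w, Matrix.ext hw⟩
  set Q : CStarMatrix (Fin k) (Fin k)
    (HilbertCX.Fibre C(X, lp G 2) x →L[ℂ] HilbertCX.Fibre C(X, lp G 2) x) :=
    CStarMatrix.ofMatrix ((w.map (W.toFibre x)).map (F.fibreMap hW x)) with hQ
  have hentry : ∀ a b, Q a b = F.onFibre hW x (w a b) := fun a b => rfl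
  refine le_antisymm ?_ ?_
  · rw [CStarMatrix.norm_le_iff_sum_le _ (hW.fibreNorm_nonneg x _)]
    intro ξ
    simp only [hentry, F.norm_sum_onFibre hW]
    have h1 := F.sum_norm_atPoint_sq_le hW x w fun b => (HilbertCX.fibreEquiv x).symm (ξ b)
    simpa only [LinearIsometryEquiv.norm_map] using h1
  · have hM0 : 0 ≤ ‖Q‖ := norm_nonneg _
    -- For `δ < 1` one has `(‖Q‖ + δ) (1 + δ) ≤ ‖Q‖ + δ (‖Q‖ + 2)`; the summand `δ` keeps the bound
    -- positive when `Q = 0`.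
    refine le_of_forall_le_add_mul (K := ‖Q‖ + 2) fun δ hδ hδ1 => ?_
    obtain ⟨i, hi⟩ := hF x k w δ hδ
    have h1 := hi (‖Q‖ + δ) (by positivity) fun ξ => ?_
    · have h0 : δ * δ ≤ δ := mul_le_of_le_one_left hδ.le hδ1.le
      linarith
    -- `Q` is tested on vectors supported in the summand `i`; evaluating the image at `i` does not
    -- increase its norm.
    have h2 := (CStarMatrix.norm_le_iff_sum_le Q (by positivity : 0 ≤ ‖Q‖ + δ)).1
      (by linarith) fun b => HilbertCX.fibreEquiv x (lp.single 2 i (ξ b))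
    have h3 : ∀ b, ‖(lp.single 2 i (ξ b) : lp G 2)‖ = ‖ξ b‖ := fun b =>
      lp.norm_single (by norm_num) i (ξ b)
    simp only [hentry, F.norm_sum_onFibre hW, LinearIsometryEquiv.symm_apply_apply,
      LinearIsometryEquiv.norm_map, h3] at h2
    refine le_trans (Finset.sum_le_sum fun a _ => ?_) h2
    refine pow_le_pow_left₀ (norm_nonneg _) ?_ 2
    have h4 := lp.norm_apply_le_norm (p := 2) (by norm_num)
      (∑ b, F.atPoint hW x (w a b) (lp.single 2 i (ξ b)) : lp G 2) i
    rw [lp.finset_sum_apply_coord] at h4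
    simpa only [F.atPoint_apply hW, lp.single_apply_self] using h4

end FibreRep

end OperatorSystem

/-! ### The norming family of all completely contractive maps, and the theorem. -/

namespace OperatorSystem

variable {X : Type u} [TopologicalSpace X] [CompactSpace X] [T2Space X]
    {A : Type v} [CStarAlgebra A] [PartialOrder A] [StarOrderedRing A]
    {W : OperatorSystem A} [Module C(X, ℂ) W] [IsScalarTower ℂ C(X, ℂ) W]

variable (X W) in
/-- The completely contractive maps into matrices over `C(X)`, of all even sizes. -/
abbrev CCIndex : Type (max u v) :=
  Σ k : ℕ, {ψ : W →ₗ[C(X, ℂ)] Matrix (Fin k ⊕ Fin k) (Fin k ⊕ Fin k) C(X, ℂ) // IsCCMap ψ}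

theorem vecNormSq_ofLp {m : Type*} [Fintype m] (ξ : EuclideanSpace ℂ m) :
    vecNormSq (WithLp.ofLp ξ) = ‖ξ‖ ^ 2 :=
  (EuclideanSpace.norm_sq_eq ξ).symm

section

variable {m : Type*} [Fintype m] [DecidableEq m]

/-- The value at a point of a map into the matrices over `C(X)`, as an operator. -/
noncomputable def evalOperator (ψ : W →ₗ[C(X, ℂ)] Matrix m m C(X, ℂ)) (y : X) :
    W →ₗ[ℂ] (EuclideanSpace ℂ m →L[ℂ] EuclideanSpace ℂ m) where
  toFun w := Matrix.toEuclideanCLM (n := m) (𝕜 := ℂ) (evalMatrix ψ y w)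
  map_add' w w' := by rw [map_add, map_add]
  map_smul' c w := by rw [map_smul, map_smul, RingHom.id_apply]

theorem evalOperator_apply (ψ : W →ₗ[C(X, ℂ)] Matrix m m C(X, ℂ)) (y : X) (w : W) :
    evalOperator ψ y w = Matrix.toEuclideanCLM (n := m) (𝕜 := ℂ) (evalMatrix ψ y w) := rfl

theorem evalOperator_smul (ψ : W →ₗ[C(X, ℂ)] Matrix m m C(X, ℂ)) (y : X) (f : C(X, ℂ)) (w : W) :
    evalOperator ψ y (f • w) = f y • evalOperator ψ y w := by
  rw [evalOperator_apply, evalOperator_apply, evalMatrix_smul, map_smul]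

theorem IsCCMap.evalOperator_adj {ψ : W →ₗ[C(X, ℂ)] Matrix m m C(X, ℂ)} (hψ : IsCCMap ψ) (y : X)
    (w : W) : evalOperator ψ y (W.adj w) = ContinuousLinearMap.adjoint (evalOperator ψ y w) := by
  rw [evalOperator_apply, evalOperator_apply, hψ.adj, ← Matrix.star_eq_conjTranspose, map_star,
    ContinuousLinearMap.star_eq_adjoint]

theorem continuous_evalOperator (ψ : W →ₗ[C(X, ℂ)] Matrix m m C(X, ℂ)) (w : W) :
    Continuous fun y => evalOperator ψ y w := by
  have h : Continuous fun y => evalMatrix ψ y w :=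
    continuous_pi fun a => continuous_pi fun b => (ψ w a b).continuous
  let L : Matrix m m ℂ →ₗ[ℂ] (EuclideanSpace ℂ m →L[ℂ] EuclideanSpace ℂ m) :=
    { toFun := fun B => Matrix.toEuclideanCLM (n := m) (𝕜 := ℂ) B
      map_add' := fun B C => map_add _ B C
      map_smul' := fun c B => map_smul _ c B }
  exact L.continuous_of_finiteDimensional.comp h

theorem norm_sum_evalOperator_sq {κ : Type*} [Fintype κ]
    (ψ : W →ₗ[C(X, ℂ)] Matrix m m C(X, ℂ)) (y : X) (w : κ → W) (ξ : κ → EuclideanSpace ℂ m) :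
    ‖∑ b, evalOperator ψ y (w b) (ξ b)‖ ^ 2
      = vecNormSq (∑ b, Matrix.mulVec (evalMatrix ψ y (w b)) (WithLp.ofLp (ξ b))) := by
  rw [← vecNormSq_ofLp, WithLp.ofLp_sum]
  rfl

theorem IsCCMap.evalOperator_bound {ψ : W →ₗ[C(X, ℂ)] Matrix m m C(X, ℂ)} (hψ : IsCCMap ψ) (y : X)
    (k : ℕ) (w : Matrix (Fin k) (Fin k) W) (ξ : Fin k → EuclideanSpace ℂ m) :
    ∑ a, ‖∑ b, evalOperator ψ y (w a b) (ξ b)‖ ^ 2 ≤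
      W.fibreNorm y (w.map (W.toFibre y)) ^ 2 * ∑ b, ‖ξ b‖ ^ 2 := by
  simpa only [vecNormSq_ofLp, norm_sum_evalOperator_sq] using
    hψ.bound y k w fun b => WithLp.ofLp (ξ b)

end

variable (X W) in
/-- The family of all completely contractive maps into matrices over `C(X)`. -/
noncomputable def ccRep : FibreRep X W
    (fun i : CCIndex X W => EuclideanSpace ℂ (Fin i.1 ⊕ Fin i.1)) where
  toFun i := evalOperator i.2.1
  map_smul i := evalOperator_smul i.2.1
  map_adj i := i.2.2.evalOperator_adj
  continuous i := continuous_evalOperator i.2.1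
  bound i := i.2.2.evalOperator_bound

theorem IsCXModule.exists_ccIndex [TopologicalSpace.SeparableSpace W]
    (hW : W.IsCXModule (X := X))
    (hcont : ∀ (n : ℕ) (w : Matrix (Fin n) (Fin n) W),
      Continuous fun x : X => W.fibreNorm x (w.map (W.toFibre x)))
    (x : X) {k : ℕ} (w : Matrix (Fin k) (Fin k) W) {δ : ℝ} (hδ : 0 < δ) :
    ∃ i : CCIndex X W, ∀ M : ℝ, 0 < M →
      (∀ ξ : Fin k → EuclideanSpace ℂ (Fin i.1 ⊕ Fin i.1),
        ∑ a, ‖∑ b, evalOperator i.2.1 x (w a b) (ξ b)‖ ^ 2 ≤ M ^ 2 * ∑ b, ‖ξ b‖ ^ 2) →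
      W.fibreNorm x (w.map (W.toFibre x)) ≤ M * (1 + δ) := by
  obtain ⟨ψ, hψ, hM⟩ := hW.exists_isCCMap hcont x w hδ
  refine ⟨⟨k, ψ, hψ⟩, fun M hM0 hle => hM M hM0 fun η => ?_⟩
  have h := hle fun b => WithLp.toLp 2 (η b)
  simp only [norm_sum_evalOperator_sq] at h
  simpa only [← vecNormSq_ofLp] using h

theorem IsCXModule.exists_norming_fibreRep [TopologicalSpace.SeparableSpace W]
    (hW : W.IsCXModule (X := X))
    (hcont : ∀ (n : ℕ) (w : Matrix (Fin n) (Fin n) W),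
      Continuous fun x : X => W.fibreNorm x (w.map (W.toFibre x))) :
    ∃ (I : Type (max u v)) (G : I → Type) (_ : ∀ i, NormedAddCommGroup (G i))
      (_ : ∀ i, InnerProductSpace ℂ (G i)) (_ : ∀ i, CompleteSpace (G i)) (F : FibreRep X W G),
      F.IsNorming :=
  ⟨CCIndex X W, fun i => EuclideanSpace ℂ (Fin i.1 ⊕ Fin i.1), fun _ => inferInstance,
    fun _ => inferInstance, fun _ => inferInstance, ccRep X W,
    fun x _ w _ hδ => hW.exists_ccIndex hcont x w hδ⟩

end OperatorSystem

end

theorem proposition2p5 {X : Type u} [TopologicalSpace X] [CompactSpace X] [T2Space X]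
    {A : Type v} [CStarAlgebra A] [PartialOrder A] [StarOrderedRing A]
    (W : OperatorSystem A) [TopologicalSpace.SeparableSpace W]
    [Module C(X, ℂ) W] [IsScalarTower ℂ C(X, ℂ) W] (hW : W.IsCXModule (X := X))
    (hcont : ∀ (n : ℕ) (w : Matrix (Fin n) (Fin n) W),
      Continuous fun x : X => W.fibreNorm x (w.map (W.toFibre x))) :
    (Function.Injective (fun f : C(X, ℂ) => f • W.unit) →
      ∀ (n : ℕ) (x : X) (φ : W.Fibre x →ₗ[ℂ] CStarMatrix (Fin n) (Fin n) ℂ),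
        IsUCP (W.fibreUnit x) (W.fibreCone x) φ →
        ∃ ψ : W →ₗ[C(X, ℂ)] CStarMatrix (Fin n) (Fin n) C(X, ℂ),
          IsUCP W.unit W.matCone ψ ∧
          ∀ (w : W) (i j : Fin n), (ψ w i j) x = φ (W.toFibre x w) i j) ∧
    (∃ (E : Type (max u v)) (_ : NormedAddCommGroup E) (_ : NormedSpace ℂ E)
        (_ : Module C(X, ℂ) E) (_ : IsScalarTower ℂ C(X, ℂ) E) (_ : CStarModule C(X, ℂ) E)
        (_ : CompleteSpace E) (Φ : W →ₗ[C(X, ℂ)] (E →ₗ[C(X, ℂ)] E)),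
      (∀ w : W, HilbertCX.IsAdjointable (Φ w)) ∧
      ∀ x : X, ∃ Φx : W.Fibre x →ₗ[ℂ] (HilbertCX.Fibre E x →L[ℂ] HilbertCX.Fibre E x),
        (∀ (w : W) (ξ : E),
          Φx (W.toFibre x w) (HilbertCX.toFibre x ξ) = HilbertCX.toFibre x (Φ w ξ)) ∧
        ∀ (k : ℕ) (y : Matrix (Fin k) (Fin k) (W.Fibre x)),
          ‖(CStarMatrix.ofMatrix (y.map Φx) :
            CStarMatrix (Fin k) (Fin k) (HilbertCX.Fibre E x →L[ℂ] HilbertCX.Fibre E x))‖ =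
          W.fibreNorm x y) := by
  refine ⟨fun hinj n x φ hφ => ?_, ?_⟩
  -- For `n = 0` the target is the zero algebra, and the normalisation by `1 / n` is not available.
  · rcases Nat.eq_zero_or_pos n with rfl | hn
    · have h0 : ∀ a b : CStarMatrix (Fin 0) (Fin 0) C(X, ℂ), a = b := fun _ _ =>
        CStarMatrix.ext fun i => i.elim0
      refine ⟨0, ⟨h0 _ _, fun k M _ => le_of_eq ?_⟩, fun w i => i.elim0⟩
      exact CStarMatrix.ext fun _ _ => h0 _ _
    · have : Nonempty (Fin n) := ⟨⟨0, hn⟩⟩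
      exact hW.exists_ucp_extension hcont hinj x φ hφ
  · obtain ⟨I, G, _, _, _, F, hF⟩ := hW.exists_norming_fibreRep hcont
    exact ⟨C(X, lp G 2), inferInstance, inferInstance, inferInstance, inferInstance, inferInstance,
      inferInstance, F.toModule hW, F.isAdjointable_toModule hW, fun x =>
        ⟨F.fibreMap hW x, F.fibreMap_toFibre_toFibre hW x, hF.norm_fibreMap hW x⟩⟩
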